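/- Let $k$ be a field of characteristic $0$, let $X$ be a smooth algebraic variety over $k$ (a smooth separated $k$-scheme of finite type) with a bivector $P\in H^0(X,\wedge^2T_X)$, and let $i:Y\hookrightarrow X$ be a smooth closed subvariety with ideal sheaf $I_Y$ which is coisotropic, i.e. $P(dI_Y,dI_Y)\subset I_Y$. Write $N^\vee=I_Y/I_Y^2$ for the conormal bundle and $N$ for the normal bundle of $Y$ in $X$, let $p:N^\vee\to T_Y$ be the morphism induced by $P$ and $p^*:\Omega^1_Y\to N$ its adjoint. For a vector bundle $E$ on $Y$ put $\mathcal O_Y(E)=\mathcal End_{\mathcal O_Y}(E)$, $N(E)=N\otimes_{\mathcal O_Y}\mathcal End_{\mathcal O_Y}(E)$ and $\Omega^1_Y(E)=\Omega^1_Y\otimes_{\mathcal O_Y}\mathcal End_{\mathcal O_Y}(E)$, let $at(E)\in H^1(Y,\Omega^1_Y(E))$ be the Atiyah class and $at_N(E)=p^*at(E)\in H^1(Y,N(E))$. Fix a first order deformation quantization $\mathcal A_1$ of $\mathcal O_X$: a sheaf of $k[\epsilon]/\epsilon^2$-algebras with a reduction $\mathcal A_1\to\mathcal O_X$ modulo $\epsilon$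 which, on the members of an affine open cover of $X$, is isomorphic to $\mathcal O_X\oplus\epsilon\mathcal O_X$ as a sheaf of $k[\epsilon]/\epsilon^2$-modules (compatibly with the reductions), with product $a*b=ab+\frac{\epsilon}{2}P(da,db)$. A *first order deformation* of a vector bundle $E$ on $Y$ is a sheaf $\mathcal E_1$ of $\mathcal A_1$-modules with a reduction $\mathcal E_1\to i_*E$ modulo $\epsilon$ such that, on the members of an affine open cover of $X$, $\mathcal A_1$ splits as above, $\mathcal E_1\simeq E\oplus\epsilon E$ as sheaves of $k[\epsilon]/\epsilon^2$-modules (compatibly with the reductions), and the action takes the form $a*e=ae+\epsilon\,\alpha(a,e)$ with $\alpha$ a bidifferential operator. Isomorphisms of first order deformations of $E$ are isomorphisms of $\mathcal A_1$-modules that restrict to the identity of $E$ modulo $\epsilon$. For such an $\mathcal E_1$, a local section $x$ of $\mathcal A_1$ whose reduction lies in $I_Y$, and a local section $e$ of $E$ with a lift $s$ to $\mathcal E_1$, locally $xs=\epsilon t$ for some $t$; write $\gamma_{\mathcal E_1}(x,e)$ for the reduction of $t$ in $E$. Let $E$ be a vector bundle on $Y$. (1) For every first order deformation $\mathcal E_1$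 of $E$, the group of automorphisms of the $\mathcal A_1$-module $\mathcal E_1$ which restrict to the identity modulo $\epsilon$ is isomorphic to the additive group $H^0(Y,\mathcal O_Y(E))$; the isomorphism sends $\phi$ to the $\phi_1$ with $\phi=1+\epsilon\phi_1$. (2) Let $L$ be a line bundle on $Y$ which admits a first order deformation. If $H^1(Y,\mathcal O_Y(E))=H^2(Y,\mathcal O_Y(E))=0$ and $at_N(E\otimes_{\mathcal O_Y}L^\vee)=0$, then the set of isomorphism classes of first order deformations of $E$ is (non-empty and) a torsor over $H^0(Y,N(E))$; the torsor structure is given by $[\mathcal E_1']=\zeta+[\mathcal E_1]$ if and only if $\gamma_{\mathcal E_1'}(x,e)=\gamma_{\mathcal E_1}(x,e)+\zeta(\bar x)e$ for all local sections $x$, $e$ as above, where $\bar x\in I_Y$ is the reduction of $x$. -/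

import Mathlib

open CategoryTheory AlgebraicGeometry TopologicalSpace Opposite

universe u

namespace DefQuant

noncomputable section

/-! ### Sections and restriction maps -/

/-- Restriction of regular functions to a smaller open set. -/
def resO {Y : Scheme.{u}} {V W : Y.Opens} (h : W ≤ V) : Γ(Y, V) →+* Γ(Y, W) :=
  (Y.presheaf.map (homOfLE h).op).hom

lemma resO_resO {Y : Scheme.{u}} {V W Z : Y.Opens} (h : W ≤ V) (h' : Z ≤ W) (b : Γ(Y, V)) :
    resO h' (resO h b) = resO (h'.trans h) b := by
  have := Y.presheaf.map_comp (homOfLE h).op (homOfLE h').op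
  exact (congr($(this).hom b)).symm

/-- The sections over `V` of a presheaf of `𝒪_Y`-modules. -/
def Sec {Y : Scheme.{u}} (M : Y.PresheafOfModules) (V : Y.Opens) : Type u :=
  M.obj (op V)

instance {Y : Scheme.{u}} (M : Y.PresheafOfModules) (V : Y.Opens) : AddCommGroup (Sec M V) :=
  inferInstanceAs (AddCommGroup (M.obj (op V)))

instance {Y : Scheme.{u}} (M : Y.PresheafOfModules) (V : Y.Opens) : Module Γ(Y, V) (Sec M V) :=
  (M.obj (op V)).isModule

/-- Restriction of sections of a presheaf of modules. -/
def res {Y : Scheme.{u}} (M : Y.PresheafOfModules) {V W : Y.Opens} (h : W ≤ V) :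
    Sec M V →+ Sec M W :=
  (M.presheaf.map (homOfLE h).op).hom

lemma res_res {Y : Scheme.{u}} (M : Y.PresheafOfModules) {V W Z : Y.Opens}
    (h : W ≤ V) (h' : Z ≤ W) (m : Sec M V) :
    res M h' (res M h m) = res M (h'.trans h) m := by
  have := M.presheaf.map_comp (homOfLE h).op (homOfLE h').op
  exact (congr($(this).hom m)).symm

lemma res_smul {Y : Scheme.{u}} (M : Y.PresheafOfModules) {V W : Y.Opens}
    (h : W ≤ V) (b : Γ(Y, V)) (m : Sec M V) :
    res M h (b • m) = resO h b • res M h m :=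
  M.map_smul (homOfLE h).op b m

/-! ### Sheaves of homomorphisms -/

/-- Homomorphisms of `𝒪_Y`-modules `M|_V → N|_V`. -/
def LocalHom {Y : Scheme.{u}} (M N : Y.PresheafOfModules) (V : Y.Opens) :
    AddSubgroup (∀ W : {W : Y.Opens // W ≤ V}, Sec M W.1 →ₗ[Γ(Y, W.1)] Sec N W.1) where
  carrier := {f | ∀ (W W' : {W : Y.Opens // W ≤ V}) (h : W'.1 ≤ W.1) (m : Sec M W.1),
    f W' (res M h m) = res N h (f W m)}
  zero_mem' := by intro W W' h m; simp
  add_mem' := by intro f g hf hg W W' h m; simp [hf W W' h m, hg W W' h m]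
  neg_mem' := by intro f hf W W' h m; simp [hf W W' h m]

namespace LocalHom

variable {Y : Scheme.{u}} {M N : Y.PresheafOfModules}

/-- Restriction of a local homomorphism to a smaller open set. -/
def restrict {V V' : Y.Opens} (h : V' ≤ V) : LocalHom M N V →+ LocalHom M N V' where
  toFun f := ⟨fun W => f.1 ⟨W.1, W.2.trans h⟩, fun W W' h' m =>
    f.2 ⟨W.1, W.2.trans h⟩ ⟨W'.1, W'.2.trans h⟩ h' m⟩
  map_zero' := rfl
  map_add' _ _ := rfl

instance (V : Y.Opens) : SMul Γ(Y, V) (LocalHom M N V) where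
  smul b f := ⟨fun W => resO W.2 b • f.1 W, fun W W' h m => by
    simp [f.2 W W' h m, res_smul, resO_resO]⟩

instance (V : Y.Opens) : Module Γ(Y, V) (LocalHom M N V) where
  one_smul f := Subtype.ext (funext fun W => by
    change resO W.2 1 • f.1 W = f.1 W; rw [map_one, one_smul])
  mul_smul a b f := Subtype.ext (funext fun W => by
    change resO W.2 (a * b) • f.1 W = resO W.2 a • resO W.2 b • f.1 W; rw [map_mul, mul_smul])
  smul_zero a := Subtype.ext (funext fun W => by
    change resO W.2 a • (0 : Sec M W.1 →ₗ[Γ(Y, W.1)] Sec N W.1) = 0; rw [smul_zero])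
  smul_add a f g := Subtype.ext (funext fun W => by
    change resO W.2 a • (f.1 W + g.1 W) = resO W.2 a • f.1 W + resO W.2 a • g.1 W
    rw [smul_add])
  add_smul a b f := Subtype.ext (funext fun W => by
    change resO W.2 (a + b) • f.1 W = resO W.2 a • f.1 W + resO W.2 b • f.1 W
    rw [map_add, add_smul])
  zero_smul f := Subtype.ext (funext fun W => by
    change resO W.2 0 • f.1 W = 0; rw [map_zero, zero_smul])

lemma restrict_smul {V V' : Y.Opens} (h : V' ≤ V) (b : Γ(Y, V)) (f : LocalHom M N V) :
    restrict h (b • f) = resO h b • restrict h f :=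
  Subtype.ext (funext fun W => by
    change resO (W.2.trans h) b • f.1 ⟨W.1, W.2.trans h⟩ =
      resO W.2 (resO h b) • f.1 ⟨W.1, W.2.trans h⟩
    rw [resO_resO])

end LocalHom

/-- The sheaf of abelian groups `ℋom_{𝒪_Y}(M, N)`. -/
def homPresheaf {Y : Scheme.{u}} (M N : Y.PresheafOfModules) :
    TopCat.Presheaf AddCommGrpCat.{u} Y where
  obj V := AddCommGrpCat.of (LocalHom M N V.unop)
  map f := AddCommGrpCat.ofHom (LocalHom.restrict f.unop.le)
  map_id _ := rfl
  map_comp _ _ := rfl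

instance {Y : Scheme.{u}} (M N : Y.PresheafOfModules) (V : (Opens Y)ᵒᵖ) :
    Module (Y.ringCatSheaf.obj.obj V) ((homPresheaf M N).obj V) :=
  inferInstanceAs (Module Γ(Y, V.unop) (LocalHom M N V.unop))

/-- The `𝒪_Y`-module `ℋom_{𝒪_Y}(M, N)`. -/
def homModule {Y : Scheme.{u}} (M N : Y.PresheafOfModules) : Y.PresheafOfModules :=
  PresheafOfModules.ofPresheaf (homPresheaf M N) fun _ _ f b φ =>
    LocalHom.restrict_smul (M := M) (N := N) f.unop.le b φ

/-- The sheaf `𝒪_Y(E) = ℰnd_{𝒪_Y}(E)` as a sheaf of abelian groups. -/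
abbrev endPresheaf {Y : Scheme.{u}} (E : Y.PresheafOfModules) :
    TopCat.Presheaf AddCommGrpCat.{u} Y :=
  homPresheaf E E

/-! ### Vector bundles -/

/-- The sections `s` form a basis of `M|_V`. -/
def IsFrame {Y : Scheme.{u}} (M : Y.PresheafOfModules) {V : Y.Opens} {n : ℕ}
    (s : Fin n → Sec M V) : Prop :=
  ∀ (W : Y.Opens) (h : W ≤ V) (m : Sec M W),
    ∃! c : Fin n → Γ(Y, W), m = ∑ j, c j • res M h (s j)

/-- `M` is locally free of finite rank. -/
def IsVectorBundle {Y : Scheme.{u}} (M : Y.PresheafOfModules) : Prop :=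
  ∀ y : Y, ∃ (V : Y.Opens) (_ : y ∈ V) (n : ℕ) (s : Fin n → Sec M V), IsFrame M s

/-- `M` is locally free of rank one. -/
def IsLineBundle {Y : Scheme.{u}} (M : Y.PresheafOfModules) : Prop :=
  ∀ y : Y, ∃ (V : Y.Opens) (_ : y ∈ V) (s : Fin 1 → Sec M V), IsFrame M s

/-! ### Čech cohomology -/

/-- Open covers indexed by the points of `Y`, the set with index `y` being a neighbourhood of `y`.
Every open cover is refined by one of these. -/
structure PointedCover (Y : Scheme.{u}) : Type u where
  /-- the neighbourhoods -/
  nhd : Y → Y.Opens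
  mem : ∀ y, y ∈ nhd y

/-- `𝒱 ≤ 𝒲` if `𝒲` refines `𝒱` index by index. -/
instance (Y : Scheme.{u}) : Preorder (PointedCover Y) where
  le 𝒱 𝒲 := ∀ y, 𝒲.nhd y ≤ 𝒱.nhd y
  le_refl _ _ := le_rfl
  le_trans _ _ _ h h' y := (h' y).trans (h y)

namespace Cech

variable {Y : Scheme.{u}} (F G H : TopCat.Presheaf AddCommGrpCat.{u} Y)

/-- Restriction of sections of a presheaf of abelian groups. -/
def resF {V W : Y.Opens} (h : W ≤ V) : F.obj (op V) →+ F.obj (op W) :=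
  (F.map (homOfLE h).op).hom

variable {F} in
lemma resF_resF {V W Z : Y.Opens} (h : W ≤ V) (h' : Z ≤ W) (m : F.obj (op V)) :
    resF F h' (resF F h m) = resF F (h'.trans h) m := by
  have := F.map_comp (homOfLE h).op (homOfLE h').op
  exact (congr($(this).hom m)).symm

variable {F G} in
lemma resF_app (η : F ⟶ G) {V W : Y.Opens} (h : W ≤ V) (m : F.obj (op V)) :
    (η.app (op W)).hom (resF F h m) = resF G h ((η.app (op V)).hom m) :=
  congr($(η.naturality (homOfLE h).op).hom m)

/-- The intersection `V_{s 0} ∩ ⋯ ∩ V_{s (m-1)}`. -/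
def inter (𝒱 : PointedCover Y) {m : ℕ} (s : Fin m → Y) : Y.Opens := ⨅ j, 𝒱.nhd (s j)

lemma inter_le (𝒱 : PointedCover Y) {m : ℕ} (s : Fin m → Y) (j : Fin m) :
    inter 𝒱 s ≤ 𝒱.nhd (s j) := iInf_le _ j

lemma inter_comp (𝒱 : PointedCover Y) {m l : ℕ} (s : Fin m → Y) (a : Fin l → Fin m) :
    inter 𝒱 s ≤ inter 𝒱 (s ∘ a) := le_iInf fun j => iInf_le _ (a j)

lemma inter_mono {𝒱 𝒲 : PointedCover Y} (h : 𝒱 ≤ 𝒲) {m : ℕ} (s : Fin m → Y) :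
    inter 𝒲 s ≤ inter 𝒱 s := iInf_mono fun j => h (s j)

/-- Čech cochains of degree `n`. -/
abbrev Cochain (𝒱 : PointedCover Y) (n : ℕ) : Type u :=
  ∀ s : Fin (n + 1) → Y, F.obj (op (inter 𝒱 s))

/-- The Čech differential. -/
def d (𝒱 : PointedCover Y) (n : ℕ) : Cochain F 𝒱 n →+ Cochain F 𝒱 (n + 1) where
  toFun c s := ∑ j : Fin (n + 2),
    (-1 : ℤ) ^ (j : ℕ) • resF F (inter_comp 𝒱 s j.succAbove) (c (s ∘ j.succAbove))
  map_zero' := by funext s; simp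
  map_add' c c' := by funext s; simp [Finset.sum_add_distrib]

/-- Čech cocycles of degree `n`. -/
abbrev Z (𝒱 : PointedCover Y) (n : ℕ) : AddSubgroup (Cochain F 𝒱 n) := (d F 𝒱 n).ker

variable {F} in
lemma mem_Z_one {𝒱 : PointedCover Y} {c : Cochain F 𝒱 1}
    (h : ∀ s : Fin 3 → Y,
      resF F (inter_comp 𝒱 s (Fin.succAbove 0)) (c (s ∘ Fin.succAbove 0)) -
        resF F (inter_comp 𝒱 s (Fin.succAbove 1)) (c (s ∘ Fin.succAbove 1)) +
        resF F (inter_comp 𝒱 s (Fin.succAbove 2)) (c (s ∘ Fin.succAbove 2)) = 0) :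
    c ∈ Z F 𝒱 1 := by
  refine AddMonoidHom.mem_ker.2 (funext fun s => ?_)
  refine Eq.trans ?_ (h s)
  change ∑ j : Fin 3, (-1 : ℤ) ^ (j : ℕ) • resF F (inter_comp 𝒱 s j.succAbove)
    (c (s ∘ j.succAbove)) = _
  rw [Fin.sum_univ_three]
  simp [sub_eq_add_neg]

/-- Čech coboundaries of degree `n`. -/
def B (𝒱 : PointedCover Y) : (n : ℕ) → AddSubgroup (Cochain F 𝒱 n)
  | 0 => ⊥
  | n + 1 => (d F 𝒱 n).range

/-- The Čech cohomology of a cover. -/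
abbrev HCover (𝒱 : PointedCover Y) (n : ℕ) : Type u :=
  Z F 𝒱 n ⧸ (B F 𝒱 n).addSubgroupOf (Z F 𝒱 n)

/-- Restriction of cochains to a finer cover. -/
def refineCochain {𝒱 𝒲 : PointedCover Y} (h : 𝒱 ≤ 𝒲) (n : ℕ) : Cochain F 𝒱 n →+ Cochain F 𝒲 n where
  toFun c s := resF F (inter_mono h s) (c s)
  map_zero' := by funext s; simp
  map_add' c c' := by funext s; simp

lemma refineCochain_d {𝒱 𝒲 : PointedCover Y} (h : 𝒱 ≤ 𝒲) (n : ℕ) (c : Cochain F 𝒱 n) :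
    d F 𝒲 n (refineCochain F h n c) = refineCochain F h (n + 1) (d F 𝒱 n c) := by
  funext s
  simp only [d, refineCochain, AddMonoidHom.coe_mk, ZeroHom.coe_mk, map_sum, map_zsmul, resF_resF]

/-- Action of a morphism of presheaves on cochains. -/
def mapCochain {F G : TopCat.Presheaf AddCommGrpCat.{u} Y} (η : F ⟶ G) (𝒱 : PointedCover Y)
    (n : ℕ) : Cochain F 𝒱 n →+ Cochain G 𝒱 n where
  toFun c s := (η.app _).hom (c s)
  map_zero' := by funext s; simp
  map_add' c c' := by funext s; simp

lemma mapCochain_d {F G : TopCat.Presheaf AddCommGrpCat.{u} Y} (η : F ⟶ G) (𝒱 : PointedCover Y)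
    (n : ℕ) (c : Cochain F 𝒱 n) :
    d G 𝒱 n (mapCochain η 𝒱 n c) = mapCochain η 𝒱 (n + 1) (d F 𝒱 n c) := by
  funext s
  simp only [d, mapCochain, AddMonoidHom.coe_mk, ZeroHom.coe_mk, map_sum, map_zsmul, resF_app]

variable {F G} in
/-- A map on cochains that commutes with the differentials acts on cohomology. -/
def mapH {𝒱 𝒲 : PointedCover Y} (φ : ∀ n, Cochain F 𝒱 n →+ Cochain G 𝒲 n)
    (hφ : ∀ n c, d G 𝒲 n (φ n c) = φ (n + 1) (d F 𝒱 n c)) (n : ℕ) :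
    HCover F 𝒱 n →+ HCover G 𝒲 n :=
  QuotientAddGroup.map _ _
    (((φ n).comp (Z F 𝒱 n).subtype).codRestrict (Z G 𝒲 n) fun c => by
      rw [AddMonoidHom.mem_ker]
      change d G 𝒲 n (φ n c.1) = 0
      rw [hφ, (AddMonoidHom.mem_ker).1 c.2, map_zero])
    (by
      rintro ⟨c, hc⟩ hB
      change φ n c ∈ B G 𝒲 n
      replace hB : c ∈ B F 𝒱 n := hB
      cases n with
      | zero =>
        have : c = 0 := hB
        rw [this, map_zero]; exact zero_mem _
      | succ n =>
        obtain ⟨b, rfl⟩ := hB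
        exact ⟨φ n b, hφ n b⟩)

/-- Čech cohomology `Ȟⁿ(Y, F)`, the direct limit over all open covers. -/
def HLim (n : ℕ) : Type u :=
  letI := Classical.decEq (PointedCover Y)
  AddCommGroup.DirectLimit (fun 𝒱 : PointedCover Y => HCover F 𝒱 n)
    fun _ _ h => mapH (refineCochain F h) (refineCochain_d F h) n

instance (n : ℕ) : AddCommGroup (HLim F n) :=
  letI := Classical.decEq (PointedCover Y)
  AddCommGroup.DirectLimit.addCommGroup _ _

variable {F} in
/-- The class in `Ȟⁿ(Y, F)` of a cocycle on a cover. -/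
def mk {n : ℕ} (𝒱 : PointedCover Y) (c : Z F 𝒱 n) : HLim F n :=
  letI := Classical.decEq (PointedCover Y)
  AddCommGroup.DirectLimit.of (fun 𝒱 : PointedCover Y => HCover F 𝒱 n)
    (fun _ _ h => mapH (refineCochain F h) (refineCochain_d F h) n) 𝒱 (QuotientAddGroup.mk c)

variable {F G} in
/-- The map on Čech cohomology that is induced by a morphism of presheaves. -/
def map (η : F ⟶ G) (n : ℕ) : HLim F n →+ HLim G n :=
  letI := Classical.decEq (PointedCover Y)
  AddCommGroup.DirectLimit.map (fun 𝒱 => mapH (mapCochain η 𝒱) (mapCochain_d η 𝒱) n)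
    (by
      intro 𝒱 𝒲 h
      ext c
      obtain ⟨c, hc⟩ := c
      simp only [mapH, AddMonoidHom.comp_apply, QuotientAddGroup.mk'_apply,
        QuotientAddGroup.map_mk]
      congr 1
      apply Subtype.ext
      funext s
      exact resF_app η _ _)

end Cech

/-! ### Schemes over a field: constants, vector fields, bivectors -/

/-- The constants `k → 𝒪_X(V)` of a `k`-scheme. -/
def const {k : Type u} [Field k] {X : Scheme.{u}} (sX : X ⟶ Spec (.of k)) (V : X.Opens) :
    k →+* Γ(X, V) :=
  ((Scheme.ΓSpecIso (.of k)).inv ≫ sX.appLE ⊤ V le_top).hom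

lemma resO_const {k : Type u} [Field k] {X : Scheme.{u}} (sX : X ⟶ Spec (.of k)) {V W : X.Opens}
    (h : W ≤ V) (c : k) : resO h (const sX V c) = const sX W c := by
  have := Scheme.Hom.appLE_map sX (U := ⊤) (V := V) (V' := W) le_top (homOfLE h).op
  exact congr($(this).hom ((Scheme.ΓSpecIso (.of k)).inv.hom c))

/-- Pullback of functions along `i`. -/
def pull {X Y : Scheme.{u}} (i : Y ⟶ X) (U : X.Opens) : Γ(X, U) →+* Γ(Y, i ⁻¹ᵁ U) :=
  (i.app U).hom

lemma preimage_le {X Y : Scheme.{u}} (i : Y ⟶ X) {U U' : X.Opens} (h : U' ≤ U) :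
    i ⁻¹ᵁ U' ≤ i ⁻¹ᵁ U := fun _ hy => h hy

lemma resO_pull {X Y : Scheme.{u}} (i : Y ⟶ X) {U U' : X.Opens} (h : U' ≤ U) (a : Γ(X, U)) :
    resO (preimage_le i h) (pull i U a) = pull i U' (resO h a) :=
  congr($(i.naturality (homOfLE h).op).hom a).symm

lemma pull_const {k : Type u} [Field k] {X Y : Scheme.{u}} (sX : X ⟶ Spec (.of k)) (i : Y ⟶ X)
    (U : X.Opens) (c : k) : pull i U (const sX U c) = const (i ≫ sX) (i ⁻¹ᵁ U) c := by
  have := Scheme.Hom.appLE_comp_appLE i sX ⊤ U (i ⁻¹ᵁ U) le_top le_rfl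
  rw [Scheme.Hom.appLE_eq_app] at this
  exact congr($(this).hom ((Scheme.ΓSpecIso (.of k)).inv.hom c))

/-- The sections over `U` of the ideal sheaf `I_Y` of functions that vanish on `Y`. -/
def idealSec {X Y : Scheme.{u}} (i : Y ⟶ X) (U : X.Opens) : Ideal Γ(X, U) :=
  RingHom.ker (pull i U)

lemma mem_idealSec {X Y : Scheme.{u}} {i : Y ⟶ X} {U : X.Opens} {x : Γ(X, U)} :
    x ∈ idealSec i U ↔ pull i U x = 0 := RingHom.mem_ker

/-- Restriction of functions that vanish on `Y`. -/
def resI {X Y : Scheme.{u}} (i : Y ⟶ X) {U U' : X.Opens} (h : U' ≤ U) (x : idealSec i U) :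
    idealSec i U' :=
  ⟨resO h x.1, by
    rw [mem_idealSec, ← resO_pull i h, mem_idealSec.1 x.2, map_zero]⟩

/-- Sections over `V` of the tangent sheaf `T_Y = 𝒟er_k(𝒪_Y)`. -/
def Tangent {k : Type u} [Field k] {Y : Scheme.{u}} (sY : Y ⟶ Spec (.of k)) (V : Y.Opens) :
    AddSubgroup (∀ W : {W : Y.Opens // W ≤ V}, Γ(Y, W.1) →+ Γ(Y, W.1)) where
  carrier := {θ |
    (∀ (W : {W : Y.Opens // W ≤ V}) (c : k), θ W (const sY W.1 c) = 0) ∧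
    (∀ (W : {W : Y.Opens // W ≤ V}) (a b : Γ(Y, W.1)), θ W (a * b) = a * θ W b + b * θ W a) ∧
    ∀ (W W' : {W : Y.Opens // W ≤ V}) (h : W'.1 ≤ W.1) (a : Γ(Y, W.1)),
      θ W' (resO h a) = resO h (θ W a)}
  zero_mem' := ⟨fun W c => by simp, fun W a b => by simp, fun W W' h a => by simp⟩
  add_mem' := by
    rintro θ η ⟨h1, h2, h3⟩ ⟨g1, g2, g3⟩
    refine ⟨fun W c => ?_, fun W a b => ?_, fun W W' h a => ?_⟩
    · simp [h1 W c, g1 W c]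
    · simp only [Pi.add_apply, AddMonoidHom.add_apply, h2 W a b, g2 W a b]; ring
    · simp [h3 W W' h a, g3 W W' h a]
  neg_mem' := by
    rintro θ ⟨h1, h2, h3⟩
    refine ⟨fun W c => ?_, fun W a b => ?_, fun W W' h a => ?_⟩
    · simp [h1 W c]
    · simp only [Pi.neg_apply, AddMonoidHom.neg_apply, h2 W a b]; ring
    · simp [h3 W W' h a]

namespace Tangent

variable {k : Type u} [Field k] {Y : Scheme.{u}} {sY : Y ⟶ Spec (.of k)}

/-- Restriction of vector fields. -/
def restrict {V V' : Y.Opens} (h : V' ≤ V) : Tangent sY V →+ Tangent sY V' where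
  toFun θ := ⟨fun W => θ.1 ⟨W.1, W.2.trans h⟩,
    fun W c => θ.2.1 ⟨W.1, W.2.trans h⟩ c,
    fun W a b => θ.2.2.1 ⟨W.1, W.2.trans h⟩ a b,
    fun W W' h' a => θ.2.2.2 ⟨W.1, W.2.trans h⟩ ⟨W'.1, W'.2.trans h⟩ h' a⟩
  map_zero' := rfl
  map_add' _ _ := rfl

instance (V : Y.Opens) : SMul Γ(Y, V) (Tangent sY V) where
  smul b θ := ⟨fun W => (AddMonoidHom.mulLeft (resO W.2 b)).comp (θ.1 W),
    fun W c => by simp [θ.2.1 W c],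
    fun W a a' => by
      simp only [AddMonoidHom.comp_apply, AddMonoidHom.coe_mulLeft, θ.2.2.1 W a a']; ring,
    fun W W' h a => by
      simp only [AddMonoidHom.comp_apply, AddMonoidHom.coe_mulLeft, θ.2.2.2 W W' h a, map_mul,
        resO_resO]⟩

lemma smul_apply {V : Y.Opens} (b : Γ(Y, V)) (θ : Tangent sY V) (W : {W : Y.Opens // W ≤ V})
    (a : Γ(Y, W.1)) : (b • θ).1 W a = resO W.2 b * θ.1 W a := rfl

lemma add_apply {V : Y.Opens} (θ η : Tangent sY V) (W : {W : Y.Opens // W ≤ V})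
    (a : Γ(Y, W.1)) : (θ + η).1 W a = θ.1 W a + η.1 W a := rfl

lemma zero_apply {V : Y.Opens} (W : {W : Y.Opens // W ≤ V})
    (a : Γ(Y, W.1)) : (0 : Tangent sY V).1 W a = 0 := rfl

lemma ext {V : Y.Opens} {θ η : Tangent sY V}
    (h : ∀ (W : {W : Y.Opens // W ≤ V}) (a : Γ(Y, W.1)), θ.1 W a = η.1 W a) : θ = η :=
  Subtype.ext (funext fun W => AddMonoidHom.ext (h W))

instance (V : Y.Opens) : Module Γ(Y, V) (Tangent sY V) where
  one_smul θ := ext fun W a => by simp [smul_apply]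
  mul_smul b b' θ := ext fun W a => by simp [smul_apply, mul_assoc]
  smul_zero b := ext fun W a => by simp [smul_apply]
  smul_add b θ η := ext fun W a => by simp [smul_apply, mul_add]
  add_smul b b' θ := ext fun W a => by simp [smul_apply, add_mul]
  zero_smul θ := ext fun W a => by simp [smul_apply]

end Tangent

/-- A bivector `P ∈ H⁰(X, ⋀² T_X)`, given by the alternating biderivations `P(da, db)` of the
rings of functions. -/
structure Bivector {k : Type u} [Field k] {X : Scheme.{u}} (sX : X ⟶ Spec (.of k)) where
  /-- the function `P(da, db)` -/
  toFun : ∀ U : X.Opens, Γ(X, U) →+ Γ(X, U) →+ Γ(X, U)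
  self : ∀ U a, toFun U a a = 0
  map_const : ∀ U a (c : k), toFun U a (const sX U c) = 0
  leibniz : ∀ U a b c, toFun U a (b * c) = b * toFun U a c + c * toFun U a b
  res : ∀ (U U' : X.Opens) (h : U' ≤ U) (a b : Γ(X, U)),
    toFun U' (resO h a) (resO h b) = resO h (toFun U a b)

namespace Bivector

variable {k : Type u} [Field k] {X Y : Scheme.{u}} {sX : X ⟶ Spec (.of k)} (P : Bivector sX)

lemma swap (U : X.Opens) (a b : Γ(X, U)) : P.toFun U a b = - P.toFun U b a := by
  have h := P.self U (a + b)
  simp only [map_add, AddMonoidHom.add_apply, P.self, zero_add, add_zero] at h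
  exact (neg_eq_of_add_eq_zero_right h).symm

/-- `Y` is coisotropic: `P(dI_Y, dI_Y) ⊆ I_Y`. -/
def IsCoisotropic (i : Y ⟶ X) : Prop :=
  ∀ (U : X.Opens) (x y : Γ(X, U)), x ∈ idealSec i U → y ∈ idealSec i U →
    P.toFun U x y ∈ idealSec i U

variable {P}

lemma pull_eq_of_coisotropic {i : Y ⟶ X} (hco : P.IsCoisotropic i) {U : X.Opens}
    (x : idealSec i U) {a b : Γ(X, U)} (h : pull i U a = pull i U b) :
    pull i U (P.toFun U x.1 a) = pull i U (P.toFun U x.1 b) := by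
  have h1 : a - b ∈ idealSec i U := by
    rw [mem_idealSec, map_sub, h, sub_self]
  have h2 := mem_idealSec.1 (hco U x.1 (a - b) x.2 h1)
  rw [map_sub, map_sub] at h2
  exact sub_eq_zero.1 h2

/-- `c` is the value at the function `b` of the vector field `p(x)`. -/
def IsValue (P : Bivector sX) (i : Y ⟶ X) {U : X.Opens} (x : idealSec i U) {W : Y.Opens}
    (b c : Γ(Y, W)) : Prop :=
  ∀ (U' : X.Opens) (h : U' ≤ U) (h' : i ⁻¹ᵁ U' ≤ W) (a : Γ(X, U')),
    pull i U' a = resO h' b → resO h' c = pull i U' (P.toFun U' (resO h x.1) a)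

/-- The lifts of restrictions of `b` to functions on open sets of `X`. -/
structure Lift (i : Y ⟶ X) (U : X.Opens) {W : Y.Opens} (b : Γ(Y, W)) where
  /-- the open set -/
  U' : X.Opens
  le : U' ≤ U
  le' : i ⁻¹ᵁ U' ≤ W
  /-- the lift -/
  a : Γ(X, U')
  eq : pull i U' a = resO le' b

lemma Lift.cover (i : Y ⟶ X) [IsClosedImmersion i] {U : X.Opens} {W : Y.Opens}
    (hW : W ≤ i ⁻¹ᵁ U) (b : Γ(Y, W)) : W ≤ ⨆ l : Lift i U b, i ⁻¹ᵁ l.U' := by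
  intro y hy
  obtain ⟨O, hO, hO'⟩ := (i.isClosedEmbedding.isInducing.isOpen_iff).1 W.2
  have hyO : i y ∈ O := by
    have : y ∈ (i ⁻¹' O : Set Y) := by rw [hO']; exact hy
    exact this
  obtain ⟨U', hU', hyU', hle⟩ := exists_isAffineOpen_mem_and_subset
    (U := U ⊓ ⟨O, hO⟩) (x := i y) ⟨hW hy, hyO⟩
  have le' : i ⁻¹ᵁ U' ≤ W := by
    intro z hz
    have : z ∈ (i ⁻¹' O : Set Y) := (hle hz).2
    rw [hO'] at this; exact this
  obtain ⟨a, ha⟩ := i.app_surjective U' hU' (resO le' b)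
  exact (Opens.mem_iSup).2 ⟨⟨U', fun z hz => (hle hz).1, le', a, ha⟩, hyU'⟩

lemma existsUnique_isValue {i : Y ⟶ X} [IsClosedImmersion i] (hco : P.IsCoisotropic i)
    {U : X.Opens} (x : idealSec i U) {W : Y.Opens} (hW : W ≤ i ⁻¹ᵁ U) (b : Γ(Y, W)) :
    ∃! c : Γ(Y, W), P.IsValue i x b c := by
  have key := Y.sheaf.existsUnique_gluing' (fun l : Lift i U b => i ⁻¹ᵁ l.U') W
    (fun l => homOfLE l.le') (Lift.cover i hW b)
    (fun l => pull i l.U' (P.toFun l.U' (resO l.le x.1) l.a)) (by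
      intro l l'
      change resO (preimage_le i inf_le_left) _ = resO (preimage_le i inf_le_right) _
      rw [resO_pull i inf_le_left, resO_pull i inf_le_right, ← P.res _ _ inf_le_left, ← P.res _ _ inf_le_right, resO_resO,
        resO_resO]
      refine pull_eq_of_coisotropic hco (resI i (inf_le_left.trans l.le) x) ?_
      rw [← resO_pull i inf_le_left, ← resO_pull i inf_le_right, l.eq, l'.eq, resO_resO,
        resO_resO])
  obtain ⟨c, hc, huniq⟩ := key
  exact ⟨c, fun U' h h' a ha => hc ⟨U', h, h', a, ha⟩,
    fun c' hc' => huniq c' fun l => hc' l.U' l.le l.le' l.a l.eq⟩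

lemma IsValue.eq_of {i : Y ⟶ X} [IsClosedImmersion i] (hco : P.IsCoisotropic i)
    {U : X.Opens} {x : idealSec i U} {W : Y.Opens} (hW : W ≤ i ⁻¹ᵁ U) {b c c' : Γ(Y, W)}
    (h : P.IsValue i x b c) (h' : P.IsValue i x b c') : c = c' :=
  (existsUnique_isValue hco x hW b).unique h h'

/-- A value may be checked on one lift for each point. -/
lemma IsValue.of_local {i : Y ⟶ X} [IsClosedImmersion i] (hco : P.IsCoisotropic i)
    {U : X.Opens} {x : idealSec i U} {W : Y.Opens} {b c : Γ(Y, W)}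
    (H : ∀ (U' : X.Opens) (h : U' ≤ U) (h' : i ⁻¹ᵁ U' ≤ W), IsAffineOpen U' →
      ∃ a : Γ(X, U'), pull i U' a = resO h' b ∧
        resO h' c = pull i U' (P.toFun U' (resO h x.1) a)) : P.IsValue i x b c := by
  intro U' h h' a ha
  refine Y.sheaf.eq_of_locally_eq'
    (fun O : {O : X.Opens // O ≤ U' ∧ IsAffineOpen O} => i ⁻¹ᵁ O.1) (i ⁻¹ᵁ U')
    (fun O => homOfLE (preimage_le i O.2.1)) ?_ _ _ ?_
  · intro y hy
    obtain ⟨O, hO, hyO, hle⟩ := exists_isAffineOpen_mem_and_subset (U := U') (x := i y) hy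
    exact (Opens.mem_iSup).2 ⟨⟨O, hle, hO⟩, hyO⟩
  · rintro ⟨O, hO, hOa⟩
    change resO (preimage_le i hO) _ = resO (preimage_le i hO) _
    obtain ⟨a', h1, h2⟩ := H O (hO.trans h) ((preimage_le i hO).trans h') hOa
    rw [resO_resO, h2, resO_pull i hO, ← P.res _ _ hO, resO_resO]
    refine pull_eq_of_coisotropic hco (resI i (hO.trans h) x) ?_
    rw [h1, ← resO_pull i hO, ha, resO_resO]

variable (P) in
/-- The value at `b` of the vector field `p(x)`. -/
def value {i : Y ⟶ X} [IsClosedImmersion i] (hco : P.IsCoisotropic i) {U : X.Opens}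
    (x : idealSec i U) {W : Y.Opens} (hW : W ≤ i ⁻¹ᵁ U) (b : Γ(Y, W)) : Γ(Y, W) :=
  (existsUnique_isValue hco x hW b).choose

lemma value_spec {i : Y ⟶ X} [IsClosedImmersion i] (hco : P.IsCoisotropic i) {U : X.Opens}
    (x : idealSec i U) {W : Y.Opens} (hW : W ≤ i ⁻¹ᵁ U) (b : Γ(Y, W)) :
    P.IsValue i x b (P.value hco x hW b) :=
  (existsUnique_isValue hco x hW b).choose_spec.1

variable (P) in
/-- The morphism `p : N^∨ → T_Y` that `P` induces on the conormal sheaf: for a function `x` on `U`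
vanishing on `Y`, the vector field `p(x)` on `Y ∩ U` is characterised by
`p(x)(a|_Y) = P(dx, da)|_Y`. -/
def p {i : Y ⟶ X} [IsClosedImmersion i] (hco : P.IsCoisotropic i) {U : X.Opens}
    (x : idealSec i U) : Tangent (i ≫ sX) (i ⁻¹ᵁ U) :=
  ⟨fun W =>
    { toFun := fun b => P.value hco x W.2 b
      map_zero' := by
        refine IsValue.eq_of hco W.2 (value_spec hco x W.2 0)
          (IsValue.of_local hco fun U' h h' hU' => ⟨0, by simp, by simp⟩)
      map_add' := fun b b' => by
        refine IsValue.eq_of hco W.2 (value_spec hco x W.2 _)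
          (IsValue.of_local hco fun U' h h' hU' => ?_)
        obtain ⟨a, ha⟩ := i.app_surjective U' hU' (resO h' b)
        obtain ⟨a', ha'⟩ := i.app_surjective U' hU' (resO h' b')
        refine ⟨a + a', ?_, ?_⟩
        · rw [map_add, map_add]; exact congrArg₂ (· + ·) ha ha'
        · rw [map_add, map_add, map_add, value_spec hco x W.2 b U' h h' a ha,
            value_spec hco x W.2 b' U' h h' a' ha'] },
    fun W c => by
      refine IsValue.eq_of hco W.2 (value_spec hco x W.2 _)
        (IsValue.of_local hco fun U' h h' hU' => ⟨const sX U' c, ?_, ?_⟩)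
      · rw [pull_const, resO_const]
      · rw [P.map_const, map_zero, map_zero],
    fun W b b' => by
      refine IsValue.eq_of hco W.2 (value_spec hco x W.2 _)
        (IsValue.of_local hco fun U' h h' hU' => ?_)
      obtain ⟨a, ha⟩ := i.app_surjective U' hU' (resO h' b)
      obtain ⟨a', ha'⟩ := i.app_surjective U' hU' (resO h' b')
      have ha : pull i U' a = resO h' b := ha
      have ha' : pull i U' a' = resO h' b' := ha'
      refine ⟨a * a', ?_, ?_⟩
      · rw [map_mul, map_mul, ha, ha']
      · change resO h' (b * P.value hco x W.2 b' + b' * P.value hco x W.2 b) = _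
        rw [P.leibniz, map_add, map_add, map_mul, map_mul, map_mul, map_mul,
          value_spec hco x W.2 b U' h h' a ha,
          value_spec hco x W.2 b' U' h h' a' ha', ha, ha'],
    fun W W' hWW b => by
      refine IsValue.eq_of hco W'.2 (value_spec hco x W'.2 _) ?_
      intro U' h h' a ha
      change resO h' (resO hWW (P.value hco x W.2 b)) = _
      rw [resO_resO] at ha ⊢
      exact value_spec hco x W.2 b U' h _ a ha⟩

lemma p_isValue {i : Y ⟶ X} [IsClosedImmersion i] (hco : P.IsCoisotropic i) {U : X.Opens}
    (x : idealSec i U) (W : {W : Y.Opens // W ≤ i ⁻¹ᵁ U}) (b : Γ(Y, W.1)) :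
    P.IsValue i x b ((P.p hco x).1 W b) := value_spec hco x W.2 b

lemma p_ext {i : Y ⟶ X} [IsClosedImmersion i] (hco : P.IsCoisotropic i) {U : X.Opens}
    {x : idealSec i U} {θ : Tangent (i ≫ sX) (i ⁻¹ᵁ U)}
    (H : ∀ W b, P.IsValue i x b (θ.1 W b)) : P.p hco x = θ :=
  Tangent.ext fun W b => IsValue.eq_of hco W.2 (p_isValue hco x W b) (H W b)

lemma p_add {i : Y ⟶ X} [IsClosedImmersion i] (hco : P.IsCoisotropic i) {U : X.Opens}
    (x x' : idealSec i U) : P.p hco (x + x') = P.p hco x + P.p hco x' := by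
  refine p_ext hco fun W b U' h h' a ha => ?_
  rw [Tangent.add_apply, map_add, p_isValue hco x W b U' h h' a ha,
    p_isValue hco x' W b U' h h' a ha, ← map_add]
  congr 1
  change _ = P.toFun U' (resO h (x.1 + x'.1)) a
  simp

lemma p_smul {i : Y ⟶ X} [IsClosedImmersion i] (hco : P.IsCoisotropic i) {U : X.Opens}
    (f : Γ(X, U)) (x : idealSec i U) : P.p hco (f • x) = pull i U f • P.p hco x := by
  refine p_ext hco fun W b U' h h' a ha => ?_
  have hx : pull i U' (resO h x.1) = 0 := (resI i h x).2
  rw [Tangent.smul_apply, map_mul, p_isValue hco x W b U' h h' a ha, resO_resO, resO_pull i h]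
  change _ = pull i U' (P.toFun U' (resO h (f * x.1)) a)
  rw [map_mul (resO h), P.swap _ (_ * _), P.leibniz, P.swap _ a (resO h x.1)]
  simp only [map_neg, map_add, map_mul, hx, zero_mul, add_zero, mul_neg, neg_neg]

lemma p_res {i : Y ⟶ X} [IsClosedImmersion i] (hco : P.IsCoisotropic i) {U U' : X.Opens}
    (hU : U' ≤ U) (x : idealSec i U) :
    P.p hco (resI i hU x) = Tangent.restrict (preimage_le i hU) (P.p hco x) := by
  refine p_ext hco fun W b U'' h h' a ha => ?_
  change resO h' ((P.p hco x).1 ⟨W.1, _⟩ b) = pull i U'' (P.toFun U'' (resO h (resO hU x.1)) a)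
  rw [resO_resO]
  exact p_isValue hco x ⟨W.1, W.2.trans (preimage_le i hU)⟩ b U'' _ h' a ha

end Bivector

/-! ### Frames -/

namespace IsFrame

variable {Y : Scheme.{u}} {M : Y.PresheafOfModules} {V : Y.Opens} {n : ℕ} {s : Fin n → Sec M V}

/-- Coordinates of a section in a frame. -/
def coord (hs : IsFrame M s) {W : Y.Opens} (h : W ≤ V) (m : Sec M W) : Fin n → Γ(Y, W) :=
  (hs W h m).choose

lemma eq_sum (hs : IsFrame M s) {W : Y.Opens} (h : W ≤ V) (m : Sec M W) :
    m = ∑ j, hs.coord h m j • res M h (s j) :=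
  (hs W h m).choose_spec.1

lemma coord_eq (hs : IsFrame M s) {W : Y.Opens} (h : W ≤ V) {m : Sec M W} {c : Fin n → Γ(Y, W)}
    (hc : m = ∑ j, c j • res M h (s j)) : hs.coord h m = c :=
  ((hs W h m).choose_spec.2 c hc).symm

lemma coord_add (hs : IsFrame M s) {W : Y.Opens} (h : W ≤ V) (m m' : Sec M W) :
    hs.coord h (m + m') = hs.coord h m + hs.coord h m' :=
  hs.coord_eq h (by
    simp only [Pi.add_apply, add_smul, Finset.sum_add_distrib]
    rw [← hs.eq_sum h m, ← hs.eq_sum h m'])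

lemma coord_smul (hs : IsFrame M s) {W : Y.Opens} (h : W ≤ V) (b : Γ(Y, W)) (m : Sec M W) :
    hs.coord h (b • m) = b • hs.coord h m :=
  hs.coord_eq h (by
    simp only [Pi.smul_apply, smul_eq_mul, mul_smul, ← Finset.smul_sum]
    rw [← hs.eq_sum h m])

lemma coord_res (hs : IsFrame M s) {W W' : Y.Opens} (h : W ≤ V) (h' : W' ≤ W) (m : Sec M W) :
    hs.coord (h'.trans h) (res M h' m) = fun j => resO h' (hs.coord h m j) :=
  hs.coord_eq _ (by
    conv_lhs => rw [hs.eq_sum h m]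
    simp only [map_sum, res_smul, res_res])

lemma restrict (hs : IsFrame M s) {V' : Y.Opens} (h : V' ≤ V) :
    IsFrame M (fun j => res M h (s j)) := by
  intro W hW m
  simpa only [res_res] using hs W (hW.trans h) m

end IsFrame

lemma isVectorBundle_homModule {Y : Scheme.{u}} {L E : Y.PresheafOfModules} (hL : IsLineBundle L)
    (hE : IsVectorBundle E) : IsVectorBundle (homModule L E) := by
  intro y
  obtain ⟨V₁, hy₁, l, hl⟩ := hL y
  obtain ⟨V₂, hy₂, n, s, hs⟩ := hE y
  replace hl := hl.restrict (V' := V₁ ⊓ V₂) inf_le_left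
  replace hs := hs.restrict (V' := V₁ ⊓ V₂) inf_le_right
  generalize (fun j => res L inf_le_left (l j) : Fin 1 → Sec L (V₁ ⊓ V₂)) = l at hl
  generalize (fun j => res E inf_le_right (s j) : Fin n → Sec E (V₁ ⊓ V₂)) = s at hs
  refine ⟨V₁ ⊓ V₂, ⟨hy₁, hy₂⟩, n, ?_⟩
  generalize V₁ ⊓ V₂ = V at *
  let φ : Fin n → LocalHom L E V := fun j =>
    ⟨fun W =>
      { toFun := fun m => hl.coord W.2 m 0 • res E W.2 (s j)
        map_add' := fun m m' => by rw [hl.coord_add, Pi.add_apply, add_smul]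
        map_smul' := fun b m => by
          rw [hl.coord_smul, Pi.smul_apply, smul_eq_mul, mul_smul, RingHom.id_apply] },
      fun W W' h m => by
        change hl.coord W'.2 (res L h m) 0 • res E W'.2 (s j) =
          res E h (hl.coord W.2 m 0 • res E W.2 (s j))
        rw [hl.coord_res W.2 h m, res_smul, res_res]⟩
  refine ⟨φ, fun W hW f => ?_⟩
  change LocalHom L E W at f
  have hval : ∀ (c : Fin n → Γ(Y, W)) (Z : {Z : Y.Opens // Z ≤ W}) (m : Sec L Z.1),
      (∑ j, c j • LocalHom.restrict hW (φ j)).1 Z m =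
        hl.coord (Z.2.trans hW) m 0 •
          res E Z.2 (∑ j, c j • res E hW (s j)) := by
    intro c Z m
    rw [AddSubgroup.val_finsetSum, Finset.sum_apply, LinearMap.sum_apply, map_sum,
      Finset.smul_sum]
    refine Finset.sum_congr rfl fun j _ => ?_
    change resO Z.2 (c j) • (hl.coord (Z.2.trans hW) m 0 • res E (Z.2.trans hW) (s j)) = _
    rw [res_smul, res_res, smul_comm]
  have hl1 : ∀ (Z : {Z : Y.Opens // Z ≤ W}) (m : Sec L Z.1),
      m = hl.coord (Z.2.trans hW) m 0 • res L Z.2 (res L hW (l 0)) := by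
    intro Z m
    conv_lhs => rw [hl.eq_sum (Z.2.trans hW) m]
    rw [Fin.sum_univ_one, res_res]
  have hl2 : hl.coord hW (res L hW (l 0)) 0 = 1 := by
    rw [hl.coord_eq hW (c := fun _ => 1) (by rw [Fin.sum_univ_one, one_smul])]
  have hiff : ∀ c : Fin n → Γ(Y, W), f = ∑ j, c j • LocalHom.restrict hW (φ j) ↔
      f.1 ⟨W, le_rfl⟩ (res L hW (l 0)) = ∑ j, c j • res E hW (s j) := by
    intro c
    constructor
    · intro h
      rw [h, hval c ⟨W, le_rfl⟩, hl2, one_smul]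
      simp only [map_sum, res_smul, res_res]
      refine Finset.sum_congr rfl fun j _ => ?_
      have h1 := res_res E hW le_rfl (s j)
      congr 1
      exact congr($(Y.presheaf.map_id (op W)).hom (c j))
    · intro h
      refine Subtype.ext (funext fun Z => LinearMap.ext fun m => ?_)
      rw [hval c Z m, ← h, hl1 Z m, map_smul, ← hl1 Z m]
      congr 1
      exact f.2 ⟨W, le_rfl⟩ Z Z.2 (res L hW (l 0))
  obtain ⟨c, hc, huniq⟩ := hs W hW (f.1 ⟨W, le_rfl⟩ (res L hW (l 0)))
  exact ⟨c, (hiff c).2 hc, fun c' hc' => huniq c' ((hiff c').1 hc')⟩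

/-! ### Connections and the Atiyah class -/

/-- Sections over `V` of the sheaf `Ω¹_Y ⊗ ℰnd(M) = ℋom(T_Y, ℰnd(M))`. -/
def OmegaEnd {k : Type u} [Field k] {Y : Scheme.{u}} (sY : Y ⟶ Spec (.of k))
    (M : Y.PresheafOfModules) (V : Y.Opens) :
    AddSubgroup (∀ W : {W : Y.Opens // W ≤ V},
      Tangent sY W.1 →ₗ[Γ(Y, W.1)] Sec M W.1 →ₗ[Γ(Y, W.1)] Sec M W.1) where
  carrier := {ω | ∀ (W W' : {W : Y.Opens // W ≤ V}) (h : W'.1 ≤ W.1) (θ : Tangent sY W.1)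
    (m : Sec M W.1), ω W' (Tangent.restrict h θ) (res M h m) = res M h (ω W θ m)}
  zero_mem' := by intro W W' h θ m; simp
  add_mem' := by intro f g hf hg W W' h θ m; simp [hf W W' h θ m, hg W W' h θ m]
  neg_mem' := by intro f hf W W' h θ m; simp [hf W W' h θ m]

/-- Restriction of sections of `Ω¹_Y ⊗ ℰnd(M)`. -/
def OmegaEnd.restrict {k : Type u} [Field k] {Y : Scheme.{u}} {sY : Y ⟶ Spec (.of k)}
    {M : Y.PresheafOfModules} {V V' : Y.Opens} (h : V' ≤ V) :
    OmegaEnd sY M V →+ OmegaEnd sY M V' where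
  toFun ω := ⟨fun W => ω.1 ⟨W.1, W.2.trans h⟩, fun W W' h' θ m =>
    ω.2 ⟨W.1, W.2.trans h⟩ ⟨W'.1, W'.2.trans h⟩ h' θ m⟩
  map_zero' := rfl
  map_add' _ _ := rfl

/-- The sheaf `Ω¹_Y(M) = Ω¹_Y ⊗ ℰnd(M)`. -/
def omegaPresheaf {k : Type u} [Field k] {Y : Scheme.{u}} (sY : Y ⟶ Spec (.of k))
    (M : Y.PresheafOfModules) : TopCat.Presheaf AddCommGrpCat.{u} Y where
  obj V := AddCommGrpCat.of (OmegaEnd sY M V.unop)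
  map f := AddCommGrpCat.ofHom (OmegaEnd.restrict f.unop.le)
  map_id _ := rfl
  map_comp _ _ := rfl

/-- Connections `∇` on `M|_V`. -/
structure Connection {k : Type u} [Field k] {Y : Scheme.{u}} (sY : Y ⟶ Spec (.of k))
    (M : Y.PresheafOfModules) (V : Y.Opens) where
  /-- the covariant derivative `∇_θ m` -/
  toFun : ∀ W : {W : Y.Opens // W ≤ V}, Tangent sY W.1 →+ Sec M W.1 →+ Sec M W.1
  smul : ∀ W (b : Γ(Y, W.1)) (θ : Tangent sY W.1) (m : Sec M W.1),
    toFun W (b • θ) m = b • toFun W θ m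
  leibniz : ∀ W (θ : Tangent sY W.1) (b : Γ(Y, W.1)) (m : Sec M W.1),
    toFun W θ (b • m) = b • toFun W θ m + θ.1 ⟨W.1, le_rfl⟩ b • m
  res : ∀ (W W' : {W : Y.Opens // W ≤ V}) (h : W'.1 ≤ W.1) (θ : Tangent sY W.1) (m : Sec M W.1),
    toFun W' (Tangent.restrict h θ) (res M h m) = res M h (toFun W θ m)

namespace Connection

variable {k : Type u} [Field k] {Y : Scheme.{u}} {sY : Y ⟶ Spec (.of k)}
  {M : Y.PresheafOfModules}

/-- Restriction of connections. -/
def restrict {V V' : Y.Opens} (h : V' ≤ V) (D : Connection sY M V) : Connection sY M V' where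
  toFun W := D.toFun ⟨W.1, W.2.trans h⟩
  smul W := D.smul ⟨W.1, W.2.trans h⟩
  leibniz W := D.leibniz ⟨W.1, W.2.trans h⟩
  res W W' := D.res ⟨W.1, W.2.trans h⟩ ⟨W'.1, W'.2.trans h⟩

/-- The difference of two connections is a section of `Ω¹_Y ⊗ ℰnd(M)`. -/
def sub {V : Y.Opens} (D D' : Connection sY M V) : OmegaEnd sY M V :=
  ⟨fun W => LinearMap.mk₂ Γ(Y, W.1) (fun θ m => D.toFun W θ m - D'.toFun W θ m)
    (fun θ θ' m => by simp only [map_add, AddMonoidHom.add_apply]; abel)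
    (fun b θ m => by rw [D.smul, D'.smul, smul_sub])
    (fun θ m m' => by simp only [map_add]; abel)
    (fun b θ m => by rw [D.leibniz, D'.leibniz, add_sub_add_right_eq_sub, smul_sub]),
  fun W W' h θ m => by
    simp only [LinearMap.mk₂_apply, map_sub, D.res W W' h, D'.res W W' h]⟩

lemma sub_cocycle {V : Y.Opens} (D₀ D₁ D₂ : Connection sY M V) :
    D₂.sub D₁ - D₂.sub D₀ + D₁.sub D₀ = 0 := by
  refine Subtype.ext (funext fun W => LinearMap.ext₂ fun θ m => ?_)
  change (D₂.toFun W θ m - D₁.toFun W θ m) - (D₂.toFun W θ m - D₀.toFun W θ m) +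
    (D₁.toFun W θ m - D₀.toFun W θ m) = 0
  abel

/-- The connection for which the sections of a frame are horizontal. -/
def ofFrame {V : Y.Opens} {n : ℕ} {s : Fin n → Sec M V} (hs : IsFrame M s) :
    Connection sY M V where
  toFun W := AddMonoidHom.mk' (fun θ => AddMonoidHom.mk'
      (fun m => ∑ j, θ.1 ⟨W.1, le_rfl⟩ (hs.coord W.2 m j) • DefQuant.res M W.2 (s j))
      (fun m m' => by
        simp only [hs.coord_add, Pi.add_apply, map_add, add_smul, Finset.sum_add_distrib]))
    (fun θ θ' => by
      ext m
      simp only [AddMonoidHom.mk'_apply, AddMonoidHom.add_apply, Tangent.add_apply, add_smul,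
        Finset.sum_add_distrib])
  smul W b θ m := by
    simp only [AddMonoidHom.mk'_apply, Tangent.smul_apply, Finset.smul_sum, mul_smul]
    refine Finset.sum_congr rfl fun j _ => ?_
    congr 1
    exact congr($(Y.presheaf.map_id (op W.1)).hom b)
  leibniz W θ b m := by
    simp only [AddMonoidHom.mk'_apply]
    conv_rhs => enter [2]; rw [hs.eq_sum W.2 m]
    simp only [hs.coord_smul, Pi.smul_apply, smul_eq_mul, Finset.smul_sum,
      ← Finset.sum_add_distrib, θ.2.2.1]
    refine Finset.sum_congr rfl fun j _ => ?_
    rw [add_smul, mul_smul, smul_smul _ (hs.coord _ m j), mul_comm (hs.coord _ m j)]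
  res W W' h θ m := by
    simp only [AddMonoidHom.mk'_apply, hs.coord_res W.2 h m, map_sum, res_smul, res_res]
    refine Finset.sum_congr rfl fun j _ => ?_
    congr 1
    exact θ.2.2.2 ⟨W.1, le_rfl⟩ ⟨W'.1, h⟩ h _

end Connection

/-- Connections on the members of an open cover. -/
structure LocalConnections {k : Type u} [Field k] {Y : Scheme.{u}} (sY : Y ⟶ Spec (.of k))
    (M : Y.PresheafOfModules) where
  /-- the cover -/
  cover : PointedCover Y
  /-- the connections -/
  conn : ∀ y, Connection sY M (cover.nhd y)

/-- The Čech cocycle `∇_z - ∇_y`. -/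
def LocalConnections.cocycle {k : Type u} [Field k] {Y : Scheme.{u}} {sY : Y ⟶ Spec (.of k)}
    {M : Y.PresheafOfModules} (D : LocalConnections sY M) :
    Cech.Z (omegaPresheaf sY M) D.cover 1 :=
  ⟨fun s => ((D.conn (s 1)).restrict (Cech.inter_le _ s 1)).sub
      ((D.conn (s 0)).restrict (Cech.inter_le _ s 0)), by
    exact Cech.mem_Z_one fun s => Connection.sub_cocycle
      ((D.conn (s 0)).restrict (Cech.inter_le _ s 0))
      ((D.conn (s 1)).restrict (Cech.inter_le _ s 1))
      ((D.conn (s 2)).restrict (Cech.inter_le _ s 2))⟩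

lemma exists_localConnections {k : Type u} [Field k] {Y : Scheme.{u}} (sY : Y ⟶ Spec (.of k))
    {M : Y.PresheafOfModules} (hM : IsVectorBundle M) : Nonempty (LocalConnections sY M) := by
  choose V hV n s hs using hM
  exact ⟨⟨⟨V, hV⟩, fun y => Connection.ofFrame (hs y)⟩⟩

/-- The Atiyah class `at(M) ∈ H¹(Y, Ω¹_Y(M))` of a vector bundle, the class of the differences
of local connections. It does not depend on the choice of the connections. -/
def atiyahClass {k : Type u} [Field k] {Y : Scheme.{u}} (sY : Y ⟶ Spec (.of k))
    {M : Y.PresheafOfModules} (hM : IsVectorBundle M) : Cech.HLim (omegaPresheaf sY M) 1 :=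
  Cech.mk _ (exists_localConnections sY hM).some.cocycle

/-! ### The normal bundle -/

/-- Sections over `V` of the sheaf `N(M) = N ⊗ ℰnd(M) = ℋom(N^∨, ℰnd(M))`, where
`N^∨ = I_Y / I_Y²`. As `I_Y` acts by zero on `ℰnd(M)`, these are the `𝒪_X`-linear
morphisms from `I_Y` to `ℰnd(M)`. -/
def NormalEnd {X Y : Scheme.{u}} (i : Y ⟶ X) (M : Y.PresheafOfModules) (V : Y.Opens) :
    AddSubgroup (∀ U : {U : X.Opens // i ⁻¹ᵁ U ≤ V},
      idealSec i U.1 →+ Sec M (i ⁻¹ᵁ U.1) →ₗ[Γ(Y, i ⁻¹ᵁ U.1)] Sec M (i ⁻¹ᵁ U.1)) where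
  carrier := {ζ |
    (∀ (U : {U : X.Opens // i ⁻¹ᵁ U ≤ V}) (f : Γ(X, U.1)) (x : idealSec i U.1),
      ζ U (f • x) = pull i U.1 f • ζ U x) ∧
    ∀ (U U' : {U : X.Opens // i ⁻¹ᵁ U ≤ V}) (h : U'.1 ≤ U.1) (x : idealSec i U.1)
      (m : Sec M (i ⁻¹ᵁ U.1)),
      ζ U' (resI i h x) (res M (preimage_le i h) m) = res M (preimage_le i h) (ζ U x m)}
  zero_mem' := ⟨fun U f x => by simp, fun U U' h x m => by simp⟩
  add_mem' := by
    rintro ζ ξ ⟨h1, h2⟩ ⟨g1, g2⟩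
    exact ⟨fun U f x => by simp [h1 U f x, g1 U f x],
      fun U U' h x m => by simp [h2 U U' h x m, g2 U U' h x m]⟩
  neg_mem' := by
    rintro ζ ⟨h1, h2⟩
    exact ⟨fun U f x => by simp [h1 U f x], fun U U' h x m => by simp [h2 U U' h x m]⟩

/-- Restriction of sections of `N(M)`. -/
def NormalEnd.restrict {X Y : Scheme.{u}} {i : Y ⟶ X} {M : Y.PresheafOfModules}
    {V V' : Y.Opens} (h : V' ≤ V) : NormalEnd i M V →+ NormalEnd i M V' where
  toFun ζ := ⟨fun U => ζ.1 ⟨U.1, U.2.trans h⟩,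
    fun U f x => ζ.2.1 ⟨U.1, U.2.trans h⟩ f x,
    fun U U' h' x m => ζ.2.2 ⟨U.1, U.2.trans h⟩ ⟨U'.1, U'.2.trans h⟩ h' x m⟩
  map_zero' := rfl
  map_add' _ _ := rfl

/-- The sheaf `N(M) = N ⊗ ℰnd(M)`. -/
def normalPresheaf {X Y : Scheme.{u}} (i : Y ⟶ X) (M : Y.PresheafOfModules) :
    TopCat.Presheaf AddCommGrpCat.{u} Y where
  obj V := AddCommGrpCat.of (NormalEnd i M V.unop)
  map f := AddCommGrpCat.ofHom (NormalEnd.restrict f.unop.le)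
  map_id _ := rfl
  map_comp _ _ := rfl

/-- The morphism `p^* : Ω¹_Y(M) → N(M)`, `(p^*ω)(x) = ω(p(x))`. -/
def Bivector.pStar {k : Type u} [Field k] {X Y : Scheme.{u}} {sX : X ⟶ Spec (.of k)}
    {P : Bivector sX} {i : Y ⟶ X} [IsClosedImmersion i] (hco : P.IsCoisotropic i)
    (M : Y.PresheafOfModules) : omegaPresheaf (i ≫ sX) M ⟶ normalPresheaf i M where
  app V := AddCommGrpCat.ofHom <| AddMonoidHom.mk'
    (fun ω : OmegaEnd (i ≫ sX) M V.unop =>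
      (⟨fun U => AddMonoidHom.mk' (fun x => ω.1 ⟨i ⁻¹ᵁ U.1, U.2⟩ (P.p hco x))
          (fun x x' => by rw [P.p_add hco, map_add]),
        fun U f x => by
          simp only [AddMonoidHom.mk'_apply, P.p_smul hco, map_smul],
        fun U U' h x m => by
          simp only [AddMonoidHom.mk'_apply, P.p_res hco h]
          exact ω.2 ⟨i ⁻¹ᵁ U.1, U.2⟩ ⟨i ⁻¹ᵁ U'.1, U'.2⟩ (preimage_le i h) _ m⟩ :
        NormalEnd i M V.unop))
    (fun _ _ => rfl)
  naturality _ _ _ := rfl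

/-- The class `at_N(M) = p^* at(M) ∈ H¹(Y, N(M))`. -/
def atiyahClassN {k : Type u} [Field k] {X Y : Scheme.{u}} {sX : X ⟶ Spec (.of k)}
    {P : Bivector sX} {i : Y ⟶ X} [IsClosedImmersion i] (hco : P.IsCoisotropic i)
    {M : Y.PresheafOfModules} (hM : IsVectorBundle M) : Cech.HLim (normalPresheaf i M) 1 :=
  Cech.map (Bivector.pStar hco M) 1 (atiyahClass (i ≫ sX) hM)

/-! ### First order quantizations of `𝒪_X` -/

/-- `D` is a differential operator of order at most `n` (in the sense of Grothendieck) from the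
`R`-module `M` to the `S`-module `N`, where `R` acts on `N` through `φ`. -/
def IsDiffOp {R S M N : Type u} [CommRing R] [CommRing S] [AddCommGroup M] [Module R M]
    [AddCommGroup N] [Module S N] (φ : R →+* S) : ℕ → (M → N) → Prop
  | 0, D => ∀ (r : R) (m : M), D (r • m) = φ r • D m
  | n + 1, D => ∀ r : R, IsDiffOp φ n fun m => D (r • m) - φ r • D m

/-- A sheaf of `k[ε]/ε²`-algebras on `X` with a morphism to `𝒪_X`, the reduction modulo `ε`. -/
structure DualAlgebra {k : Type u} [Field k] {X : Scheme.{u}} (sX : X ⟶ Spec (.of k)) where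
  /-- the sheaf of rings -/
  ring : Sheaf (Opens.grothendieckTopology X) RingCat.{u}
  /-- the structure of a sheaf of `k[ε]/ε²`-algebras -/
  scalar : ∀ U : X.Opens, DualNumber k →+* ring.obj.obj (op U)
  scalar_comm : ∀ (U : X.Opens) (c : DualNumber k) (a : ring.obj.obj (op U)),
    scalar U c * a = a * scalar U c
  scalar_res : ∀ (U U' : X.Opens) (h : U' ≤ U) (c : DualNumber k),
    (ring.obj.map (homOfLE h).op).hom (scalar U c) = scalar U' c
  /-- the reduction modulo `ε` -/
  proj : ring.obj ⟶ X.ringCatSheaf.obj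
  proj_scalar : ∀ (U : X.Opens) (c : DualNumber k),
    (proj.app (op U)).hom (scalar U c) = const sX U c.fst

namespace DualAlgebra

variable {k : Type u} [Field k] {X : Scheme.{u}} {sX : X ⟶ Spec (.of k)} (𝒜 : DualAlgebra sX)

/-- The ring of sections over `U`. -/
abbrev Sections (U : X.Opens) : Type u := 𝒜.ring.obj.obj (op U)

/-- Restriction of sections. -/
def resA {U U' : X.Opens} (h : U' ≤ U) : 𝒜.Sections U →+* 𝒜.Sections U' :=
  (𝒜.ring.obj.map (homOfLE h).op).hom

/-- Reduction modulo `ε` of sections. -/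
def red (U : X.Opens) : 𝒜.Sections U →+* Γ(X, U) := (𝒜.proj.app (op U)).hom

/-- The section `ε`. -/
def eps (U : X.Opens) : 𝒜.Sections U := 𝒜.scalar U DualNumber.eps

/-- An isomorphism `𝒪_X ⊕ ε𝒪_X ≅ 𝒜` over `U` of sheaves of `k[ε]/ε²`-modules, compatible with the
reductions modulo `ε`, under which the product of `𝒜` is `a ∗ b = ab + ε ½P(da, db)`. -/
structure Splitting (P : Bivector sX) (U : X.Opens) where
  /-- the inclusion of `𝒪_X` -/
  toFun : ∀ V : X.Opens, V ≤ U → Γ(X, V) →+ 𝒜.Sections V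
  res : ∀ (V V' : X.Opens) (h : V ≤ U) (h' : V' ≤ V) (a : Γ(X, V)),
    toFun V' (h'.trans h) (resO h' a) = 𝒜.resA h' (toFun V h a)
  map_const : ∀ (V : X.Opens) (h : V ≤ U) (c : k) (a : Γ(X, V)),
    toFun V h (const sX V c * a) = 𝒜.scalar V (TrivSqZeroExt.inl c) * toFun V h a
  red_toFun : ∀ (V : X.Opens) (h : V ≤ U) (a : Γ(X, V)), 𝒜.red V (toFun V h a) = a
  bijective : ∀ (V : X.Opens) (h : V ≤ U) (s : 𝒜.Sections V),
    ∃! a : Γ(X, V) × Γ(X, V), s = toFun V h a.1 + 𝒜.eps V * toFun V h a.2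
  mul : ∀ (V : X.Opens) (h : V ≤ U) (a b : Γ(X, V)),
    toFun V h a * toFun V h b =
      toFun V h (a * b) + 𝒜.eps V * toFun V h (const sX V (2⁻¹ : k) * P.toFun V a b)

end DualAlgebra

/-- A first order deformation quantization `𝒜₁` of `𝒪_X` in the direction of the bivector `P`:
a flat sheaf of `k[ε]/ε²`-algebras which, on an affine open cover, is `𝒪_X ⊕ ε𝒪_X` with product
`a ∗ b = ab + ε ½P(da, db)`. -/
structure Quantization {k : Type u} [Field k] {X : Scheme.{u}} (sX : X ⟶ Spec (.of k))
    (P : Bivector sX) extends DualAlgebra sX where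
  exists_splitting : ∀ x : X, ∃ U : X.Opens, x ∈ U ∧ IsAffineOpen U ∧
    Nonempty (toDualAlgebra.Splitting P U)

/-! ### First order deformations of a vector bundle -/

/-- A sheaf of `𝒜`-modules on `X` with a reduction morphism to the `𝒪_Y`-module `E`. -/
structure DualModule {k : Type u} [Field k] {X Y : Scheme.{u}} {sX : X ⟶ Spec (.of k)}
    (i : Y ⟶ X) (𝒜 : DualAlgebra sX) (E : Y.PresheafOfModules) where
  /-- the sheaf of modules -/
  mod : SheafOfModules.{u} 𝒜.ring
  /-- the reduction modulo `ε` -/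
  proj : ∀ U : X.Opens, mod.val.obj (op U) →+ Sec E (i ⁻¹ᵁ U)
  proj_res : ∀ (U U' : X.Opens) (h : U' ≤ U) (s : mod.val.obj (op U)),
    proj U' (mod.val.map (homOfLE h).op s) = res E (preimage_le i h) (proj U s)
  proj_smul : ∀ (U : X.Opens) (a : 𝒜.Sections U) (s : mod.val.obj (op U)),
    proj U (a • s) = pull i U (𝒜.red U a) • proj U s

namespace DualModule

variable {k : Type u} [Field k] {X Y : Scheme.{u}} {sX : X ⟶ Spec (.of k)}
    {i : Y ⟶ X} {𝒜 : DualAlgebra sX} {E : Y.PresheafOfModules}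

/-- The module of sections over `U`. -/
abbrev Sections (D : DualModule i 𝒜 E) (U : X.Opens) : Type u := D.mod.val.obj (op U)

/-- Restriction of sections. -/
def resD (D : DualModule i 𝒜 E) {U U' : X.Opens} (h : U' ≤ U) : D.Sections U →+ D.Sections U' :=
  (D.mod.val.presheaf.map (homOfLE h).op).hom

/-- An isomorphism `E ⊕ εE ≅ D` over `U` of sheaves of `k[ε]/ε²`-modules, compatible with the
reductions modulo `ε`, under which the action of `𝒜 ≅ 𝒪_X ⊕ ε𝒪_X` is
`a ∗ e = ae + ε α(a, e)` with a bidifferential operator `α`. -/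
structure Splitting (D : DualModule i 𝒜 E) {P : Bivector sX} {U : X.Opens}
    (τ : 𝒜.Splitting P U) where
  /-- the inclusion of `E` -/
  toFun : ∀ V : X.Opens, V ≤ U → Sec E (i ⁻¹ᵁ V) →+ D.Sections V
  res : ∀ (V V' : X.Opens) (h : V ≤ U) (h' : V' ≤ V) (e : Sec E (i ⁻¹ᵁ V)),
    toFun V' (h'.trans h) (res E (preimage_le i h') e) = D.resD h' (toFun V h e)
  map_const : ∀ (V : X.Opens) (h : V ≤ U) (c : k) (e : Sec E (i ⁻¹ᵁ V)),
    toFun V h (const (i ≫ sX) (i ⁻¹ᵁ V) c • e) =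
      𝒜.scalar V (TrivSqZeroExt.inl c) • toFun V h e
  proj_toFun : ∀ (V : X.Opens) (h : V ≤ U) (e : Sec E (i ⁻¹ᵁ V)), D.proj V (toFun V h e) = e
  bijective : ∀ (V : X.Opens) (h : V ≤ U) (s : D.Sections V),
    ∃! e : Sec E (i ⁻¹ᵁ V) × Sec E (i ⁻¹ᵁ V), s = toFun V h e.1 + 𝒜.eps V • toFun V h e.2
  /-- the first order term of the action -/
  α : ∀ V : X.Opens, V ≤ U → Γ(X, V) → Sec E (i ⁻¹ᵁ V) → Sec E (i ⁻¹ᵁ V)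
  smul : ∀ (V : X.Opens) (h : V ≤ U) (a : Γ(X, V)) (e : Sec E (i ⁻¹ᵁ V)),
    τ.toFun V h a • toFun V h e =
      toFun V h (pull i V a • e) + 𝒜.eps V • toFun V h (α V h a e)
  bidifferential : ∃ n : ℕ, ∀ (V : X.Opens) (h : V ≤ U),
    (∀ e, IsDiffOp (pull i V) n fun a => α V h a e) ∧
    ∀ a, IsDiffOp (RingHom.id Γ(Y, i ⁻¹ᵁ V)) n fun e => α V h a e

end DualModule

/-- A first order deformation `ℰ₁` of `E`: a flat sheaf of `𝒜₁`-modules with reduction `E` modulo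
`ε`, which is `E ⊕ εE` on an affine open cover, with an action of the form
`a ∗ e = ae + ε α(a, e)`, `α` a bidifferential operator. (The transition functions
`e ↦ e + ε β(e)` between two splittings satisfy
`β(ae) - aβ(e) = α'(a, e) - α(a, e) + β^X(a)e`, and so are differential operators.) -/
structure Deformation {k : Type u} [Field k] {X Y : Scheme.{u}} {sX : X ⟶ Spec (.of k)}
    (i : Y ⟶ X) {P : Bivector sX} (𝒜 : Quantization sX P) (E : Y.PresheafOfModules) extends
    DualModule i 𝒜.toDualAlgebra E where
  exists_splitting : ∀ x : X, ∃ U : X.Opens, x ∈ U ∧ IsAffineOpen U ∧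
    ∃ τ : 𝒜.toDualAlgebra.Splitting P U, Nonempty (toDualModule.Splitting τ)

namespace Deformation

variable {k : Type u} [Field k] {X Y : Scheme.{u}} {sX : X ⟶ Spec (.of k)}
    {i : Y ⟶ X} {P : Bivector sX} {𝒜 : Quantization sX P} {E : Y.PresheafOfModules}

/-- A morphism of sheaves of `𝒜₁`-modules restricts to the identity of `E` modulo `ε`. -/
def IsIdentityMod {D D' : Deformation i 𝒜 E} (φ : D.mod ⟶ D'.mod) : Prop :=
  ∀ (U : X.Opens) (s : D.Sections U), D'.proj U (φ.val.app (op U) s) = D.proj U s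

/-- The group of automorphisms of `ℰ₁` that restrict to the identity modulo `ε`. -/
def autGroup (D : Deformation i 𝒜 E) : Subgroup (Aut D.mod) where
  carrier := {φ | IsIdentityMod (D := D) (D' := D) φ.hom}
  one_mem' := fun U s => rfl
  mul_mem' := by
    intro φ ψ hφ hψ U s
    exact (hφ U _).trans (hψ U s)
  inv_mem' := by
    intro φ hφ U s
    have h1 : φ.hom.val.app (op U) ((φ⁻¹).hom.val.app (op U) s) = s := by
      have h := φ.inv_hom_id
      exact congr(($h).val.app (op U) s)
    have h2 := hφ U ((φ⁻¹).hom.val.app (op U) s)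
    rw [h1] at h2
    exact h2.symm

/-- Isomorphisms of first order deformations: isomorphisms of `𝒜₁`-modules that restrict to the
identity of `E` modulo `ε`. -/
instance setoid (i : Y ⟶ X) (𝒜 : Quantization sX P) (E : Y.PresheafOfModules) :
    Setoid (Deformation i 𝒜 E) where
  r D D' := ∃ φ : D.mod ≅ D'.mod, IsIdentityMod (D := D) (D' := D') φ.hom
  iseqv :=
    { refl := fun D => ⟨Iso.refl _, fun U s => rfl⟩
      symm := by
        rintro D D' ⟨φ, hφ⟩
        refine ⟨φ.symm, fun U s => ?_⟩
        have h1 : φ.hom.val.app (op U) (φ.inv.val.app (op U) s) = s := by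
          have h := φ.inv_hom_id
          exact congr(($h).val.app (op U) s)
        have h2 := hφ U (φ.inv.val.app (op U) s)
        rw [h1] at h2
        exact h2.symm
      trans := by
        rintro D D' D'' ⟨φ, hφ⟩ ⟨ψ, hψ⟩
        exact ⟨φ ≪≫ ψ, fun U s => (hψ U _).trans (hφ U s)⟩ }

/-- The set of isomorphism classes of first order deformations of `E`. -/
def IsoClasses (i : Y ⟶ X) (𝒜 : Quantization sX P) (E : Y.PresheafOfModules) : Type (u + 1) :=
  Quotient (setoid i 𝒜 E)

/-- The isomorphism class of a first order deformation. -/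
def isoClass (D : Deformation i 𝒜 E) : IsoClasses i 𝒜 E := Quotient.mk _ D

/-- `φ = 1 + ε φ₁`. -/
def IsOneAddEps (D : Deformation i 𝒜 E) (φ : Aut D.mod) (φ₁ : LocalHom E E ⊤) : Prop :=
  ∀ (U : X.Opens) (s t : D.Sections U),
    D.proj U t = φ₁.1 ⟨i ⁻¹ᵁ U, le_top⟩ (D.proj U s) →
      φ.hom.val.app (op U) s = s + 𝒜.eps U • t

/-- `γ' = γ + ζ`, where `γ` and `γ'` are the operators of `D` and `D'` that describe the action of
functions vanishing on `Y`: for a section `x` of `𝒜₁` whose reduction vanishes on `Y` and a section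
`s` of `D` with reduction `e`, one has `x s = ε t`, and `γ(x, e)` is the reduction of `t`. -/
def IsTranslate (D D' : Deformation i 𝒜 E) (ζ : NormalEnd i E ⊤) : Prop :=
  ∀ (U : X.Opens) (x : 𝒜.Sections U) (hx : 𝒜.red U x ∈ idealSec i U)
    (s t : D.Sections U) (s' t' : D'.Sections U),
    D.proj U s = D'.proj U s' → x • s = 𝒜.eps U • t → x • s' = 𝒜.eps U • t' →
      D'.proj U t' = D.proj U t + ζ.1 ⟨U, le_top⟩ ⟨𝒜.red U x, hx⟩ (D.proj U s)

end Deformation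

end

end DefQuant

/-! The whole argument turns on the operator γ. Near a point of `X` a deformation is an action of
`𝒜₁` on `E ⊕ εE`, written a·e = āe + εA(a, e) with ā the restriction to `Y` of the reduction of a.
The term A (an `Act`) satisfies A(ab, e) = āA(b, e) + A(a, b̄e) and A(εa, e) = āe. A change of
splitting e ↦ e + εβ(e) adds β(āe) − āβ(e) to A(a, e), which is zero when ā = 0. So for such x the
value γ(x, e) = A(x, e) does not depend on the splitting, and γ is a global object
(`Deformation.gam`). Comparing A(xa, e) with A(ax, e), where xa − ax = εP(dx, da), gives γ(x, be) =
bγ(x, e) + p(x)(b)e: γ is a kind of connection in conormal directions with symbol p. The symbol does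
not depend on the deformation, so the difference of two γ's is linear in e; it does not see the
ε-part of x, and is therefore a section of `N(E)` (`exists_isTranslate_of_pair`).

Next, γ is a complete invariant. Locally, two actions with the same γ differ by some g(ā, e) with
g(ab, e) = a g(b, e) + g(a, be). If E has a frame sⱼ, then β(∑ cⱼ sⱼ) = ∑ g(cⱼ, sⱼ) satisfies g(a,
e) = β(ae) − aβ(e), so the two actions are isomorphic (`Act.SameNormal.exists_isTrans`). Such a β is
unique up to a section of ℰnd(E). Hence local isomorphisms can be corrected to glue if H¹(ℰnd E) = 0
(`equiv_of_gam_eq`), and local actions with a common γ can be glued to a deformation if H²(ℰnd E) =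
0 (`exists_deformation_of_acts`).

To translate a deformation by ζ ∈ H⁰(N(E)), the action has to be changed locally so that γ becomes γ
+ ζ. As X and Y are smooth, the conormal sequence splits over affine open sets, so ζ extends from
`I_Y` to a derivation 𝒪_X → ℰnd(E) (`EndDerivation.exists_extension`). Adding a derivation to A
preserves the identities above, and the modified actions glue.

It remains to find one deformation. The bundle E ⊗ L^∨ is ℋom(L, E). That its class at_N vanishes
means that local connections, used only along the fields p(x) and corrected by sections of N, agree
on overlaps and give a global ∇ in conormal directions. The Leibniz rule γ_E(x, m(l)) = (∇ₓm)(l) +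
m(γ_L(x, l)) then prescribes γ for E. It is consistent because the symbols of ∇ and γ_L are both p
(`gamHom_smul_right`). Locally it is realised by transporting the action on L along frames and
adding a derivation (`exists_act_gamHom`).

For automorphisms: a morphism that is the identity modulo ε is also the identity on εE, so its
difference from 1 factors through an 𝒪_Y-linear map E → εE (`LocalMor.exists_sub`). -/

namespace DefQuant

noncomputable section

/-! ### Gluing of locally determined sections -/

section Gluing

open CategoryTheory.Limits

variable {C : Type*} [Category* C] {FC : C → C → Type*} {CC : C → Type u}
  [∀ X Y, FunLike (FC X Y) (CC X) (CC Y)] [ConcreteCategory.{u} C FC]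
  [HasLimitsOfSize.{u, u} C] [(forget C).ReflectsIsomorphisms]
  [PreservesLimitsOfSize.{u, u} (forget C)] {Z : TopCat.{u}}

/-- Sections of a sheaf that agree near every point are equal. -/
lemma sheaf_ext {F : TopCat.Presheaf C Z} (hF : F.IsSheaf) {V : Opens Z}
    {s t : ToType (F.obj (op V))}
    (h : ∀ x ∈ V, ∃ (V' : Opens Z) (h : V' ≤ V), x ∈ V' ∧
      F.map (homOfLE h).op s = F.map (homOfLE h).op t) : s = t := by
  choose! V' hV' hx h using h
  refine TopCat.Sheaf.eq_of_locally_eq' ⟨F, hF⟩ (fun x : V => V' x.1) V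
    (fun x => homOfLE (hV' x.1 x.2)) ?_ s t (fun x => h x.1 x.2)
  intro x hxV
  exact Opens.mem_iSup.2 ⟨⟨x, hxV⟩, hx x hxV⟩

/-- A property of sections that determines a section locally determines a section. -/
lemma sheaf_glue {F : TopCat.Presheaf C Z} (hF : F.IsSheaf) {V : Opens Z}
    (R : ∀ V' : Opens Z, V' ≤ V → ToType (F.obj (op V')) → Prop)
    (hres : ∀ V' h g, R V' h g → ∀ V'' (h' : V'' ≤ V'), R V'' (h'.trans h) (F.map (homOfLE h').op g))
    (huniq : ∀ V' h g g', R V' h g → R V' h g' → g = g')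
    (hex : ∀ x ∈ V, ∃ (V' : Opens Z) (h : V' ≤ V), x ∈ V' ∧ ∃ g, R V' h g) :
    ∃ g : ToType (F.obj (op V)), ∀ V' h g', R V' h g' → F.map (homOfLE h).op g = g' := by
  choose! V' hV' hx g hg using hex
  obtain ⟨s, hs, -⟩ := TopCat.Sheaf.existsUnique_gluing' ⟨F, hF⟩ (fun x : V => V' x.1) V
    (fun x => homOfLE (hV' x.1 x.2))
    (fun x hxV => Opens.mem_iSup.2 ⟨⟨x, hxV⟩, hx x hxV⟩)
    (fun x => g x.1 x.2) (by
      intro x y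
      exact huniq _ (inf_le_left.trans (hV' x.1 x.2)) _ _ (hres _ _ _ (hg x.1 x.2) _ inf_le_left)
        (hres _ _ _ (hg y.1 y.2) _ inf_le_right))
  refine ⟨s, fun W h g' hg' => ?_⟩
  refine sheaf_ext hF fun x hxW => ⟨W ⊓ V' x, inf_le_left, ⟨hxW, hx x (h hxW)⟩, ?_⟩
  rw [← ConcreteCategory.comp_apply, ← F.map_comp]
  have h1 := hs ⟨x, h hxW⟩
  have h2 : F.map ((homOfLE (hV' x (h hxW))).op ≫ (homOfLE (inf_le_right : W ⊓ V' x ≤ V' x)).op) s =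
      F.map (homOfLE (inf_le_right : W ⊓ V' x ≤ V' x)).op (g x (h hxW)) := by
    rw [F.map_comp, ConcreteCategory.comp_apply]
    exact congrArg _ h1
  refine Eq.trans ?_ (huniq _ (inf_le_left.trans h) _ _
    (hres _ _ _ (hg x (h hxW)) _ inf_le_right) (hres _ _ _ hg' _ inf_le_left))
  exact h2

end Gluing

/-! ### Sections of sheaves pushed forward from Y to X -/

lemma resO_self {Y : Scheme.{u}} {V : Y.Opens} (h : V ≤ V) (b : Γ(Y, V)) : resO h b = b :=
  congr($(Y.presheaf.map_id (op V)).hom b)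

lemma res_self {Y : Scheme.{u}} (M : Y.PresheafOfModules) {V : Y.Opens} (h : V ≤ V)
    (m : Sec M V) : res M h m = m :=
  congr($(M.presheaf.map_id (op V)).hom m)

/-- Pushforward of sections: sections of `i_* M` over `V`. -/
abbrev SecP {X Y : Scheme.{u}} (i : Y ⟶ X) (M : Y.PresheafOfModules) (V : X.Opens) : Type u :=
  Sec M (i ⁻¹ᵁ V)

/-- Restriction of sections of `i_* M`. -/
def resP {X Y : Scheme.{u}} (i : Y ⟶ X) (M : Y.PresheafOfModules) {V W : X.Opens} (h : W ≤ V) :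
    SecP i M V →+ SecP i M W := res M (preimage_le i h)

/-- Restriction of sections of `i_* 𝒪_Y`. -/
def resOP {X Y : Scheme.{u}} (i : Y ⟶ X) {V W : X.Opens} (h : W ≤ V) :
    Γ(Y, i ⁻¹ᵁ V) →+* Γ(Y, i ⁻¹ᵁ W) := resO (preimage_le i h)

lemma resP_resP {X Y : Scheme.{u}} {i : Y ⟶ X} {M : Y.PresheafOfModules} {V W Z : X.Opens}
    (h : W ≤ V) (h' : Z ≤ W) (m : SecP i M V) :
    resP i M h' (resP i M h m) = resP i M (h'.trans h) m :=
  res_res M _ _ m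

lemma resP_self {X Y : Scheme.{u}} {i : Y ⟶ X} {M : Y.PresheafOfModules} {V : X.Opens}
    (h : V ≤ V) (m : SecP i M V) : resP i M h m = m :=
  res_self M _ m

lemma resP_smul {X Y : Scheme.{u}} {i : Y ⟶ X} {M : Y.PresheafOfModules} {V W : X.Opens}
    (h : W ≤ V) (b : Γ(Y, i ⁻¹ᵁ V)) (m : SecP i M V) :
    resP i M h (b • m) = resOP i h b • resP i M h m :=
  res_smul M _ b m

lemma resOP_resOP {X Y : Scheme.{u}} {i : Y ⟶ X} {V W Z : X.Opens}
    (h : W ≤ V) (h' : Z ≤ W) (b : Γ(Y, i ⁻¹ᵁ V)) :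
    resOP i h' (resOP i h b) = resOP i (h'.trans h) b :=
  resO_resO _ _ b

lemma resOP_self {X Y : Scheme.{u}} {i : Y ⟶ X} {V : X.Opens}
    (h : V ≤ V) (b : Γ(Y, i ⁻¹ᵁ V)) : resOP i h b = b :=
  resO_self _ b

lemma resOP_pull {X Y : Scheme.{u}} {i : Y ⟶ X} {V W : X.Opens} (h : W ≤ V) (a : Γ(X, V)) :
    resOP i h (pull i V a) = pull i W (resO h a) :=
  resO_pull i h a

section Pushforward

variable {X Y : Scheme.{u}} {i : Y ⟶ X}

lemma isSheaf_pushforward {C : Type*} [Category* C] {F : TopCat.Presheaf C Y} (hF : F.IsSheaf)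
    (i : Y ⟶ X) : TopCat.Presheaf.IsSheaf (i.base _* F : TopCat.Presheaf C X) :=
  TopCat.Sheaf.pushforward_sheaf_of_sheaf i.base hF

/-- The presheaf of modules `M` is a sheaf. -/
class IsSheafOfModules (M : Y.PresheafOfModules) : Prop where
  isSheaf : TopCat.Presheaf.IsSheaf M.presheaf

instance (E : Y.Modules) : IsSheafOfModules E.val := ⟨E.isSheaf⟩

lemma res_ext {E : Y.PresheafOfModules} [IsSheafOfModules E] {V : Y.Opens} {e e' : Sec E V}
    (h : ∀ x ∈ V, ∃ (V' : Y.Opens) (h : V' ≤ V), x ∈ V' ∧ res E h e = res E h e') :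
    e = e' :=
  sheaf_ext (IsSheafOfModules.isSheaf (M := E)) h

lemma resP_ext {E : Y.PresheafOfModules} [IsSheafOfModules E] {V : X.Opens} {e e' : SecP i E V}
    (h : ∀ x ∈ V, ∃ (V' : X.Opens) (h : V' ≤ V), x ∈ V' ∧ resP i E h e = resP i E h e') :
    e = e' :=
  sheaf_ext (isSheaf_pushforward (IsSheafOfModules.isSheaf (M := E)) i) h

lemma resOP_ext {V : X.Opens} {e e' : Γ(Y, i ⁻¹ᵁ V)}
    (h : ∀ x ∈ V, ∃ (V' : X.Opens) (h : V' ≤ V), x ∈ V' ∧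
      resOP i h e = resOP i h e') :
    e = e' :=
  sheaf_ext (isSheaf_pushforward Y.sheaf.2 i) h

lemma resP_glue {E : Y.PresheafOfModules} [IsSheafOfModules E] {V : X.Opens}
    (R : ∀ V' : X.Opens, V' ≤ V → SecP i E V' → Prop)
    (hres : ∀ V' h g, R V' h g → ∀ V'' (h' : V'' ≤ V'), R V'' (h'.trans h) (resP i E h' g))
    (huniq : ∀ V' h g g', R V' h g → R V' h g' → g = g')
    (hex : ∀ x ∈ V, ∃ (V' : X.Opens) (h : V' ≤ V), x ∈ V' ∧ ∃ g, R V' h g) :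
    ∃ g : SecP i E V, ∀ V' h g', R V' h g' → resP i E h g = g' :=
  let R' : ∀ V' : Opens X, V' ≤ V →
    ToType ((i.base _* E.presheaf : TopCat.Presheaf AddCommGrpCat X).obj (op V')) → Prop := R
  sheaf_glue (isSheaf_pushforward (IsSheafOfModules.isSheaf (M := E)) i) R' hres huniq hex

lemma resOP_glue {V : X.Opens}
    (R : ∀ V' : X.Opens, V' ≤ V → Γ(Y, i ⁻¹ᵁ V') → Prop)
    (hres : ∀ V' h g, R V' h g → ∀ V'' (h' : V'' ≤ V'),
      R V'' (h'.trans h) (resOP i h' g))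
    (huniq : ∀ V' h g g', R V' h g → R V' h g' → g = g')
    (hex : ∀ x ∈ V, ∃ (V' : X.Opens) (h : V' ≤ V), x ∈ V' ∧ ∃ g, R V' h g) :
    ∃ g : Γ(Y, i ⁻¹ᵁ V), ∀ V' h g', R V' h g' → resOP i h g = g' :=
  sheaf_glue (isSheaf_pushforward Y.sheaf.2 i) R hres huniq hex

/-- The trace of `V` on `Y` is empty, so the sheaf condition leaves only one section. This disposes
of everything that happens away from `Y`. -/
lemma subsingleton_secP {E : Y.PresheafOfModules} [IsSheafOfModules E] {V : X.Opens} (hV : ∀ y : Y, i y ∉ V) :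
    Subsingleton (SecP i E V) :=
  ⟨fun _ _ => res_ext fun y hy => (hV y hy).elim⟩

/-! ### Open sets of a closed subscheme -/

/-- The largest open subset of `X` whose trace on `Y` is `W`. -/
def extOpen (i : Y ⟶ X) [IsClosedImmersion i] (W : Y.Opens) : X.Opens :=
  ⟨(i '' (W : Set Y)ᶜ)ᶜ, (i.isClosedEmbedding.isClosedMap _ W.2.isClosed_compl).isOpen_compl⟩

variable [IsClosedImmersion i]

lemma mem_extOpen {W : Y.Opens} {y : Y} : i y ∈ extOpen i W ↔ y ∈ W := by
  change i y ∉ i '' (W : Set Y)ᶜ ↔ _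
  rw [i.isClosedEmbedding.injective.mem_set_image]
  simp

lemma preimage_extOpen (W : Y.Opens) : i ⁻¹ᵁ extOpen i W = W := by
  ext y
  exact mem_extOpen

lemma extOpen_mono {W W' : Y.Opens} (h : W ≤ W') : extOpen i W ≤ extOpen i W' :=
  fun _ hx ⟨y, hy, hyx⟩ => hx ⟨y, fun hy' => hy (h hy'), hyx⟩

lemma le_extOpen (V : X.Opens) : V ≤ extOpen i (i ⁻¹ᵁ V) := by
  rintro x hx ⟨y, hy, rfl⟩
  exact hy hx

/-- Every open subset of `Y ∩ U` is the trace of an open subset of `U`. This is how data indexed by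
open sets of `X` become data indexed by open sets of `Y`. -/
lemma preimage_extOpen_inf {W : Y.Opens} {U : X.Opens} (h : W ≤ i ⁻¹ᵁ U) :
    i ⁻¹ᵁ (extOpen i W ⊓ U) = W := by
  ext y
  exact ⟨fun hy => mem_extOpen.1 hy.1, fun hy => ⟨mem_extOpen.2 hy, h hy⟩⟩

/-- The complement of `Y`. -/
def complOpen (i : Y ⟶ X) [IsClosedImmersion i] : X.Opens := extOpen i ⊥

lemma notMem_complOpen (y : Y) : i y ∉ complOpen i := fun h => (mem_extOpen.1 h).elim

lemma mem_complOpen {x : X} (hx : ∀ y : Y, i y ≠ x) : x ∈ complOpen i :=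
  fun ⟨y, _, hy⟩ => hx y hy

end Pushforward

/-! ### Čech cocycles with trivial class -/

namespace PointedCover

variable {Y : Scheme.{u}}

/-- Directedness is what makes vanishing in the direct limit visible on a single refinement. -/
instance : IsDirectedOrder (PointedCover Y) :=
  ⟨fun 𝒱 𝒲 => ⟨⟨fun y => 𝒱.nhd y ⊓ 𝒲.nhd y, fun y => ⟨𝒱.mem y, 𝒲.mem y⟩⟩,
    fun _ => inf_le_left, fun _ => inf_le_right⟩⟩

end PointedCover

namespace Cech

variable {Y : Scheme.{u}} {F G : TopCat.Presheaf AddCommGrpCat.{u} Y}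

lemma resF_self {V : Y.Opens} (h : V ≤ V) (m : F.obj (op V)) : resF F h m = m :=
  congr($(F.map_id (op V)).hom m)

instance directedSystem (n : ℕ) : DirectedSystem (fun 𝒱 : PointedCover Y => HCover F 𝒱 n)
    fun _ _ h => mapH (refineCochain F h) (refineCochain_d F h) n where
  map_self := by
    rintro 𝒱 ⟨c, hc⟩
    refine congrArg QuotientAddGroup.mk (Subtype.ext (funext fun s => ?_))
    exact resF_self _ _
  map_map := by
    rintro 𝒱 𝒲 𝒰 h h' ⟨c, hc⟩
    refine congrArg QuotientAddGroup.mk (Subtype.ext (funext fun s => ?_))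
    exact resF_resF _ _ _

/-- A cocycle with trivial class is a coboundary on a finer cover. -/
lemma exists_of_mk_eq_zero {n : ℕ} {𝒱 : PointedCover Y} {c : Z F 𝒱 (n + 1)}
    (h : mk 𝒱 c = 0) :
    ∃ (𝒲 : PointedCover Y) (h : 𝒱 ≤ 𝒲) (b : Cochain F 𝒲 n),
      d F 𝒲 n b = refineCochain F h (n + 1) c.1 := by
  let := Classical.decEq (PointedCover Y)
  obtain ⟨𝒲, hle, h'⟩ := AddCommGroup.DirectLimit.of.zero_exact _ _ h
  have h2 := (QuotientAddGroup.eq_zero_iff _).1 h'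
  obtain ⟨b, hb⟩ := h2
  exact ⟨𝒲, hle, b, hb⟩

lemma map_mk {n : ℕ} (η : F ⟶ G) (𝒱 : PointedCover Y) (c : Z F 𝒱 n) :
    map η n (mk 𝒱 c) = mk 𝒱 ⟨mapCochain η 𝒱 n c.1, by
      rw [AddMonoidHom.mem_ker, mapCochain_d, (AddMonoidHom.mem_ker).1 c.2, map_zero]⟩ := by
  let := Classical.decEq (PointedCover Y)
  exact AddCommGroup.DirectLimit.map_apply_of _ _ _

lemma d_zero_apply (𝒱 : PointedCover Y) (b : Cochain F 𝒱 0) (s : Fin 2 → Y) :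
    d F 𝒱 0 b s = resF F (inter_comp 𝒱 s (Fin.succAbove 0)) (b (s ∘ Fin.succAbove 0)) -
      resF F (inter_comp 𝒱 s (Fin.succAbove 1)) (b (s ∘ Fin.succAbove 1)) := by
  change ∑ j : Fin 2, (-1 : ℤ) ^ (j : ℕ) • resF F (inter_comp 𝒱 s j.succAbove)
    (b (s ∘ j.succAbove)) = _
  rw [Fin.sum_univ_two]
  simp [sub_eq_add_neg]

lemma d_one_apply (𝒱 : PointedCover Y) (b : Cochain F 𝒱 1) (s : Fin 3 → Y) :
    d F 𝒱 1 b s = resF F (inter_comp 𝒱 s (Fin.succAbove 0)) (b (s ∘ Fin.succAbove 0)) -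
      resF F (inter_comp 𝒱 s (Fin.succAbove 1)) (b (s ∘ Fin.succAbove 1)) +
      resF F (inter_comp 𝒱 s (Fin.succAbove 2)) (b (s ∘ Fin.succAbove 2)) := by
  change ∑ j : Fin 3, (-1 : ℤ) ^ (j : ℕ) • resF F (inter_comp 𝒱 s j.succAbove)
    (b (s ∘ j.succAbove)) = _
  rw [Fin.sum_univ_three]
  simp [sub_eq_add_neg]

lemma mem_Z_two {𝒱 : PointedCover Y} {c : Cochain F 𝒱 2}
    (h : ∀ s : Fin 4 → Y,
      resF F (inter_comp 𝒱 s (Fin.succAbove 0)) (c (s ∘ Fin.succAbove 0)) -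
        resF F (inter_comp 𝒱 s (Fin.succAbove 1)) (c (s ∘ Fin.succAbove 1)) +
        resF F (inter_comp 𝒱 s (Fin.succAbove 2)) (c (s ∘ Fin.succAbove 2)) -
        resF F (inter_comp 𝒱 s (Fin.succAbove 3)) (c (s ∘ Fin.succAbove 3)) = 0) :
    c ∈ Z F 𝒱 2 := by
  refine AddMonoidHom.mem_ker.2 (funext fun s => ?_)
  refine Eq.trans ?_ (h s)
  change ∑ j : Fin 4, (-1 : ℤ) ^ (j : ℕ) • resF F (inter_comp 𝒱 s j.succAbove)
    (c (s ∘ j.succAbove)) = _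
  rw [Fin.sum_univ_four]
  simp [sub_eq_add_neg, pow_succ]

end Cech

/-! ### Derivations transverse to a smooth closed subvariety -/

section Algebra

open TensorProduct KaehlerDifferential

/-- A finite projective module is a direct summand of some `Bⁿ`; the functionals are the coordinates
of a section of the surjection `Bⁿ → M`. -/
lemma exists_dual_family {B M : Type*} [CommRing B] [AddCommGroup M] [Module B M]
    [Module.Finite B M] [Module.Projective B M] :
    ∃ (n : ℕ) (w : Fin n → M) (φ : Fin n → M →ₗ[B] B), ∀ m, m = ∑ j, φ j m • w j := by
  obtain ⟨n, f, hf⟩ := Module.Finite.exists_fin' B M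
  obtain ⟨s, hs⟩ := Module.projective_lifting_property f LinearMap.id hf
  refine ⟨n, fun j => f (Pi.single j 1), fun j => LinearMap.proj j ∘ₗ s, fun m => ?_⟩
  conv_lhs => rw [← LinearMap.id_apply (R := B) m, ← hs]
  rw [LinearMap.comp_apply]
  conv_lhs => rw [← LinearMap.sum_single_apply (fun _ : Fin n => B) (s m)]
  rw [map_sum]
  refine Finset.sum_congr rfl fun j _ => ?_
  rw [LinearMap.comp_apply, LinearMap.proj_apply, ← map_smul]
  congr 1
  rw [← Pi.single_smul, smul_eq_mul, mul_one]

/-- For a smooth quotient `B` of a smooth algebra `A`, with kernel `I`, there are elements `xⱼ ∈ I`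
and derivations `∂ⱼ : A → B` such that `f = ∑ ∂ⱼ(f) xⱼ` in `I / I²` for all `f ∈ I`. -/
lemma exists_transverse_derivations {k A B : Type u} [CommRing k] [CommRing A] [CommRing B]
    [Algebra k A] [Algebra A B] [Algebra k B] [IsScalarTower k A B] [Algebra.FormallySmooth k A]
    [Algebra.FiniteType k A] [Algebra.FormallySmooth k B]
    (hAB : Function.Surjective (algebraMap A B)) :
    ∃ (n : ℕ) (x : Fin n → A) (δ : Fin n → Derivation k A B),
      (∀ j, algebraMap A B (x j) = 0) ∧ ∀ f ∈ RingHom.ker (algebraMap A B), ∃ c : Fin n → A,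
        (∀ j, algebraMap A B (c j) = δ j f) ∧
          f - ∑ j, c j * x j ∈ RingHom.ker (algebraMap A B) ^ 2 := by
  -- Smoothness of `B` says that I/I² → B ⊗ Ω is split injective; `l` is a retraction.
  obtain ⟨l, hl⟩ := (Algebra.FormallySmooth.iff_split_injection (R := k) (P := A) (A := B) hAB).1
    inferInstance
  -- `B ⊗ Ω` is projective because `A` is smooth. The derivations are φⱼ ∘ d, and the xⱼ represent
  -- the classes l(wⱼ).
  obtain ⟨n, w, φ, hφ⟩ := exists_dual_family (B := B) (M := B ⊗[A] Ω[A⁄k])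
  choose x hx using fun j => Ideal.toCotangent_surjective _ (l (w j))
  refine ⟨n, fun j => (x j).1,
    fun j => Derivation.mk' ((φ j).restrictScalars k ∘ₗ
      (TensorProduct.mk A B (Ω[A⁄k]) 1).restrictScalars k ∘ₗ (D k A).toLinearMap) ?_,
    fun j => (x j).2, fun f hf => ?_⟩
  · intro a b
    simp [← algebraMap_smul B, map_add, map_smul]
  · choose c hc using fun j => hAB (φ j (1 ⊗ₜ D k A f))
    refine ⟨c, fun j => hc j, ?_⟩
    -- l(1 ⊗ df) is the class of f; expanding 1 ⊗ df in the dual family turns this into f ≡ ∑ ∂ⱼ(f)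
    -- xⱼ modulo I².
    have h1 := LinearMap.congr_fun hl (Ideal.toCotangent _ ⟨f, hf⟩)
    rw [LinearMap.comp_apply, LinearMap.id_apply] at h1
    change l (1 ⊗ₜ D k A f) = _ at h1
    rw [hφ (1 ⊗ₜ D k A f), map_sum] at h1
    simp_rw [← hc, algebraMap_smul, map_smul, ← hx] at h1
    simp_rw [← map_smul] at h1
    rw [← map_sum] at h1
    have h2 := (Ideal.toCotangent_eq _).1 h1.symm
    simpa using h2

end Algebra

/-! ### Fractions on affine open sets -/

section Localization

variable {X Y : Scheme.{u}} {U : X.Opens}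

lemma exists_res_eq_zero (hU : IsAffineOpen U) {V : X.Opens} (hV : V ≤ U) {f : Γ(X, U)}
    (hf : resO hV f = 0) {x : X} (hx : x ∈ V) :
    ∃ t : Γ(X, U), X.basicOpen t ≤ V ∧ x ∈ X.basicOpen t ∧ t * f = 0 := by
  obtain ⟨s, hs, hxs⟩ := hU.exists_basicOpen_le (V := V) ⟨x, hx⟩ (hV hx)
  have h0 : resO (X.basicOpen_le s) f = 0 := by
    rw [← resO_resO hV hs, hf, map_zero]
  obtain ⟨n, hn⟩ := exists_pow_mul_eq_zero_of_res_basicOpen_eq_zero_of_isAffineOpen X hU f s h0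
  -- One factor of `s` more than needed: `n` may be zero, and only a positive power has the same
  -- basic open set as `s`.
  refine ⟨s ^ (n + 1), ?_, ?_, by rw [pow_succ', mul_assoc, hn, mul_zero]⟩
  · rw [Scheme.basicOpen_pow _ _ n.succ_pos]; exact hs
  · rw [Scheme.basicOpen_pow _ _ n.succ_pos]; exact hxs

lemma isUnit_resO_basicOpen (t : Γ(X, U)) {V : X.Opens} (h : V ≤ X.basicOpen t) :
    IsUnit (resO (h.trans (X.basicOpen_le t)) t) := by
  rw [← resO_resO (X.basicOpen_le t) h]
  exact (RingedSpace.isUnit_res_basicOpen X.toLocallyRingedSpace.toRingedSpace t).map _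

/-- Functions on open subsets of an affine open set are locally fractions. -/
lemma exists_fraction (hU : IsAffineOpen U) {V : X.Opens} (hV : V ≤ U) (a : Γ(X, V)) {x : X}
    (hx : x ∈ V) :
    ∃ (t f : Γ(X, U)) (h : X.basicOpen t ≤ V), x ∈ X.basicOpen t ∧
      resO (X.basicOpen_le t) t * resO h a = resO (X.basicOpen_le t) f := by
  obtain ⟨s, hs, hxs⟩ := hU.exists_basicOpen_le (V := V) ⟨x, hx⟩ (hV hx)
  have := hU.isLocalization_basicOpen s
  obtain ⟨n, f, hf⟩ := IsLocalization.Away.surj s (resO hs a)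
  have hf : resO hs a * resO (X.basicOpen_le s) s ^ n = resO (X.basicOpen_le s) f := hf
  have hb : X.basicOpen (s ^ (n + 1)) = X.basicOpen s := Scheme.basicOpen_pow _ _ n.succ_pos
  -- The extra factor again keeps the exponent positive, so that the basic open set is that of `s`.
  refine ⟨s ^ (n + 1), s * f, hb.le.trans hs, hb.ge hxs, ?_⟩
  have := congrArg (resO hb.le) hf
  simp only [map_mul, map_pow, resO_resO] at this ⊢
  rw [← this]; ring

lemma pull_ne {i : Y ⟶ X} {V : X.Opens} {t : Γ(X, V)} (ht : IsUnit t) : IsUnit (pull i V t) :=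
  ht.map _

end Localization

/-- Derivations from `𝒪_X` to `i_* 𝒪_Y` over `U`. -/
structure SheafDerivation {k : Type u} [Field k] {X Y : Scheme.{u}} (sX : X ⟶ Spec (.of k))
    (i : Y ⟶ X) (U : X.Opens) where
  /-- the derivation -/
  toFun : ∀ V : X.Opens, V ≤ U → Γ(X, V) →+ Γ(Y, i ⁻¹ᵁ V)
  map_const : ∀ V h c, toFun V h (const sX V c) = 0
  leibniz : ∀ V h a b, toFun V h (a * b) = pull i V a * toFun V h b + pull i V b * toFun V h a
  res : ∀ V V' (h : V ≤ U) (h' : V' ≤ V) a,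
    toFun V' (h'.trans h) (resO h' a) = resOP i h' (toFun V h a)

namespace SheafDerivation

variable {k : Type u} [Field k] {X Y : Scheme.{u}} {sX : X ⟶ Spec (.of k)}
  {i : Y ⟶ X} {U : X.Opens} {δ : Γ(X, U) →+ Γ(Y, i ⁻¹ᵁ U)}

/-- `g` is the value at `a` of the extension to `V` of the derivation `δ` of functions on `U`. -/
def IsValue (δ : Γ(X, U) →+ Γ(Y, i ⁻¹ᵁ U)) {V : X.Opens} (hV : V ≤ U) (a : Γ(X, V))
    (g : Γ(Y, i ⁻¹ᵁ V)) : Prop :=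
  ∀ (V' : X.Opens) (h : V' ≤ V) (t f : Γ(X, U)),
    resO (h.trans hV) t * resO h a = resO (h.trans hV) f →
      pull i V' (resO (h.trans hV) t) * resOP i h g +
        pull i V' (resO h a) * resOP i (h.trans hV) (δ t) =
          resOP i (h.trans hV) (δ f)

/-- Derivations are local: if tf = 0, then t²δ(f) = 0 by the Leibniz rule, and t may be chosen
invertible near the given point. -/
lemma res_eq_zero (hδ : ∀ a b, δ (a * b) = pull i U a * δ b + pull i U b * δ a)
    (hU : IsAffineOpen U) {V : X.Opens} (hV : V ≤ U) {f : Γ(X, U)} (hf : resO hV f = 0) :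
    resOP i hV (δ f) = 0 := by
  refine resOP_ext fun x hx => ?_
  obtain ⟨t, ht, hxt, h0⟩ := exists_res_eq_zero hU hV hf hx
  refine ⟨_, ht, hxt, ?_⟩
  have h1 := hδ t f
  rw [h0, map_zero] at h1
  have h2 : pull i U t * pull i U t * δ f = 0 := by
    have h3 : pull i U t * pull i U f = 0 := by rw [← map_mul, h0, map_zero]
    linear_combination (-pull i U t) * h1 - δ t * h3
  have hu := pull_ne (i := i) (isUnit_resO_basicOpen t le_rfl)
  have h3 := congrArg (resOP i (X.basicOpen_le t)) h2
  simp only [map_mul, map_zero, resOP_pull (X.basicOpen_le t)] at h3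
  rw [map_zero, resOP_resOP]
  exact (hu.mul hu).mul_right_eq_zero.1 h3

/-- One fraction f/t for `a` suffices. If f'/t' is another, then tf' − t'f restricts to zero, hence
so does its derivative, and the two quotient rules agree. -/
lemma IsValue.of_fraction (hδ : ∀ a b, δ (a * b) = pull i U a * δ b + pull i U b * δ a)
    (hU : IsAffineOpen U) {V : X.Opens} {hV : V ≤ U} {a : Γ(X, V)} {g : Γ(Y, i ⁻¹ᵁ V)}
    {t f : Γ(X, U)} (ht : IsUnit (resO hV t)) (hf : resO hV t * a = resO hV f)
    (hg : pull i V (resO hV t) * g + pull i V a * resOP i hV (δ t) =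
      resOP i hV (δ f)) : IsValue δ hV a g := by
  intro V' h t' f' hf'
  have hu := pull_ne (i := i) (ht.map (resO h))
  have hf1 := congrArg (resO h) hf
  have hg1 := congrArg (resOP i h) hg
  simp only [map_mul, map_add, resO_resO, resOP_resOP, resOP_pull h] at hf1 hg1 hu
  have h0 : resO (h.trans hV) (t * f' - t' * f) = 0 := by
    rw [map_sub, map_mul, map_mul, ← hf', ← hf1]; ring
  have h1 := res_eq_zero hδ hU (h.trans hV) h0
  simp only [map_sub, hδ, map_add, map_mul, resOP_pull (h.trans hV), ← hf', ← hf1] at h1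
  refine hu.mul_left_cancel ?_
  linear_combination pull i V' (resO (h.trans hV) t') * hg1 - h1

lemma IsValue.res {V V' : X.Opens} {hV : V ≤ U} (h : V' ≤ V) {a : Γ(X, V)} {g : Γ(Y, i ⁻¹ᵁ V)}
    (H : IsValue δ hV a g) :
    IsValue δ (h.trans hV) (resO h a) (resOP i h g) := by
  intro V'' h' t f hf
  rw [resO_resO] at hf
  rw [resO_resO, resOP_resOP]
  exact H V'' (h'.trans h) t f hf

lemma IsValue.of_local {V : X.Opens} {hV : V ≤ U} {a : Γ(X, V)} {g : Γ(Y, i ⁻¹ᵁ V)}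
    (H : ∀ x ∈ V, ∃ (V' : X.Opens) (h : V' ≤ V), x ∈ V' ∧
      IsValue δ (h.trans hV) (resO h a) (resOP i h g)) : IsValue δ hV a g := by
  intro V' h t f hf
  refine resOP_ext fun x hx => ?_
  obtain ⟨V'', h'', hxV, H⟩ := H x (h hx)
  refine ⟨V' ⊓ V'', inf_le_left, ⟨hx, hxV⟩, ?_⟩
  have := H (V' ⊓ V'') inf_le_right t f (by
    have := congrArg (resO (inf_le_left : V' ⊓ V'' ≤ V')) hf
    simpa only [map_mul, resO_resO] using this)
  simpa only [map_mul, map_add, resO_resO, resOP_resOP, resOP_pull (inf_le_left : V' ⊓ V'' ≤ V')] using this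

/-- Near each point `a` is a fraction with invertible denominator, and there the quotient rule
leaves only one value. -/
lemma IsValue.unique (hU : IsAffineOpen U) {V : X.Opens} {hV : V ≤ U} {a : Γ(X, V)}
    {g g' : Γ(Y, i ⁻¹ᵁ V)} (H : IsValue δ hV a g) (H' : IsValue δ hV a g') : g = g' := by
  refine resOP_ext fun x hx => ?_
  obtain ⟨t, f, h, hxt, hf⟩ := exists_fraction hU hV a hx
  refine ⟨_, h, hxt, ?_⟩
  have hu := pull_ne (i := i) (isUnit_resO_basicOpen t le_rfl)
  exact hu.mul_left_cancel (add_right_cancel ((H _ h t f hf).trans (H' _ h t f hf).symm))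

/-- The quotient rule (δ(f) − aδ(t))/t gives values on small open sets, and uniqueness glues them.
-/
lemma exists_isValue (hδ : ∀ a b, δ (a * b) = pull i U a * δ b + pull i U b * δ a)
    (hU : IsAffineOpen U) {V : X.Opens} (hV : V ≤ U) (a : Γ(X, V)) :
    ∃ g, IsValue δ hV a g := by
  obtain ⟨g, hg⟩ := resOP_glue (i := i) (V := V) (fun V' h g => IsValue δ (h.trans hV) (resO h a) g)
    (fun V' h g H V'' h' => by simpa only [resO_resO] using H.res h')
    (fun V' h g g' H H' => H.unique hU H') (fun x hx => by
      obtain ⟨t, f, h, hxt, hf⟩ := exists_fraction hU hV a hx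
      have hu := pull_ne (i := i) (isUnit_resO_basicOpen t le_rfl)
      obtain ⟨v, hv⟩ := hu
      refine ⟨_, h, hxt, v⁻¹ * (resOP i (h.trans hV) (δ f) -
        pull i _ (resO h a) * resOP i (h.trans hV) (δ t)),
        IsValue.of_fraction hδ hU (isUnit_resO_basicOpen t le_rfl) hf ?_⟩
      rw [← hv, Units.mul_inv_cancel_left]
      ring)
  refine ⟨g, IsValue.of_local fun x hx => ?_⟩
  obtain ⟨t, f, h, hxt, hf⟩ := exists_fraction hU hV a hx
  have hu := pull_ne (i := i) (isUnit_resO_basicOpen t le_rfl)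
  obtain ⟨v, hv⟩ := hu
  have H : IsValue δ (h.trans hV) (resO h a) (v⁻¹ * (resOP i (h.trans hV) (δ f) -
        pull i _ (resO h a) * resOP i (h.trans hV) (δ t))) :=
    IsValue.of_fraction hδ hU (isUnit_resO_basicOpen t le_rfl) hf (by
      rw [← hv, Units.mul_inv_cancel_left]
      ring)
  refine ⟨_, h, hxt, ?_⟩
  rw [hg _ h _ H]
  exact H

/-- Two functions on an open subset of an affine open set are locally fractions with the same
denominator. -/
lemma exists_fraction₂ (hU : IsAffineOpen U) {V : X.Opens} (hV : V ≤ U) (a b : Γ(X, V)) {x : X}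
    (hx : x ∈ V) :
    ∃ (V' : X.Opens) (h : V' ≤ V) (t f g : Γ(X, U)), x ∈ V' ∧ IsUnit (resO (h.trans hV) t) ∧
      resO (h.trans hV) t * resO h a = resO (h.trans hV) f ∧
      resO (h.trans hV) t * resO h b = resO (h.trans hV) g := by
  obtain ⟨t, f, h, hxt, hf⟩ := exists_fraction hU hV a hx
  obtain ⟨t', f', h', hxt', hf'⟩ := exists_fraction hU hV b hx
  refine ⟨X.basicOpen t ⊓ X.basicOpen t', inf_le_left.trans h, t * t', t' * f, t * f',
    ⟨hxt, hxt'⟩, ?_, ?_, ?_⟩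
  · rw [map_mul]
    exact (isUnit_resO_basicOpen t inf_le_left).mul (isUnit_resO_basicOpen t' inf_le_right)
  · have := congrArg (resO (inf_le_left : X.basicOpen t ⊓ X.basicOpen t' ≤ _)) hf
    simp only [map_mul, resO_resO] at this ⊢
    rw [← this]; ring
  · have := congrArg (resO (inf_le_right : X.basicOpen t ⊓ X.basicOpen t' ≤ _)) hf'
    simp only [map_mul, resO_resO] at this ⊢
    rw [← this]; ring

/-- A derivation of the functions on an affine open set extends to a derivation of sheaves. -/
lemma exists_extension (hδ : ∀ a b, δ (a * b) = pull i U a * δ b + pull i U b * δ a)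
    (hc : ∀ c, δ (const sX U c) = 0) (hU : IsAffineOpen U) :
    ∃ D : SheafDerivation sX i U, ∀ a, D.toFun U le_rfl a = δ a := by
  have hone : δ 1 = 0 := by simpa using hc 1
  have hval : ∀ (V : X.Opens) (h : V ≤ U) (f : Γ(X, U)),
      IsValue δ h (resO h f) (resOP i h (δ f)) := fun V h f =>
    IsValue.of_fraction hδ hU (t := 1) (f := f) (by simp) (by simp) (by simp [hone])
  choose d hd using fun (V : X.Opens) (h : V ≤ U) (a : Γ(X, V)) => exists_isValue hδ hU h a
  have hadd : ∀ (V : X.Opens) (h : V ≤ U) (a b : Γ(X, V)), d V h (a + b) = d V h a + d V h b := by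
    intro V hV a b
    refine (hd V hV (a + b)).unique hU (IsValue.of_local fun x hx => ?_)
    obtain ⟨V', h, t, f, g, hx', hu, hf, hg⟩ := exists_fraction₂ hU hV a b hx
    refine ⟨V', h, hx', IsValue.of_fraction hδ hU (t := t) (f := f + g) hu ?_ ?_⟩
    · rw [map_add, map_add, mul_add, hf, hg]
    · have h1 := hd V hV a V' h t f hf
      have h2 := hd V hV b V' h t g hg
      simp only [map_add]
      linear_combination h1 + h2
  refine ⟨⟨fun V h => AddMonoidHom.mk' (d V h) (hadd V h), fun V h c => ?_, fun V hV a b => ?_,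
    fun V V' h h' a => ?_⟩, fun a => ?_⟩
  · have := hval V h (const sX U c)
    rw [hc, map_zero, resO_const] at this
    exact (hd V h _).unique hU this
  · refine (hd V hV (a * b)).unique hU (IsValue.of_local fun x hx => ?_)
    obtain ⟨V', h, t, f, g, hx', hu, hf, hg⟩ := exists_fraction₂ hU hV a b hx
    refine ⟨V', h, hx', IsValue.of_fraction hδ hU (t := t * t) (f := f * g) ?_ ?_ ?_⟩
    · rw [map_mul]; exact hu.mul hu
    · simp only [map_mul]
      rw [← hf, ← hg]; ring
    · have h1 := hd V hV a V' h t f hf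
      have h2 := hd V hV b V' h t g hg
      have h3 := congrArg (pull i V') hf
      have h4 := congrArg (pull i V') hg
      simp only [map_mul] at h3 h4
      simp only [map_add, map_mul, hδ, resOP_pull (h.trans hV), resOP_pull h,
        AddMonoidHom.mk'_apply]
      rw [← h3, ← h4, ← h1, ← h2]
      ring
  · exact (hd V' (h'.trans h) _).unique hU ((hd V h a).res h')
  · have := hval U le_rfl a
    rw [resO_self, resOP_self] at this
    exact (hd U le_rfl a).unique hU this

end SheafDerivation

/-! ### Vector fields transverse to Y and sections of N(E) -/

section Transverse

variable {k : Type u} [Field k] {X Y : Scheme.{u}} {sX : X ⟶ Spec (.of k)}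
  {i : Y ⟶ X} {U : X.Opens}

lemma smooth_const (sX : X ⟶ Spec (.of k)) [Smooth sX] (hU : IsAffineOpen U) :
    (const sX U).Smooth := by
  have h := sX.smooth_appLE (isAffineOpen_top _) hU le_top
  exact RingHom.Smooth.respectsIso.2 _ (Scheme.ΓSpecIso (.of k)).symm.commRingCatIsoToRingEquiv h

/-- The value of a section of `N(M)`. -/
def napp {M : Y.PresheafOfModules} {T : Y.Opens} (ζ : NormalEnd i M T) {V : X.Opens}
    (h : i ⁻¹ᵁ V ≤ T) : idealSec i V →+ SecP i M V →ₗ[Γ(Y, i ⁻¹ᵁ V)] SecP i M V :=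
  ζ.1 ⟨V, h⟩

namespace NormalEnd

variable {M : Y.PresheafOfModules} {T : Y.Opens} (ζ : NormalEnd i M T)

lemma app_smul {V : X.Opens} (h : i ⁻¹ᵁ V ≤ T) (f : Γ(X, V)) (x : idealSec i V) (m : SecP i M V) :
    napp ζ h (f • x) m = pull i V f • napp ζ h x m :=
  congr($(ζ.2.1 ⟨V, h⟩ f x) m)

lemma app_res {V V' : X.Opens} (h : i ⁻¹ᵁ V ≤ T) (h' : V' ≤ V) (x : idealSec i V)
    (m : SecP i M V) :
    napp ζ ((preimage_le i h').trans h) (resI i h' x) (resP i M h' m) =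
      resP i M h' (napp ζ h x m) :=
  ζ.2.2 ⟨V, h⟩ ⟨V', (preimage_le i h').trans h⟩ h' x m

/-- ζ(xy) = x|_Y · ζ(y) = 0 when x and y vanish on `Y`; so ζ lives on I/I². -/
lemma app_sq {V : X.Opens} (h : i ⁻¹ᵁ V ≤ T) {q : idealSec i V} (hq : q.1 ∈ idealSec i V ^ 2) :
    napp ζ h q = 0 := by
  obtain ⟨q, hq'⟩ := q
  replace hq : q ∈ idealSec i V ^ 2 := hq
  rw [pow_two] at hq
  induction hq using Submodule.mul_induction_on' with
  | mem_mul_mem x hx y hy =>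
    refine LinearMap.ext fun m => (app_smul ζ h x ⟨y, hy⟩ m).trans ?_
    rw [mem_idealSec.1 hx, zero_smul, LinearMap.zero_apply]
  | add x hx y hy h1 h2 =>
    have hx' : x ∈ idealSec i V := Ideal.mul_le_left hx
    have hy' : y ∈ idealSec i V := Ideal.mul_le_left hy
    refine (map_add (napp ζ h) ⟨x, hx'⟩ ⟨y, hy'⟩).trans ?_
    rw [h1 hx', h2 hy', add_zero]

lemma ext {ζ ξ : NormalEnd i M T}
    (H : ∀ (V : X.Opens) (h : i ⁻¹ᵁ V ≤ T) x m, napp ζ h x m = napp ξ h x m) : ζ = ξ :=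
  Subtype.ext (funext fun V => AddMonoidHom.ext fun x => LinearMap.ext fun m => H V.1 V.2 x m)

lemma add_app (ζ ξ : NormalEnd i M T) {V : X.Opens} (h : i ⁻¹ᵁ V ≤ T) (x : idealSec i V)
    (m : SecP i M V) : napp (ζ + ξ) h x m = napp ζ h x m + napp ξ h x m := rfl

end NormalEnd

lemma smul_sec_cancel {M : Y.PresheafOfModules} {V : Y.Opens} {r : Γ(Y, V)} (hr : IsUnit r)
    {m m' : Sec M V} (h : r • m = r • m') : m = m' :=
  hr.smul_left_cancel.1 h

lemma resO_mem_idealSec_pow {V W : X.Opens} (h : W ≤ V) {n : ℕ} {q : Γ(X, V)}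
    (hq : q ∈ idealSec i V ^ n) : resO h q ∈ idealSec i W ^ n := by
  have := Ideal.mem_map_of_mem (resO h) hq
  rw [Ideal.map_pow] at this
  have hle : Ideal.map (resO h) (idealSec i V) ≤ idealSec i W :=
    Ideal.map_le_iff_le_comap.2 fun a ha => (resI i h ⟨a, ha⟩).2
  exact Ideal.pow_right_mono hle n this

/-- The algebraic splitting lemma for k → Γ(X, U) → Γ(Y, Y ∩ U): as U is affine, both algebras are
smooth over k and the second map is surjective. -/
lemma exists_transverse_sections (sX : X ⟶ Spec (.of k)) (i : Y ⟶ X) [Smooth sX]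
    [IsClosedImmersion i] [Smooth (i ≫ sX)] (hU : IsAffineOpen U) :
    ∃ (n : ℕ) (x : Fin n → Γ(X, U)) (δ : Fin n → Γ(X, U) →+ Γ(Y, i ⁻¹ᵁ U)),
      (∀ j, x j ∈ idealSec i U) ∧
      (∀ j a b, δ j (a * b) = pull i U a * δ j b + pull i U b * δ j a) ∧
      (∀ j c, δ j (const sX U c) = 0) ∧
      ∀ f ∈ idealSec i U, ∃ c : Fin n → Γ(X, U), (∀ j, pull i U (c j) = δ j f) ∧
        f - ∑ j, c j * x j ∈ idealSec i U ^ 2 := by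
  have hUY : IsAffineOpen (i ⁻¹ᵁ U) := hU.preimage i
  let : Algebra k Γ(X, U) := (const sX U).toAlgebra
  let : Algebra k Γ(Y, i ⁻¹ᵁ U) := (const (i ≫ sX) (i ⁻¹ᵁ U)).toAlgebra
  let : Algebra Γ(X, U) Γ(Y, i ⁻¹ᵁ U) := (pull i U).toAlgebra
  have : IsScalarTower k Γ(X, U) Γ(Y, i ⁻¹ᵁ U) := IsScalarTower.of_algebraMap_eq fun c =>
    (pull_const sX i U c).symm
  have h1 : Algebra.Smooth k Γ(X, U) := smooth_const sX hU
  have h2 : Algebra.Smooth k Γ(Y, i ⁻¹ᵁ U) := smooth_const (i ≫ sX) hUY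
  obtain ⟨n, x, δ, hx, hδ⟩ := exists_transverse_derivations (k := k) (A := Γ(X, U))
    (B := Γ(Y, i ⁻¹ᵁ U)) (i.app_surjective U hU)
  exact ⟨n, x, fun j => (δ j : Γ(X, U) →+ Γ(Y, i ⁻¹ᵁ U)), hx, fun j a b => (δ j).leibniz a b,
    fun j c => (δ j).map_algebraMap c, hδ⟩

/-- Functions `xⱼ` vanishing on `Y` and vector fields `Dⱼ` along `Y`, on an affine open set, for
which every `ζ : I_Y → ℰnd(E)` is given by `ζ(z) = ∑ Dⱼ(z) ζ(xⱼ)`. -/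
lemma exists_transverse_sheafDerivations (sX : X ⟶ Spec (.of k)) (i : Y ⟶ X) [Smooth sX]
    [IsClosedImmersion i] [Smooth (i ≫ sX)] (hU : IsAffineOpen U) :
    ∃ (n : ℕ) (x : Fin n → idealSec i U) (D : Fin n → SheafDerivation sX i U),
      ∀ (E : Y.PresheafOfModules) [IsSheafOfModules E] (T : Y.Opens) (hT : i ⁻¹ᵁ U ≤ T)
        (ζ : NormalEnd i E T) (V : X.Opens) (h : V ≤ U) (z : idealSec i V) (m : SecP i E V),
        napp ζ ((preimage_le i h).trans hT) z m =
          ∑ j, (D j).toFun V h z.1 • napp ζ ((preimage_le i h).trans hT) (resI i h (x j)) m := by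
  have hUY : IsAffineOpen (i ⁻¹ᵁ U) := hU.preimage i
  obtain ⟨n, x, δ, hx, hl, hc, hδ⟩ := exists_transverse_sections sX i hU
  choose D hD using fun j => SheafDerivation.exists_extension (hl j) (hc j) hU
  refine ⟨n, fun j => ⟨x j, hx j⟩, D, fun E _ T hT ζ V hV z m => ?_⟩
  refine resP_ext fun p hp => ?_
  obtain ⟨t, f, h, hpt, hf⟩ := exists_fraction hU hV z.1 hp
  refine ⟨X.basicOpen t, h, hpt, ?_⟩
  have hb : i ⁻¹ᵁ X.basicOpen t = Y.basicOpen (pull i U t) := Scheme.preimage_basicOpen i t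
  -- The numerator f of z = f/t vanishes on `Y` only over the basic open set of t. Multiplying it by
  -- a power of t puts it into `I_Y(U)`, where the expansion modulo I² is available.
  have hfY : resO (Y.basicOpen_le (pull i U t)) (pull i U f) = 0 := by
    rw [← resO_resO (preimage_le i (X.basicOpen_le t)) hb.ge, resO_pull i (X.basicOpen_le t), ← hf,
      map_mul, ← resOP_pull h, mem_idealSec.1 z.2, map_zero, mul_zero, map_zero]
  obtain ⟨l, hl⟩ := exists_pow_mul_eq_zero_of_res_basicOpen_eq_zero_of_isAffineOpen Y hUY _ _ hfY
  have hfI : t ^ l * f ∈ idealSec i U := by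
    rw [mem_idealSec, map_mul, map_pow, hl]
  obtain ⟨c, hc, hq⟩ := hδ _ hfI
  have hWU : X.basicOpen t ≤ U := X.basicOpen_le t
  have hu : IsUnit (pull i (X.basicOpen t) (resO hWU (t ^ (l + 1)))) := by
    rw [map_pow]
    exact pull_ne ((isUnit_resO_basicOpen t le_rfl).pow _)
  have hz : resO hWU (t ^ l * f) = resO hWU (t ^ (l + 1)) * resO h z.1 := by
    rw [map_mul, ← hf, pow_succ, map_mul]; ring
  clear hf hb hfY hpt
  generalize X.basicOpen t = W at *
  have hDres : ∀ j, resOP i h ((D j).toFun V hV z.1) =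
      (D j).toFun W hWU (resO h z.1) := fun j => ((D j).res V W hV h z.1).symm
  rw [← NormalEnd.app_res ζ, map_sum]
  simp only [resP_smul, ← NormalEnd.app_res ζ, hDres]
  -- Both sides may be multiplied by t^(l+1), a unit on the trace of `W`; and t^(l+1)z is the
  -- restriction of the global element t^l f.
  apply smul_sec_cancel hu
  rw [← NormalEnd.app_smul ζ, Finset.smul_sum]
  have e1 : (resO hWU (t ^ (l + 1)) • resI i h z : idealSec i W) =
      ∑ j, resO hWU (c j) • resI i hWU ⟨x j, hx j⟩ +
        resI i hWU ⟨_, Ideal.pow_le_self two_ne_zero hq⟩ := by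
    apply Subtype.ext
    change resO _ (t ^ (l + 1)) * resO h z.1 = _
    rw [← hz, Submodule.coe_add, AddSubmonoidClass.coe_finsetSum]
    change _ = ∑ j, resO _ (c j) * resO _ (x j) + resO _ (_ - _)
    simp only [map_sub, map_sum, map_mul]
    ring
  rw [e1, map_add, map_sum, NormalEnd.app_sq ζ, add_zero, LinearMap.sum_apply]
  · refine Finset.sum_congr rfl fun j _ => ?_
    rw [NormalEnd.app_smul ζ, smul_smul]
    congr 1
    -- The term with the derivative of t^(l+1) drops out because z vanishes on `Y`.
    have h3 := (D j).leibniz W hWU (resO hWU (t ^ (l + 1))) (resO h z.1)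
    rw [← hz, ← resOP_pull h, mem_idealSec.1 z.2, map_zero, zero_mul, add_zero] at h3
    rw [← h3, ← resOP_pull hWU, hc j]
    have h4 := (D j).res U W le_rfl hWU (t ^ l * f)
    rw [hD] at h4
    · exact h4.symm
    · congr 2
      exact Subtype.ext (resO_resO hV h (x j)).symm
  · exact resO_mem_idealSec_pow _ hq

end Transverse

/-! ### Sections of first order quantizations -/

namespace DualAlgebra

variable {k : Type u} [Field k] {X Y : Scheme.{u}} {sX : X ⟶ Spec (.of k)} {i : Y ⟶ X}
  (𝒜 : DualAlgebra sX) {P : Bivector sX}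

/-- The restriction to `Y` of the reduction modulo `ε`. -/
def redY (i : Y ⟶ X) (V : X.Opens) : 𝒜.Sections V →+* Γ(Y, i ⁻¹ᵁ V) := (pull i V).comp (𝒜.red V)

variable {𝒜}

lemma redY_apply {V : X.Opens} (a : 𝒜.Sections V) : 𝒜.redY i V a = pull i V (𝒜.red V a) := rfl

lemma resA_resA {V W Z : X.Opens} (h : W ≤ V) (h' : Z ≤ W) (a : 𝒜.Sections V) :
    𝒜.resA h' (𝒜.resA h a) = 𝒜.resA (h'.trans h) a := by
  have := 𝒜.ring.obj.map_comp (homOfLE h).op (homOfLE h').op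
  exact (congr($(this).hom a)).symm

lemma resA_self {V : X.Opens} (h : V ≤ V) (a : 𝒜.Sections V) : 𝒜.resA h a = a :=
  congr($(𝒜.ring.obj.map_id (op V)).hom a)

lemma red_resA {V W : X.Opens} (h : W ≤ V) (a : 𝒜.Sections V) :
    𝒜.red W (𝒜.resA h a) = resO h (𝒜.red V a) :=
  congr($(𝒜.proj.naturality (homOfLE h).op).hom a)

lemma redY_resA {V W : X.Opens} (h : W ≤ V) (a : 𝒜.Sections V) :
    𝒜.redY i W (𝒜.resA h a) = resOP i h (𝒜.redY i V a) := by
  rw [redY_apply, red_resA, redY_apply, resOP_pull]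

lemma resA_scalar {V W : X.Opens} (h : W ≤ V) (c : DualNumber k) :
    𝒜.resA h (𝒜.scalar V c) = 𝒜.scalar W c :=
  𝒜.scalar_res V W h c

lemma resA_eps {V W : X.Opens} (h : W ≤ V) : 𝒜.resA h (𝒜.eps V) = 𝒜.eps W :=
  resA_scalar h _

lemma eps_mul_eps (V : X.Opens) : 𝒜.eps V * 𝒜.eps V = 0 := by
  rw [eps, ← map_mul, DualNumber.eps_mul_eps, map_zero]

lemma eps_comm {V : X.Opens} (a : 𝒜.Sections V) : 𝒜.eps V * a = a * 𝒜.eps V :=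
  𝒜.scalar_comm V _ a

lemma red_eps (V : X.Opens) : 𝒜.red V (𝒜.eps V) = 0 := by
  refine (𝒜.proj_scalar V _).trans ?_
  rw [DualNumber.fst_eps, map_zero]

lemma redY_eps_mul {V : X.Opens} (a : 𝒜.Sections V) : 𝒜.redY i V (𝒜.eps V * a) = 0 := by
  rw [redY_apply, map_mul, red_eps, zero_mul, map_zero]

lemma redY_scalar {V : X.Opens} (c : DualNumber k) :
    𝒜.redY i V (𝒜.scalar V c) = const (i ≫ sX) (i ⁻¹ᵁ V) c.fst := by
  rw [redY_apply, ← pull_const]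
  exact congrArg _ (𝒜.proj_scalar V c)

/-- Restriction of splittings. -/
def Splitting.restrict {U U' : X.Opens} (τ : 𝒜.Splitting P U) (h : U' ≤ U) :
    𝒜.Splitting P U' where
  toFun V hV := τ.toFun V (hV.trans h)
  res V V' hV h' a := τ.res V V' (hV.trans h) h' a
  map_const V hV c a := τ.map_const V (hV.trans h) c a
  red_toFun V hV a := τ.red_toFun V (hV.trans h) a
  bijective V hV s := τ.bijective V (hV.trans h) s
  mul V hV a b := τ.mul V (hV.trans h) a b

lemma Splitting.exists_eq {U : X.Opens} (τ : 𝒜.Splitting P U) {V : X.Opens} (h : V ≤ U)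
    (a : 𝒜.Sections V) : ∃ c, a = τ.toFun V h (𝒜.red V a) + 𝒜.eps V * τ.toFun V h c := by
  obtain ⟨⟨b, c⟩, hb, -⟩ := τ.bijective V h a
  have : 𝒜.red V a = b := by
    rw [hb, map_add, map_mul, red_eps, zero_mul, add_zero, τ.red_toFun]
  exact ⟨c, by rw [this]; exact hb⟩

/-- ab is symmetric and ½P(da, db) is antisymmetric, so the commutator is twice the latter. The
ε-parts of the two factors contribute nothing, since products are commutative modulo ε. -/
lemma Splitting.commutator [CharZero k] {U : X.Opens} (τ : 𝒜.Splitting P U) {V : X.Opens}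
    (h : V ≤ U) (a b : 𝒜.Sections V) : a * b = b * a +
      𝒜.eps V * τ.toFun V h (P.toFun V (𝒜.red V a) (𝒜.red V b)) := by
  obtain ⟨a', ha⟩ := τ.exists_eq h a
  obtain ⟨b', hb⟩ := τ.exists_eq h b
  generalize 𝒜.red V a = x at *
  generalize 𝒜.red V b = y at *
  have hee : ∀ z : 𝒜.Sections V, 𝒜.eps V * (𝒜.eps V * z) = 0 := fun z => by
    rw [← mul_assoc, eps_mul_eps, zero_mul]
  have hc : ∀ u v : Γ(X, V), 𝒜.eps V * (τ.toFun V h u * τ.toFun V h v) =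
      𝒜.eps V * (τ.toFun V h v * τ.toFun V h u) := fun u v => by
    rw [τ.mul, τ.mul, mul_add, mul_add, hee, hee, mul_comm u v]
  have h1 : τ.toFun V h x * τ.toFun V h y = τ.toFun V h y * τ.toFun V h x +
      𝒜.eps V * τ.toFun V h (P.toFun V x y) := by
    rw [τ.mul, τ.mul, mul_comm x y, add_assoc, ← mul_add, ← map_add, P.swap V y x]
    congr 3
    have h2 : const sX V (2⁻¹ : k) + const sX V (2⁻¹ : k) = 1 := by
      rw [← map_add, ← two_mul, mul_inv_cancel₀ two_ne_zero, map_one]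
    linear_combination (P.toFun V x y) * h2
  have e1 : τ.toFun V h x * (𝒜.eps V * τ.toFun V h b') =
      𝒜.eps V * (τ.toFun V h b' * τ.toFun V h x) := by
    rw [← mul_assoc, ← eps_comm, mul_assoc, hc]
  have e2 : τ.toFun V h y * (𝒜.eps V * τ.toFun V h a') =
      𝒜.eps V * (τ.toFun V h a' * τ.toFun V h y) := by
    rw [← mul_assoc, ← eps_comm, mul_assoc, hc]
  have e3 : ∀ u v : Γ(X, V), 𝒜.eps V * τ.toFun V h u * (𝒜.eps V * τ.toFun V h v) = 0 :=
    fun u v => by rw [eps_comm (τ.toFun V h v), ← mul_assoc, mul_assoc (𝒜.eps V), ← eps_comm, hee]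
  rw [ha, hb]
  simp only [mul_add, add_mul, e1, e2, e3, h1, add_zero, mul_assoc]
  abel

end DualAlgebra

namespace Quantization

variable {k : Type u} [Field k] {X Y : Scheme.{u}} {sX : X ⟶ Spec (.of k)} {i : Y ⟶ X}
  {P : Bivector sX} (𝒜 : Quantization sX P)

lemma exists_splitting_le {O : X.Opens} {x : X} (hx : x ∈ O) :
    ∃ U ≤ O, x ∈ U ∧ IsAffineOpen U ∧ Nonempty (𝒜.toDualAlgebra.Splitting P U) := by
  obtain ⟨U, hxU, hU, ⟨τ⟩⟩ := 𝒜.exists_splitting x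
  obtain ⟨U', hU', hxU', hle⟩ := exists_isAffineOpen_mem_and_subset (U := U ⊓ O) (x := x) ⟨hxU, hx⟩
  exact ⟨U', fun z hz => (hle hz).2, hxU', hU', ⟨τ.restrict fun z hz => (hle hz).1⟩⟩

lemma exists_red_eq {V : X.Opens} (f : Γ(X, V)) {x : X} (hx : x ∈ V) :
    ∃ (V' : X.Opens) (h : V' ≤ V), x ∈ V' ∧ ∃ a, 𝒜.red V' a = resO h f := by
  obtain ⟨U, hU, hxU, -, ⟨τ⟩⟩ := 𝒜.exists_splitting_le hx
  exact ⟨U, hU, hxU, τ.toFun U le_rfl (resO hU f), τ.red_toFun _ _ _⟩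

/-- Local lifting from 𝒪_Y through 𝒪_X to `𝒜`. It is used throughout to replace a function on `Y` by
a section of `𝒜` that acts. -/
lemma exists_redY_eq [IsClosedImmersion i] {V : X.Opens} (b : Γ(Y, i ⁻¹ᵁ V)) {x : X} (hx : x ∈ V) :
    ∃ (V' : X.Opens) (h : V' ≤ V), x ∈ V' ∧ ∃ a, 𝒜.redY i V' a = resOP i h b := by
  obtain ⟨U, hU, hxU, hUa, ⟨τ⟩⟩ := 𝒜.exists_splitting_le hx
  obtain ⟨f, hf⟩ := i.app_surjective U hUa (resOP i hU b)
  exact ⟨U, hU, hxU, τ.toFun U le_rfl f, by rw [DualAlgebra.redY_apply, τ.red_toFun]; exact hf⟩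

end Quantization

/-! ### Actions on `E ⊕ εE` -/

/-- An action of `𝒜` on the trivial extension `E ⊕ εE` over `U`, with `a · e = ae + ε act(a, e)`. -/
structure Act {k : Type u} [Field k] {X Y : Scheme.{u}} {sX : X ⟶ Spec (.of k)} (i : Y ⟶ X)
    (𝒜 : DualAlgebra sX) (E : Y.PresheafOfModules) (U : X.Opens) where
  /-- the first order term of the action -/
  toFun : ∀ V : X.Opens, V ≤ U → 𝒜.Sections V →+ SecP i E V →+ SecP i E V
  res : ∀ (V V' : X.Opens) (h : V ≤ U) (h' : V' ≤ V) (a : 𝒜.Sections V) (e : SecP i E V),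
    toFun V' (h'.trans h) (𝒜.resA h' a) (resP i E h' e) = resP i E h' (toFun V h a e)
  mul : ∀ (V : X.Opens) (h : V ≤ U) (a b : 𝒜.Sections V) (e : SecP i E V),
    toFun V h (a * b) e = 𝒜.redY i V a • toFun V h b e + toFun V h a (𝒜.redY i V b • e)
  eps : ∀ (V : X.Opens) (h : V ≤ U) (a : 𝒜.Sections V) (e : SecP i E V),
    toFun V h (𝒜.eps V * a) e = 𝒜.redY i V a • e
  const : ∀ (V : X.Opens) (h : V ≤ U) (c : k) (e : SecP i E V),
    toFun V h (𝒜.scalar V (TrivSqZeroExt.inl c)) e = 0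

namespace Act

variable {k : Type u} [Field k] {X Y : Scheme.{u}} {sX : X ⟶ Spec (.of k)} {i : Y ⟶ X}
  {P : Bivector sX}

section

variable {𝒜 : DualAlgebra sX} {E : Y.PresheafOfModules} {U : X.Opens}

/-- Restriction to a smaller open set. -/
def restrict (A : Act i 𝒜 E U) {U' : X.Opens} (h : U' ≤ U) : Act i 𝒜 E U' where
  toFun V hV := A.toFun V (hV.trans h)
  res V V' hV h' := A.res V V' (hV.trans h) h'
  mul V hV := A.mul V (hV.trans h)
  eps V hV := A.eps V (hV.trans h)
  const V hV := A.const V (hV.trans h)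

lemma one (A : Act i 𝒜 E U) {V : X.Opens} (h : V ≤ U) (e : SecP i E V) : A.toFun V h 1 e = 0 := by
  have := A.const V h 1 e
  rwa [TrivSqZeroExt.inl_one, map_one] at this

lemma eps_one (A : Act i 𝒜 E U) {V : X.Opens} (h : V ≤ U) (e : SecP i E V) :
    A.toFun V h (𝒜.eps V) e = e := by
  have := A.eps V h 1 e
  rwa [mul_one, map_one, one_smul] at this

/-- The product rule evaluates the actions of xa and of ax. They differ by the action of xa − ax =
εP(dx, da), which is multiplication by a function. -/
lemma smul_of_redY_eq_zero [CharZero k] (A : Act i 𝒜 E U) {V : X.Opens} (h : V ≤ U)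
    (τ : 𝒜.Splitting P U) {x : 𝒜.Sections V} (hx : 𝒜.redY i V x = 0) (a : 𝒜.Sections V)
    (e : SecP i E V) :
    A.toFun V h x (𝒜.redY i V a • e) = 𝒜.redY i V a • A.toFun V h x e +
      pull i V (P.toFun V (𝒜.red V x) (𝒜.red V a)) • e := by
  have h1 := A.mul V h x a e
  have h2 := A.mul V h a x e
  have h3 := A.eps V h (τ.toFun V h (P.toFun V (𝒜.red V x) (𝒜.red V a))) e
  rw [DualAlgebra.redY_apply, τ.red_toFun] at h3
  rw [hx, zero_smul, zero_add] at h1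
  rw [hx, zero_smul, map_zero, add_zero] at h2
  rw [← h1, ← h2, ← h3, ← AddMonoidHom.add_apply, ← map_add, ← τ.commutator h]

/-- The action in terms of the splitting `τ` is bidifferential. -/
def IsBidifferential (A : Act i 𝒜 E U) (τ : 𝒜.Splitting P U) : Prop :=
  ∃ n : ℕ, ∀ (V : X.Opens) (h : V ≤ U),
    (∀ e, IsDiffOp (pull i V) n fun a => A.toFun V h (τ.toFun V h a) e) ∧
    ∀ a, IsDiffOp (RingHom.id Γ(Y, i ⁻¹ᵁ V)) n fun e => A.toFun V h (τ.toFun V h a) e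

end

variable {𝒜 : Quantization sX P} {E : Y.PresheafOfModules} [IsSheafOfModules E] {U : X.Opens}

/-- A function b on `Y` lifts locally to `𝒜`, and p(x)(b) is computed by P on any lift. So the
normal part of an action is a connection in conormal directions with symbol p. -/
lemma smul_of_redY_eq_zero' [CharZero k] [IsClosedImmersion i] (hco : P.IsCoisotropic i)
    (A : Act i 𝒜.toDualAlgebra E U) {V : X.Opens} (h : V ≤ U) {x : 𝒜.Sections V}
    (hx : 𝒜.red V x ∈ idealSec i V) (b : Γ(Y, i ⁻¹ᵁ V)) (e : SecP i E V) :
    A.toFun V h x (b • e) = b • A.toFun V h x e +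
      (P.p hco ⟨𝒜.red V x, hx⟩).1 ⟨i ⁻¹ᵁ V, le_rfl⟩ b • e := by
  refine resP_ext fun z hz => ?_
  obtain ⟨V₁, h₁, hz₁, a, ha⟩ := 𝒜.exists_redY_eq b hz
  obtain ⟨V₂, h₂, hz₂, -, ⟨τ⟩⟩ := 𝒜.exists_splitting_le hz₁
  refine ⟨V₂, h₂.trans h₁, hz₂, ?_⟩
  have hx' : 𝒜.redY i V₂ (𝒜.resA (h₂.trans h₁) x) = 0 := by
    rw [DualAlgebra.redY_resA]
    have : 𝒜.redY i V x = 0 := hx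
    rw [this, map_zero]
  have hb : resOP i (h₂.trans h₁) b = 𝒜.redY i V₂ (𝒜.resA h₂ a) := by
    rw [DualAlgebra.redY_resA, ha, resOP_resOP]
  have h3 := (A.restrict (h₂.trans (h₁.trans h))).smul_of_redY_eq_zero le_rfl τ hx'
    (𝒜.resA h₂ a) (resP i E (h₂.trans h₁) e)
  have h4 := Bivector.p_isValue hco ⟨𝒜.red V x, hx⟩ ⟨i ⁻¹ᵁ V, le_rfl⟩ b V₂ (h₂.trans h₁)
    (preimage_le i (h₂.trans h₁)) (𝒜.red V₂ (𝒜.resA h₂ a)) hb.symm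
  have h4 : resOP i (h₂.trans h₁) ((P.p hco ⟨𝒜.red V x, hx⟩).1 ⟨i ⁻¹ᵁ V, le_rfl⟩ b) = _ := h4
  rw [map_add, resP_smul, resP_smul, ← A.res V V₂ h, ← A.res V V₂ h, resP_smul, hb, h4,
    ← DualAlgebra.red_resA]
  exact h3

end Act

/-! ### Differential operators -/

namespace IsDiffOp

variable {R S M N : Type u} [CommRing R] [CommRing S] [AddCommGroup M] [Module R M]
    [AddCommGroup N] [Module S N] {φ : R →+* S}

lemma add {n : ℕ} {D D' : M → N} (h : IsDiffOp φ n D) (h' : IsDiffOp φ n D') :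
    IsDiffOp φ n fun m => D m + D' m := by
  induction n generalizing D D' with
  | zero => intro r m; simp only [h r m, h' r m, smul_add]
  | succ n ih =>
    intro r
    simpa only [smul_add, add_sub_add_comm] using ih (h r) (h' r)

lemma of_linear {D : M → N} (h : ∀ (r : R) (m : M), D (r • m) = φ r • D m) (n : ℕ) :
    IsDiffOp φ n D := by
  induction n generalizing D with
  | zero => exact h
  | succ n ih => exact fun r => ih fun s m => by simp only [h, sub_self, smul_zero]

lemma zero (n : ℕ) : IsDiffOp φ n fun _ : M => (0 : N) :=
  of_linear (fun _ _ => (smul_zero _).symm) n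

lemma mono_succ {n : ℕ} {D : M → N} (h : IsDiffOp φ n D) : IsDiffOp φ (n + 1) D := by
  induction n generalizing D with
  | zero => exact of_linear h _
  | succ n ih => exact fun r => ih (h r)

lemma mono {n m : ℕ} (hnm : n ≤ m) {D : M → N} (h : IsDiffOp φ n D) : IsDiffOp φ m D := by
  induction m, hnm using Nat.le_induction with
  | base => exact h
  | succ m _ ih => exact ih.mono_succ

lemma sum {n : ℕ} {ι : Type*} (s : Finset ι) {D : ι → M → N} (h : ∀ j, IsDiffOp φ n (D j)) :
    IsDiffOp φ n fun m => ∑ j ∈ s, D j m := by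
  classical
  induction s using Finset.induction_on with
  | empty => simpa using zero n
  | insert j s hj ih => simpa only [Finset.sum_insert hj] using (h j).add ih

lemma comp_left {N' : Type u} [AddCommGroup N'] [Module S N'] (f : N →ₗ[S] N') {n : ℕ}
    {D : M → N} (h : IsDiffOp φ n D) : IsDiffOp φ n fun m => f (D m) := by
  induction n generalizing D with
  | zero => intro r m; simp only [h r m, map_smul]
  | succ n ih =>
    intro r
    simpa only [map_sub, map_smul] using ih (h r)

lemma comp_right {M' : Type u} [AddCommGroup M'] [Module R M'] (f : M' →ₗ[R] M) {n : ℕ}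
    {D : M → N} (h : IsDiffOp φ n D) : IsDiffOp φ n fun m => D (f m) := by
  induction n generalizing D with
  | zero => intro r m; simp only [h r _, map_smul]
  | succ n ih =>
    intro r
    simpa only [map_smul] using ih (h r)

end IsDiffOp

/-! ### Derivations with values in endomorphisms -/

/-- Derivations from `𝒪_X` to `i_* ℰnd(E)` over `U`. -/
structure EndDerivation {k : Type u} [Field k] {X Y : Scheme.{u}} (sX : X ⟶ Spec (.of k))
    (i : Y ⟶ X) (E : Y.PresheafOfModules) (U : X.Opens) where
  /-- the derivation -/
  toFun : ∀ V : X.Opens, V ≤ U → Γ(X, V) →+ SecP i E V →ₗ[Γ(Y, i ⁻¹ᵁ V)] SecP i E V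
  map_const : ∀ V h c, toFun V h (const sX V c) = 0
  leibniz : ∀ V h a b, toFun V h (a * b) = pull i V a • toFun V h b + pull i V b • toFun V h a
  res : ∀ V V' (h : V ≤ U) (h' : V' ≤ V) a e,
    toFun V' (h'.trans h) (resO h' a) (resP i E h' e) = resP i E h' (toFun V h a e)

namespace EndDerivation

variable {k : Type u} [Field k] {X Y : Scheme.{u}} {sX : X ⟶ Spec (.of k)} {i : Y ⟶ X}
  {E : Y.PresheafOfModules} {U : X.Opens}

/-- On an affine open set, sections of `N(E)` extend to derivations. -/
lemma exists_extension [IsSheafOfModules E] [Smooth sX] [IsClosedImmersion i] [Smooth (i ≫ sX)]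
    (hU : IsAffineOpen U) {T : Y.Opens} (hT : i ⁻¹ᵁ U ≤ T) (ζ : NormalEnd i E T) :
    ∃ D : EndDerivation sX i E U, ∀ (V : X.Opens) (h : V ≤ U) (z : idealSec i V) (e : SecP i E V),
      D.toFun V h z.1 e = napp ζ ((preimage_le i h).trans hT) z e := by
  -- The right side of ζ(z) = ∑ Dⱼ(z) ζ(xⱼ) makes sense for every function, not only for those
  -- vanishing on `Y`, and defines the extension.
  obtain ⟨n, x, D, hD⟩ := exists_transverse_sheafDerivations sX i hU
  refine ⟨⟨fun V h => AddMonoidHom.mk' (fun a => ∑ j, (D j).toFun V h a •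
    napp ζ ((preimage_le i h).trans hT) (resI i h (x j))) fun a b => ?_, fun V h c => ?_,
    fun V h a b => ?_, fun V V' h h' a e => ?_⟩, fun V h z e => ?_⟩
  · simp only [map_add, add_smul, Finset.sum_add_distrib]
  · simp only [AddMonoidHom.mk'_apply, (D _).map_const, zero_smul, Finset.sum_const_zero]
  · simp only [AddMonoidHom.mk'_apply, (D _).leibniz, add_smul, Finset.sum_add_distrib,
      Finset.smul_sum, mul_smul]
  · simp only [AddMonoidHom.mk'_apply, LinearMap.sum_apply, LinearMap.smul_apply, map_sum,
      resP_smul, (D _).res V V' h h']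
    refine Finset.sum_congr rfl fun j _ => ?_
    rw [← NormalEnd.app_res]
    congr 3
    exact Subtype.ext (resO_resO h h' (x j).1).symm
  · refine Eq.trans ?_ (hD E T hT ζ V h z e).symm
    simp only [AddMonoidHom.mk'_apply, LinearMap.sum_apply, LinearMap.smul_apply]

end EndDerivation

/-! ### New actions from old: adding derivations, transport along frames -/

namespace Act

variable {k : Type u} [Field k] {X Y : Scheme.{u}} {sX : X ⟶ Spec (.of k)} {i : Y ⟶ X}
  {P : Bivector sX} {𝒜 : DualAlgebra sX} {E : Y.PresheafOfModules} {U : X.Opens}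

/-- Modification of an action by a derivation. -/
def twist (A : Act i 𝒜 E U) (D : EndDerivation sX i E U) : Act i 𝒜 E U where
  toFun V h := AddMonoidHom.mk' (fun a => A.toFun V h a + (D.toFun V h (𝒜.red V a)).toAddMonoidHom)
    fun a b => by
      ext e
      simp only [map_add, AddMonoidHom.add_apply, LinearMap.toAddMonoidHom_coe,
        LinearMap.add_apply]
      abel
  res V V' h h' a e := by
    simp only [AddMonoidHom.mk'_apply, AddMonoidHom.add_apply, LinearMap.toAddMonoidHom_coe,
      A.res V V' h h', map_add, DualAlgebra.red_resA, D.res V V' h h']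
  mul V h a b e := by
    simp only [AddMonoidHom.mk'_apply, AddMonoidHom.add_apply, LinearMap.toAddMonoidHom_coe,
      A.mul, map_mul, D.leibniz, LinearMap.add_apply, LinearMap.smul_apply, map_smul, smul_add,
      DualAlgebra.redY_apply]
    abel
  eps V h a e := by
    simp only [AddMonoidHom.mk'_apply, AddMonoidHom.add_apply, LinearMap.toAddMonoidHom_coe,
      A.eps, map_mul, DualAlgebra.red_eps, zero_mul, map_zero, LinearMap.zero_apply, add_zero]
  const V h c e := by
    simp only [AddMonoidHom.mk'_apply, AddMonoidHom.add_apply, LinearMap.toAddMonoidHom_coe,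
      A.const]
    have : 𝒜.red V (𝒜.scalar V (TrivSqZeroExt.inl c)) = DefQuant.const sX V c := 𝒜.proj_scalar V _
    rw [this, D.map_const, LinearMap.zero_apply, add_zero]

lemma twist_apply (A : Act i 𝒜 E U) (D : EndDerivation sX i E U) {V : X.Opens} (h : V ≤ U)
    (a : 𝒜.Sections V) (e : SecP i E V) :
    (A.twist D).toFun V h a e = A.toFun V h a e + D.toFun V h (𝒜.red V a) e := rfl

lemma IsBidifferential.twist {A : Act i 𝒜 E U} {τ : 𝒜.Splitting P U} (hA : A.IsBidifferential τ)
    (D : EndDerivation sX i E U) : (A.twist D).IsBidifferential τ := by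
  obtain ⟨n, hn⟩ := hA
  -- The derivation has order one in the function, which `n` need not allow when it is zero.
  refine ⟨n + 1, fun V h => ⟨fun e => ?_, fun a => ?_⟩⟩
  · simp only [twist_apply, τ.red_toFun]
    refine ((hn V h).1 e).mono_succ.add (IsDiffOp.mono (Nat.succ_le_succ n.zero_le) ?_)
    intro r s m
    simp only [smul_eq_mul, D.leibniz, LinearMap.add_apply, LinearMap.smul_apply, map_mul, mul_smul,
      smul_add]
    rw [smul_comm (pull i V r) (pull i V s)]
    abel_nf
  · simp only [twist_apply, τ.red_toFun]
    exact ((hn V h).2 a).mono_succ.add (IsDiffOp.of_linear (fun r m => map_smul _ r m) _)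

/-- Actions may be transported along local isomorphisms `E ≅ Lⁿ`, given by frames. -/
def ofFrames {L : Y.PresheafOfModules} (A : Act i 𝒜 L U) {T : Y.Opens} (hT : i ⁻¹ᵁ U ≤ T) {n : ℕ}
    {l : Fin 1 → Sec L T} (hl : IsFrame L l) {s : Fin n → Sec E T} (hs : IsFrame E s) :
    Act i 𝒜 E U where
  toFun V h := AddMonoidHom.mk' (fun a => AddMonoidHom.mk' (fun e => ∑ j,
      hl.coord ((preimage_le i h).trans hT) (A.toFun V h a
        (hs.coord ((preimage_le i h).trans hT) e j •
          DefQuant.res L ((preimage_le i h).trans hT) (l 0))) 0 •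
        DefQuant.res E ((preimage_le i h).trans hT) (s j)) fun e e' => by
      simp only [hs.coord_add, Pi.add_apply, add_smul, map_add, hl.coord_add,
        Finset.sum_add_distrib]) fun a a' => by
    ext e
    simp only [map_add, AddMonoidHom.add_apply, AddMonoidHom.mk'_apply, hl.coord_add, Pi.add_apply,
      add_smul, Finset.sum_add_distrib]
  res V V' h h' a e := by
    simp only [AddMonoidHom.mk'_apply, map_sum]
    refine Finset.sum_congr rfl fun j _ => ?_
    change hl.coord _ (A.toFun V' (h'.trans h) (𝒜.resA h' a) (hs.coord
      ((preimage_le i h').trans ((preimage_le i h).trans hT)) (DefQuant.res E (preimage_le i h') e) j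
        • _)) 0 • _ = DefQuant.res E (preimage_le i h') _
    rw [res_smul, res_res, hs.coord_res ((preimage_le i h).trans hT) (preimage_le i h') e,
      ← res_res L ((preimage_le i h).trans hT) (preimage_le i h') (l 0), ← res_smul]
    congr 1
    refine (congrArg (fun m => hl.coord _ m 0) (A.res V V' h h' a _)).trans ?_
    exact congrFun (hl.coord_res ((preimage_le i h).trans hT) (preimage_le i h') _) 0
  mul V h a b e := by
    simp only [AddMonoidHom.mk'_apply, A.mul, hs.coord_smul, hl.coord_add, hl.coord_smul,
      Pi.add_apply, Pi.smul_apply, smul_eq_mul, add_smul, mul_smul, Finset.sum_add_distrib,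
      Finset.smul_sum]
  eps V h a e := by
    simp only [AddMonoidHom.mk'_apply, A.eps]
    conv_rhs => rw [hs.eq_sum ((preimage_le i h).trans hT) e, Finset.smul_sum]
    refine Finset.sum_congr rfl fun j _ => ?_
    rw [smul_smul, smul_smul, hl.coord_eq _
      (c := fun _ => 𝒜.redY i V a * hs.coord ((preimage_le i h).trans hT) e j)]
    rw [Fin.sum_univ_one]
  const V h c e := by
    simp only [AddMonoidHom.mk'_apply, A.const]
    refine Finset.sum_eq_zero fun j _ => ?_
    rw [hl.coord_eq _ (c := fun _ => 0) (by simp), zero_smul]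

/-- The transported action is a sum of terms in which the given one is composed on both sides with
linear maps, so the order does not grow. -/
lemma IsBidifferential.ofFrames {L : Y.PresheafOfModules} {A : Act i 𝒜 L U}
    {τ : 𝒜.Splitting P U} (hA : A.IsBidifferential τ) {T : Y.Opens} (hT : i ⁻¹ᵁ U ≤ T) {n : ℕ}
    {l : Fin 1 → Sec L T} (hl : IsFrame L l) {s : Fin n → Sec E T} (hs : IsFrame E s) :
    (A.ofFrames hT hl hs).IsBidifferential τ := by
  obtain ⟨m, hm⟩ := hA
  refine ⟨m, fun V h => ?_⟩
  let hV := (preimage_le i h).trans hT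
  let f : Fin n → SecP i L V →ₗ[Γ(Y, i ⁻¹ᵁ V)] SecP i E V := fun j =>
    { toFun := fun x => hl.coord hV x 0 • DefQuant.res E hV (s j)
      map_add' := fun x y => by rw [hl.coord_add, Pi.add_apply, add_smul]
      map_smul' := fun r x => by
        rw [hl.coord_smul, Pi.smul_apply, smul_eq_mul, mul_smul, RingHom.id_apply] }
  let g : Fin n → SecP i E V →ₗ[Γ(Y, i ⁻¹ᵁ V)] SecP i L V := fun j =>
    { toFun := fun e => hs.coord hV e j • DefQuant.res L hV (l 0)
      map_add' := fun x y => by rw [hs.coord_add, Pi.add_apply, add_smul]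
      map_smul' := fun r x => by
        rw [hs.coord_smul, Pi.smul_apply, smul_eq_mul, mul_smul, RingHom.id_apply] }
  exact ⟨fun e => IsDiffOp.sum Finset.univ fun j => (((hm V h).1 (g j e)).comp_left (f j)),
    fun a => IsDiffOp.sum Finset.univ fun j => (((hm V h).2 a).comp_right (g j)).comp_left (f j)⟩

end Act

/-! ### Additive endomorphisms -/

/-- Endomorphisms of the sheaf of abelian groups `M|_T`. -/
def AddEnd {Y : Scheme.{u}} (M : Y.PresheafOfModules) (T : Y.Opens) :
    AddSubgroup (∀ W : {W : Y.Opens // W ≤ T}, Sec M W.1 →+ Sec M W.1) where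
  carrier := {f | ∀ (W W' : {W : Y.Opens // W ≤ T}) (h : W'.1 ≤ W.1) (m : Sec M W.1),
    f W' (res M h m) = res M h (f W m)}
  zero_mem' := by intro W W' h m; simp
  add_mem' := by intro f g hf hg W W' h m; simp [hf W W' h m, hg W W' h m]
  neg_mem' := by intro f hf W W' h m; simp [hf W W' h m]

section AddEnd

variable {Y : Scheme.{u}} {M : Y.PresheafOfModules} {T : Y.Opens}

/-- The value of an endomorphism. -/
def aapp (β : AddEnd M T) {W : Y.Opens} (h : W ≤ T) : Sec M W →+ Sec M W := β.1 ⟨W, h⟩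

lemma aapp_res (β : AddEnd M T) {W W' : Y.Opens} (h : W ≤ T) (h' : W' ≤ W) (m : Sec M W) :
    aapp β (h'.trans h) (res M h' m) = res M h' (aapp β h m) :=
  β.2 ⟨W, h⟩ ⟨W', h'.trans h⟩ h' m

lemma aapp_resP {X : Scheme.{u}} {i : Y ⟶ X} (β : AddEnd M T) {V V' : X.Opens} (h : i ⁻¹ᵁ V ≤ T)
    (h' : V' ≤ V) (m : SecP i M V) :
    aapp β ((preimage_le i h').trans h) (resP i M h' m) = resP i M h' (aapp β h m) :=
  aapp_res β h (preimage_le i h') m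

/-- The value of a local homomorphism. -/
def happ {N : Y.PresheafOfModules} (f : LocalHom M N T) {W : Y.Opens} (h : W ≤ T) :
    Sec M W →ₗ[Γ(Y, W)] Sec N W :=
  f.1 ⟨W, h⟩

lemma happ_res {N : Y.PresheafOfModules} (f : LocalHom M N T) {W W' : Y.Opens} (h : W ≤ T)
    (h' : W' ≤ W) (m : Sec M W) :
    happ f (h'.trans h) (res M h' m) = res N h' (happ f h m) :=
  f.2 ⟨W, h⟩ ⟨W', h'.trans h⟩ h' m

lemma happ_resP {X : Scheme.{u}} {i : Y ⟶ X} {N : Y.PresheafOfModules} (f : LocalHom M N T)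
    {V V' : X.Opens} (h : i ⁻¹ᵁ V ≤ T) (h' : V' ≤ V) (m : SecP i M V) :
    happ f ((preimage_le i h').trans h) (resP i M h' m) = resP i N h' (happ f h m) :=
  happ_res f h (preimage_le i h') m

lemma happ_ext {N : Y.PresheafOfModules} {f g : LocalHom M N T}
    (H : ∀ (W : Y.Opens) (h : W ≤ T) (m : Sec M W), happ f h m = happ g h m) : f = g :=
  Subtype.ext (funext fun W => LinearMap.ext fun m => H W.1 W.2 m)

lemma add_happ {N : Y.PresheafOfModules} (f g : LocalHom M N T) {W : Y.Opens} (h : W ≤ T)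
    (m : Sec M W) : happ (f + g) h m = happ f h m + happ g h m := rfl

/-- Homomorphisms as additive endomorphisms. -/
def toAddEnd (f : LocalHom M M T) : AddEnd M T :=
  ⟨fun W => (f.1 W).toAddMonoidHom, f.2⟩

lemma aapp_toAddEnd (f : LocalHom M M T) {W : Y.Opens} (h : W ≤ T) (m : Sec M W) :
    aapp (toAddEnd f) h m = happ f h m := rfl

/-- Restriction of endomorphisms. -/
def restrictAddEnd (β : AddEnd M T) {T' : Y.Opens} (h : T' ≤ T) : AddEnd M T' :=
  ⟨fun W => β.1 ⟨W.1, W.2.trans h⟩, fun W W' h' m =>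
    β.2 ⟨W.1, W.2.trans h⟩ ⟨W'.1, W'.2.trans h⟩ h' m⟩

lemma aapp_restrict (β : AddEnd M T) {T' : Y.Opens} (h : T' ≤ T) {W : Y.Opens} (h' : W ≤ T')
    (m : Sec M W) : aapp (restrictAddEnd β h) h' m = aapp β (h'.trans h) m := rfl

lemma aapp_sub (β β' : AddEnd M T) {W : Y.Opens} (h : W ≤ T) (m : Sec M W) :
    aapp (β - β') h m = aapp β h m - aapp β' h m := rfl

lemma aapp_add (β β' : AddEnd M T) {W : Y.Opens} (h : W ≤ T) (m : Sec M W) :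
    aapp (β + β') h m = aapp β h m + aapp β' h m := rfl

variable {X : Scheme.{u}} {i : Y ⟶ X} [IsClosedImmersion i]

/-- Endomorphisms of the pushforward of `M` to `X` are endomorphisms of `M`. -/
lemma exists_addEnd_of_pushforward {U : X.Opens} (hT : T ≤ i ⁻¹ᵁ U)
    (f : ∀ V : X.Opens, V ≤ U → SecP i M V →+ SecP i M V)
    (hf : ∀ V V' (h : V ≤ U) (h' : V' ≤ V) m,
      f V' (h'.trans h) (resP i M h' m) = resP i M h' (f V h m)) :
    ∃ β : AddEnd M T, ∀ (V : X.Opens) (h : V ≤ U) (hV : i ⁻¹ᵁ V ≤ T) (m : SecP i M V),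
      aapp β hV m = f V h m := by
  have hpre : ∀ W : {W : Y.Opens // W ≤ T}, i ⁻¹ᵁ (extOpen i W.1 ⊓ U) = W.1 := fun W =>
    preimage_extOpen_inf (W.2.trans hT)
  refine ⟨⟨fun W => (res M (hpre W).ge).comp
    ((f (extOpen i W.1 ⊓ U) inf_le_right).comp (res M (hpre W).le)), fun W W' h m => ?_⟩,
    fun V h hV m => ?_⟩
  · have hle : extOpen i W'.1 ⊓ U ≤ extOpen i W.1 ⊓ U := inf_le_inf_right _ (extOpen_mono h)
    have := hf _ _ inf_le_right hle (res M (hpre W).le m)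
    simp only [AddMonoidHom.comp_apply, res_res]
    rw [← res_res M (hpre W).le (preimage_le i hle) m]
    exact (congrArg _ this).trans (res_res M _ _ _)
  -- `V` may be smaller than the open set used in the definition, but the traces on `Y` coincide, so
  -- restricting from one to the other loses nothing.
  · have hle : V ≤ extOpen i (i ⁻¹ᵁ V) ⊓ U := le_inf (le_extOpen V) h
    have := hf _ _ inf_le_right hle (res M (hpre ⟨_, hV⟩).le m)
    have h2 : resP i M hle (res M (hpre ⟨_, hV⟩).le m) = m :=
      (res_res M _ _ m).trans (res_self M _ m)
    rw [h2] at this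
    exact this.symm

/-- Linearity may be checked near each point, where every function on `Y` is the restriction of the
reduction of a section of `𝒜`. -/
lemma exists_localHom_of_linear {k : Type u} [Field k] {sX : X ⟶ Spec (.of k)} {P : Bivector sX}
    (𝒜 : Quantization sX P) [IsSheafOfModules M] {U : X.Opens} (hT : T ≤ i ⁻¹ᵁ U) (β : AddEnd M T)
    (H : ∀ (V : X.Opens) (_ : V ≤ U) (h : i ⁻¹ᵁ V ≤ T) (a : 𝒜.Sections V) (m : SecP i M V),
      aapp β h (𝒜.redY i V a • m) = 𝒜.redY i V a • aapp β h m) :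
    ∃ f : LocalHom M M T, ∀ (W : Y.Opens) (h : W ≤ T) (m : Sec M W), happ f h m = aapp β h m := by
  refine ⟨⟨fun W =>
    { toFun := aapp β W.2
      map_add' := map_add _
      map_smul' := fun b m => ?_ }, β.2⟩, fun W h m => rfl⟩
  have hpre : i ⁻¹ᵁ (extOpen i W.1 ⊓ U) = W.1 := preimage_extOpen_inf (W.2.trans hT)
  refine res_ext fun y hy => ?_
  obtain ⟨V, hV, hyV, a, ha⟩ := 𝒜.exists_redY_eq (i := i) (resO hpre.le b) (x := i y)
    (show y ∈ i ⁻¹ᵁ _ from hpre.ge hy)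
  have hVW : i ⁻¹ᵁ V ≤ W.1 := (preimage_le i hV).trans hpre.le
  refine ⟨i ⁻¹ᵁ V, hVW, hyV, ?_⟩
  have hb : 𝒜.redY i V a = resO hVW b := ha.trans (resO_resO _ _ b)
  rw [← aapp_res β W.2 hVW, RingHom.id_apply, res_smul, res_smul, ← aapp_res β W.2 hVW, ← hb]
  exact H V (hV.trans inf_le_right) (hVW.trans W.2) a _

end AddEnd

/-! ### Transitions between actions -/

section Trans

variable {k : Type u} [Field k] {X Y : Scheme.{u}} {sX : X ⟶ Spec (.of k)} {i : Y ⟶ X}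
  {P : Bivector sX}

/-- `e ↦ e + ε β(e)` intertwines the actions `A` and `A'`. -/
def IsTrans {𝒜 : DualAlgebra sX} {E : Y.PresheafOfModules} {U U' : X.Opens} (A : Act i 𝒜 E U)
    (A' : Act i 𝒜 E U') {T : Y.Opens} (β : AddEnd E T) : Prop :=
  ∀ (V : X.Opens) (h : V ≤ U) (h' : V ≤ U') (hT : i ⁻¹ᵁ V ≤ T) (a : 𝒜.Sections V) (e : SecP i E V),
    A'.toFun V h' a e = A.toFun V h a e +
      (aapp β hT (𝒜.redY i V a • e) - 𝒜.redY i V a • aapp β hT e)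

/-- The actions of elements that reduce to functions vanishing on `Y` are the same. -/
def Act.SameNormal {𝒜 : DualAlgebra sX} {E : Y.PresheafOfModules} {U U' : X.Opens}
    (A : Act i 𝒜 E U) (A' : Act i 𝒜 E U') : Prop :=
  ∀ (V : X.Opens) (h : V ≤ U) (h' : V ≤ U') (x : 𝒜.Sections V) (e : SecP i E V),
    𝒜.redY i V x = 0 → A.toFun V h x e = A'.toFun V h' x e

variable {𝒜 : Quantization sX P} {E : Y.PresheafOfModules} [IsSheafOfModules E]
  [IsClosedImmersion i] {U U' : X.Opens}

/-- A'(a, e) − A(a, e) vanishes when a restricts to zero on `Y`, hence depends on a only through its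
restriction b. Lifts of b exist only locally, so the values have to be glued. -/
lemma Act.SameNormal.exists_sub {A : Act i 𝒜.toDualAlgebra E U} {A' : Act i 𝒜.toDualAlgebra E U'}
    (H : A.SameNormal A') {V : X.Opens} (h : V ≤ U) (h' : V ≤ U') (b : Γ(Y, i ⁻¹ᵁ V))
    (e : SecP i E V) : ∃ g : SecP i E V, ∀ (V' : X.Opens) (hV : V' ≤ V) (a : 𝒜.Sections V'),
      𝒜.redY i V' a = resOP i hV b → resP i E hV g =
        A'.toFun V' (hV.trans h') a (resP i E hV e) -
          A.toFun V' (hV.trans h) a (resP i E hV e) := by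
  obtain ⟨g, hg⟩ := resP_glue (i := i) (E := E) (V := V)
    (fun V' hV g => ∃ a : 𝒜.Sections V', 𝒜.redY i V' a = resOP i hV b ∧ g =
        A'.toFun V' (hV.trans h') a (resP i E hV e) - A.toFun V' (hV.trans h) a (resP i E hV e))
    (fun V' hV g ⟨a, ha, hg⟩ V'' hV' => ⟨𝒜.resA hV' a, by
        rw [DualAlgebra.redY_resA, ha, resOP_resOP], by
        rw [hg, map_sub, ← A.res V' V'', ← A'.res V' V'', resP_resP]⟩)
    (fun V' hV g g' ⟨a, ha, hg⟩ ⟨a', ha', hg'⟩ => by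
      have := H V' (hV.trans h) (hV.trans h') (a - a') (resP i E hV e)
        (by rw [map_sub, ha, ha', sub_self])
      simp only [map_sub, AddMonoidHom.sub_apply] at this
      rw [hg, hg', sub_eq_sub_iff_sub_eq_sub, ← this])
    (fun x hx => by
      obtain ⟨V', hV, hxV, a, ha⟩ := 𝒜.exists_redY_eq b hx
      exact ⟨V', hV, hxV, _, a, ha, rfl⟩)
  exact ⟨g, fun V' hV a ha => hg V' hV _ ⟨a, ha, rfl⟩⟩

/-- Two actions on `E ⊕ εE` with the same normal part are isomorphic if `E` has a frame. -/
lemma Act.SameNormal.exists_isTrans {A : Act i 𝒜.toDualAlgebra E U}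
    {A' : Act i 𝒜.toDualAlgebra E U'} (H : A.SameNormal A') {T T' : Y.Opens}
    (hT : T ≤ i ⁻¹ᵁ U ⊓ i ⁻¹ᵁ U') (hT' : T ≤ T') {n : ℕ} {s : Fin n → Sec E T'}
    (hs : IsFrame E s) : ∃ β : AddEnd E T, IsTrans A A' β := by
  replace hs := hs.restrict hT'
  generalize (fun j => DefQuant.res E hT' (s j) : Fin n → Sec E T) = s at hs
  set O := extOpen i T ⊓ (U ⊓ U') with hO
  have hOT : i ⁻¹ᵁ O = T := preimage_extOpen_inf hT
  have hOU : O ≤ U := inf_le_right.trans inf_le_left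
  have hOU' : O ≤ U' := inf_le_right.trans inf_le_right
  let hV : ∀ {V : X.Opens}, V ≤ O → i ⁻¹ᵁ V ≤ T := fun h => (preimage_le i h).trans hOT.le
  -- g(b, e) is the difference A' − A as a function of b ∈ 𝒪_Y.
  choose g hg using fun (V : X.Opens) (h : V ≤ O) (b : Γ(Y, i ⁻¹ᵁ V)) (e : SecP i E V) =>
    H.exists_sub (h.trans hOU) (h.trans hOU') b e
  have guniq : ∀ (V : X.Opens) (h : V ≤ O) (b : Γ(Y, i ⁻¹ᵁ V)) (e : SecP i E V) (c : SecP i E V),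
      (∀ (V' : X.Opens) (hV : V' ≤ V) (a : 𝒜.Sections V'), 𝒜.redY i V' a = resOP i hV b →
        resP i E hV c = A'.toFun V' (hV.trans (h.trans hOU')) a (resP i E hV e) -
          A.toFun V' (hV.trans (h.trans hOU)) a (resP i E hV e)) → g V h b e = c := by
    intro V h b e c hc
    refine resP_ext fun x hx => ?_
    obtain ⟨V', hV, hxV, a, ha⟩ := 𝒜.exists_redY_eq b hx
    exact ⟨V', hV, hxV, (hg V h b e V' hV a ha).trans (hc V' hV a ha).symm⟩
  have gval : ∀ (V : X.Opens) (h : V ≤ O) (a : 𝒜.Sections V) (e : SecP i E V),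
      g V h (𝒜.redY i V a) e = A'.toFun V (h.trans hOU') a e - A.toFun V (h.trans hOU) a e := by
    intro V h a e
    have := hg V h (𝒜.redY i V a) e V le_rfl a (resOP_self _ _).symm
    rwa [resP_self, resP_self] at this
  have gres : ∀ (V V' : X.Opens) (h : V ≤ O) (h' : V' ≤ V) (b : Γ(Y, i ⁻¹ᵁ V)) (e : SecP i E V),
      g V' (h'.trans h) (resOP i h' b) (resP i E h' e) = resP i E h' (g V h b e) := by
    intro V V' h h' b e
    refine guniq _ _ _ _ _ fun V'' h'' a ha => ?_
    rw [resOP_resOP] at ha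
    rw [resP_resP, resP_resP]
    exact hg V h b e V'' (h''.trans h') a ha
  have gadd : ∀ (V : X.Opens) (h : V ≤ O) (b b' : Γ(Y, i ⁻¹ᵁ V)) (e : SecP i E V),
      g V h (b + b') e = g V h b e + g V h b' e := by
    intro V h b b' e
    refine resP_ext fun x hx => ?_
    obtain ⟨V₁, h₁, hx₁, a, ha⟩ := 𝒜.exists_redY_eq b hx
    obtain ⟨V₂, h₂, hx₂, a', ha'⟩ := 𝒜.exists_redY_eq (resOP i h₁ b') hx₁
    refine ⟨V₂, h₂.trans h₁, hx₂, ?_⟩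
    have e1 : resOP i (h₂.trans h₁) b = 𝒜.redY i V₂ (𝒜.resA h₂ a) := by
      rw [DualAlgebra.redY_resA, ha, resOP_resOP]
    have e2 : resOP i (h₂.trans h₁) b' = 𝒜.redY i V₂ a' := by rw [ha', resOP_resOP]
    rw [map_add, ← gres, ← gres, ← gres, map_add, e1, e2, ← map_add, gval, gval, gval]
    simp only [map_add, AddMonoidHom.add_apply]
    abel
  -- The product rules of both actions combine to say that g is a derivation with values in additive
  -- endomorphisms of E. The aim is to show that it is the commutator with some β.
  have gmul : ∀ (V : X.Opens) (h : V ≤ O) (a : 𝒜.Sections V) (b : Γ(Y, i ⁻¹ᵁ V)) (e : SecP i E V),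
      g V h (𝒜.redY i V a * b) e = 𝒜.redY i V a • g V h b e + g V h (𝒜.redY i V a) (b • e) := by
    intro V h a b e
    refine resP_ext fun x hx => ?_
    obtain ⟨V₁, h₁, hx₁, c, hc⟩ := 𝒜.exists_redY_eq b hx
    refine ⟨V₁, h₁, hx₁, ?_⟩
    rw [map_add, resP_smul, ← gres, ← gres, ← gres, map_mul, ← hc, ← DualAlgebra.redY_resA,
      ← map_mul, gval, gval, gval, A.mul, A'.mul, resP_smul, hc, smul_sub]
    abel
  -- The choice β(∑ cⱼ sⱼ) = ∑ g(cⱼ, sⱼ), for which the frame is killed by β, makes g inner.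
  obtain ⟨β, hβ⟩ := exists_addEnd_of_pushforward (M := E) (T := T) (U := O) hOT.ge
    (fun V h => AddMonoidHom.mk' (fun m => ∑ j, g V h (hs.coord (hV h) m j) (DefQuant.res E (hV h) (s j)))
      fun m m' => by simp only [hs.coord_add, Pi.add_apply, gadd, Finset.sum_add_distrib])
    (fun V V' h h' m => by
      simp only [AddMonoidHom.mk'_apply, map_sum, ← gres]
      refine Finset.sum_congr rfl fun j _ => ?_
      congr 1
      · exact congrFun (hs.coord_res (hV h) (preimage_le i h') m) j
      · exact (res_res E _ _ _).symm)
  refine ⟨β, fun V h h' hVT a e => ?_⟩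
  have hVO : V ≤ O := le_inf ((le_extOpen V).trans (extOpen_mono hVT)) (le_inf h h')
  -- Additivity of g in e is read off from the two actions, which requires the first argument to
  -- come from a section a of `𝒜`.
  have h1 : g V hVO (𝒜.redY i V a) e = ∑ j, g V hVO (𝒜.redY i V a)
      (hs.coord (hV hVO) e j • DefQuant.res E (hV hVO) (s j)) := by
    conv_lhs => rw [hs.eq_sum (hV hVO) e]
    rw [gval, map_sum, map_sum, ← Finset.sum_sub_distrib]
    exact Finset.sum_congr rfl fun j _ => (gval _ _ _ _).symm
  rw [hβ V hVO hVT, hβ V hVO hVT, ← sub_eq_iff_eq_add', ← gval V hVO a e, h1]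
  simp only [AddMonoidHom.mk'_apply, hs.coord_smul, Pi.smul_apply, smul_eq_mul, gmul,
    Finset.sum_add_distrib, Finset.smul_sum]
  abel

end Trans

/-! ### Gluing of first order deformations -/

section GlueData

variable {k : Type u} [Field k] {X Y : Scheme.{u}} {sX : X ⟶ Spec (.of k)}
  {P : Bivector sX}

lemma resP_glue_family {i : Y ⟶ X} {E : Y.PresheafOfModules} [IsSheafOfModules E] {ι : Type u}
    {U : ι → X.Opens} {V : X.Opens} (hU : ∀ j, U j ≤ V) (hV : ∀ x ∈ V, ∃ j, x ∈ U j)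
    (s : ∀ j, SecP i E (U j))
    (hs : ∀ j l, resP i E (inf_le_left : U j ⊓ U l ≤ U j) (s j) =
      resP i E (inf_le_right : U j ⊓ U l ≤ U l) (s l)) :
    ∃ e : SecP i E V, ∀ j, resP i E (hU j) e = s j :=
  let F : TopCat.Sheaf AddCommGrpCat.{u} X :=
    ⟨i.base _* E.presheaf, isSheaf_pushforward (IsSheafOfModules.isSheaf (M := E)) i⟩
  let s' : ∀ j, ToType (F.obj.obj (op (U j))) := s
  (F.existsUnique_gluing' U V (fun j => homOfLE (hU j))
    (fun x hx => Opens.mem_iSup.2 (hV x hx)) s' hs).exists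

/-- Actions on `E ⊕ εE` on an open cover of `Y`, and compatible transitions between them. -/
structure GlueData (i : Y ⟶ X) (𝒜 : DualAlgebra sX) (E : Y.PresheafOfModules) where
  /-- the cover -/
  U : Y → X.Opens
  mem : ∀ y, i y ∈ U y
  /-- the actions -/
  A : ∀ y, Act i 𝒜 E (U y)
  /-- the transitions -/
  β : ∀ y z, AddEnd E (i ⁻¹ᵁ U y ⊓ i ⁻¹ᵁ U z)
  trans : ∀ y z, IsTrans (A y) (A z) (β y z)
  cocycle : ∀ (y z w : Y) (W : Y.Opens) (hy : W ≤ i ⁻¹ᵁ U y) (hz : W ≤ i ⁻¹ᵁ U z)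
    (hw : W ≤ i ⁻¹ᵁ U w) (e : Sec E W),
    aapp (β y w) (le_inf hy hw) e = aapp (β y z) (le_inf hy hz) e + aapp (β z w) (le_inf hz hw) e

namespace GlueData

variable {i : Y ⟶ X} {𝒜 : DualAlgebra sX} {E : Y.PresheafOfModules} (G : GlueData i 𝒜 E)

/-- The value of a transition. -/
def tr (y z : Y) {V : X.Opens} (hy : V ≤ G.U y) (hz : V ≤ G.U z) : SecP i E V →+ SecP i E V :=
  aapp (G.β y z) (le_inf (preimage_le i hy) (preimage_le i hz))

lemma tr_res (y z : Y) {V V' : X.Opens} (hy : V ≤ G.U y) (hz : V ≤ G.U z) (h : V' ≤ V)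
    (e : SecP i E V) :
    G.tr y z (h.trans hy) (h.trans hz) (resP i E h e) = resP i E h (G.tr y z hy hz e) :=
  aapp_resP _ _ h e

lemma tr_add (y z w : Y) {V : X.Opens} (hy : V ≤ G.U y) (hz : V ≤ G.U z) (hw : V ≤ G.U w)
    (e : SecP i E V) : G.tr y w hy hw e = G.tr y z hy hz e + G.tr z w hz hw e :=
  G.cocycle y z w _ (preimage_le i hy) (preimage_le i hz) (preimage_le i hw) e

/-- The cocycle condition for y, y, y reads β = β + β. -/
lemma tr_self (y : Y) {V : X.Opens} (hy : V ≤ G.U y) (e : SecP i E V) : G.tr y y hy hy e = 0 := by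
  have := G.tr_add y y y hy hy hy e
  exact add_eq_left.1 this.symm

/-- The intertwining relation in the form in which it shows that the action preserves the gluing
condition. -/
lemma tr_rel (y z : Y) {V : X.Opens} (hy : V ≤ G.U y) (hz : V ≤ G.U z) (a : 𝒜.Sections V)
    (e : SecP i E V) : (G.A z).toFun V hz a e + 𝒜.redY i V a • G.tr y z hy hz e =
      (G.A y).toFun V hy a e + G.tr y z hy hz (𝒜.redY i V a • e) := by
  rw [G.trans y z V hy hz (le_inf (preimage_le i hy) (preimage_le i hz)) a e]
  change _ + (G.tr y z hy hz _ - _ • G.tr y z hy hz e) + _ = _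
  abel

/-- Sections of the glued module. -/
def sec (V : X.Opens) : AddSubgroup (SecP i E V × ∀ y, SecP i E (V ⊓ G.U y)) where
  -- `p.1` is the reduction e and `p.2 y` the ε-component in the chart `y`; passing from `y` to `z`
  -- adds β(e) to the latter. The charts cover only `Y`, which suffices because all components
  -- vanish elsewhere.
  carrier := {p | ∀ (y z : Y) (V' : X.Opens) (h : V' ≤ V) (hy : V' ≤ G.U y) (hz : V' ≤ G.U z),
    resP i E (le_inf h hz) (p.2 z) = resP i E (le_inf h hy) (p.2 y) + G.tr y z hy hz (resP i E h p.1)}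
  zero_mem' := by intro y z V' h hy hz; simp
  add_mem' := by
    intro p q hp hq y z V' h hy hz
    simp only [Prod.snd_add, Pi.add_apply, map_add, Prod.fst_add, hp y z V' h hy hz,
      hq y z V' h hy hz]
    abel
  neg_mem' := by
    intro p hp y z V' h hy hz
    simp only [Prod.snd_neg, Pi.neg_apply, map_neg, Prod.fst_neg, hp y z V' h hy hz]
    abel

variable {G}

lemma sec_ext {V : X.Opens} {p q : G.sec V} (h1 : p.1.1 = q.1.1) (h2 : ∀ y, p.1.2 y = q.1.2 y) :
    p = q :=
  Subtype.ext (Prod.ext h1 (funext h2))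

variable (G)

/-- Restriction of sections of the glued module. -/
def secRes {V V' : X.Opens} (h : V' ≤ V) : G.sec V →+ G.sec V' where
  toFun p := ⟨(resP i E h p.1.1, fun y => resP i E (inf_le_inf_right _ h) (p.1.2 y)), by
    intro y z V'' h' hy hz
    simp only [resP_resP]
    exact p.2 y z V'' (h'.trans h) hy hz⟩
  map_zero' := sec_ext (map_zero _) fun y => map_zero _
  map_add' p q := sec_ext (map_add _ _ _) fun y => map_add _ _ _

lemma secRes_self {V : X.Opens} (p : G.sec V) : G.secRes le_rfl p = p :=
  sec_ext (resP_self _ p.1.1) fun y => resP_self _ (p.1.2 y)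

lemma secRes_secRes {V V' V'' : X.Opens} (h : V' ≤ V) (h' : V'' ≤ V') (p : G.sec V) :
    G.secRes h' (G.secRes h p) = G.secRes (h'.trans h) p :=
  sec_ext (resP_resP h h' p.1.1) fun y =>
    resP_resP (inf_le_inf_right (G.U y) h) (inf_le_inf_right (G.U y) h') (p.1.2 y)

/-- The glued module as a presheaf of abelian groups. -/
def presheaf : TopCat.Presheaf AddCommGrpCat.{u} X where
  obj V := AddCommGrpCat.of (G.sec V.unop)
  map f := AddCommGrpCat.ofHom (G.secRes f.unop.le)
  map_id _ := AddCommGrpCat.hom_ext (AddMonoidHom.ext fun p => G.secRes_self p)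
  map_comp f g := AddCommGrpCat.hom_ext (AddMonoidHom.ext fun p =>
    (G.secRes_secRes f.unop.le g.unop.le p).symm)

/-- The reduction and the ε-components glue separately, being sections of E, and the relation
between them can be checked locally. -/
lemma isSheaf_presheaf [IsSheafOfModules E] : TopCat.Presheaf.IsSheaf G.presheaf := by
  rw [TopCat.Presheaf.isSheaf_iff_isSheafUniqueGluing]
  intro ι U sf hsf
  change ∀ j, G.sec (U j) at sf
  have hV : ∀ x ∈ iSup U, ∃ j, x ∈ U j := fun x hx => Opens.mem_iSup.1 hx
  have hU : ∀ j, U j ≤ iSup U := le_iSup U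
  have hsf' : ∀ j l, G.secRes (inf_le_left : U j ⊓ U l ≤ U j) (sf j) =
    G.secRes (inf_le_right : U j ⊓ U l ≤ U l) (sf l) := hsf
  have hsf1 : ∀ j l, resP i E (inf_le_left : U j ⊓ U l ≤ U j) (sf j).1.1 =
      resP i E (inf_le_right : U j ⊓ U l ≤ U l) (sf l).1.1 := fun j l => congr($(hsf' j l).1.1)
  have hsf2 : ∀ j l y, resP i E (inf_le_inf_right (G.U y) (inf_le_left : U j ⊓ U l ≤ U j))
        ((sf j).1.2 y) =
      resP i E (inf_le_inf_right (G.U y) (inf_le_right : U j ⊓ U l ≤ U l)) ((sf l).1.2 y) :=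
    fun j l y => congr($(hsf' j l).1.2 y)
  obtain ⟨e, he⟩ := resP_glue_family hU hV (fun j => (sf j).1.1) hsf1
  have hf : ∀ y, ∃ f : SecP i E (iSup U ⊓ G.U y), ∀ j,
      resP i E (inf_le_inf_right (G.U y) (hU j)) f = (sf j).1.2 y := fun y =>
    resP_glue_family (U := fun j => U j ⊓ G.U y) (fun j => inf_le_inf_right (G.U y) (hU j))
      (fun x hx => (hV x hx.1).imp fun j hj => ⟨hj, hx.2⟩) (fun j => (sf j).1.2 y) fun j l => by
        have hle : (U j ⊓ G.U y) ⊓ (U l ⊓ G.U y) ≤ (U j ⊓ U l) ⊓ G.U y :=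
          le_inf (inf_le_inf inf_le_left inf_le_left) (inf_le_left.trans inf_le_right)
        have := congrArg (resP i E hle) (hsf2 j l y)
        rwa [resP_resP, resP_resP] at this
  choose f hf using hf
  have hmem : (e, f) ∈ G.sec (iSup U) := by
    intro y z V' h hy hz
    refine resP_ext fun x hx => ?_
    obtain ⟨j, hj⟩ := hV x (h hx)
    refine ⟨V' ⊓ U j, inf_le_left, ⟨hx, hj⟩, ?_⟩
    have := (sf j).2 y z (V' ⊓ U j) inf_le_right (inf_le_left.trans hy) (inf_le_left.trans hz)
    rw [← he j, ← hf z j, ← hf y j] at this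
    rw [map_add, ← tr_res]
    simp only [resP_resP] at this ⊢
    exact this
  refine ⟨⟨(e, f), hmem⟩, fun j => sec_ext (he j) fun y => hf y j, fun p hp => ?_⟩
  have hp' : ∀ j, G.secRes (hU j) p = sf j := hp
  refine sec_ext ?_ fun y => ?_
  · refine resP_ext fun x hx => ?_
    obtain ⟨j, hj⟩ := hV x hx
    exact ⟨U j, hU j, hj, (congr($(hp' j).1.1)).trans (he j).symm⟩
  · refine resP_ext fun x hx => ?_
    obtain ⟨j, hj⟩ := hV x hx.1
    exact ⟨U j ⊓ G.U y, inf_le_inf_right _ (hU j), ⟨hj, hx.2⟩,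
      (congr($(hp' j).1.2 y)).trans (hf y j).symm⟩

/-- In the chart `y` this is a·(e + εf) = āe + ε(āf + A_y(a, e)). -/
instance (V : X.Opens) : SMul (𝒜.Sections V) (G.sec V) where
  smul a p := ⟨(𝒜.redY i V a • p.1.1, fun y =>
    resOP i (inf_le_left : V ⊓ G.U y ≤ V) (𝒜.redY i V a) • p.1.2 y +
      (G.A y).toFun (V ⊓ G.U y) inf_le_right (𝒜.resA inf_le_left a)
        (resP i E inf_le_left p.1.1)), by
    intro y z V' h hy hz
    have h1 := G.tr_rel y z hy hz (𝒜.resA h a) (resP i E h p.1.1)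
    simp only [map_add, resP_smul, resOP_resOP, ← (G.A _).res _ V' inf_le_right,
      DualAlgebra.resA_resA, resP_resP, p.2 y z V' h hy hz, smul_add]
    rw [DualAlgebra.redY_resA] at h1
    rw [add_assoc, add_assoc, add_comm (resOP i h (𝒜.redY i V a) • G.tr y z hy hz _), h1]⟩

variable {G}

lemma smul_fst {V : X.Opens} (a : 𝒜.Sections V) (p : G.sec V) :
    (a • p).1.1 = 𝒜.redY i V a • p.1.1 := rfl

lemma smul_snd {V : X.Opens} (a : 𝒜.Sections V) (p : G.sec V) (y : Y) :
    (a • p).1.2 y = resOP i (inf_le_left : V ⊓ G.U y ≤ V) (𝒜.redY i V a) • p.1.2 y +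
      (G.A y).toFun (V ⊓ G.U y) inf_le_right (𝒜.resA inf_le_left a)
        (resP i E inf_le_left p.1.1) := rfl

lemma add_fst {V : X.Opens} (p q : G.sec V) : (p + q).1.1 = p.1.1 + q.1.1 := rfl

lemma add_snd {V : X.Opens} (p q : G.sec V) (y : Y) : (p + q).1.2 y = p.1.2 y + q.1.2 y := rfl

instance (V : X.Opens) : Module (𝒜.Sections V) (G.sec V) where
  one_smul p := by
    refine sec_ext ?_ fun y => ?_
    · rw [smul_fst, map_one, one_smul]
    · rw [smul_snd, map_one, map_one, one_smul, map_one, (G.A y).one, add_zero]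
  mul_smul a b p := by
    refine sec_ext ?_ fun y => ?_
    · rw [smul_fst, smul_fst, smul_fst, map_mul, mul_smul]
    · simp only [smul_snd, smul_fst, map_mul, (G.A y).mul, mul_smul, smul_add, resP_smul,
        DualAlgebra.redY_resA]
      rw [add_assoc]
  smul_zero a := by
    refine sec_ext ?_ fun y => ?_
    · rw [smul_fst]; exact smul_zero _
    · rw [smul_snd]
      change _ • (0 : SecP i E _) + (G.A y).toFun _ _ _ (resP i E _ 0) = 0
      rw [smul_zero, map_zero, map_zero, add_zero]
  smul_add a p q := by
    refine sec_ext ?_ fun y => ?_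
    · rw [smul_fst, add_fst, add_fst, smul_add]; rfl
    · simp only [smul_snd, add_snd, add_fst, smul_add, map_add]
      abel
  add_smul a b p := by
    refine sec_ext ?_ fun y => ?_
    · rw [smul_fst, add_fst, map_add, add_smul]; rfl
    · simp only [smul_snd, add_snd, add_smul, map_add, AddMonoidHom.add_apply]
      abel
  zero_smul p := by
    refine sec_ext ?_ fun y => ?_
    · rw [smul_fst, map_zero, zero_smul]; rfl
    · rw [smul_snd, map_zero, map_zero, zero_smul, map_zero, map_zero, AddMonoidHom.zero_apply,
        add_zero]
      rfl

lemma secRes_smul {V V' : X.Opens} (h : V' ≤ V) (a : 𝒜.Sections V) (p : G.sec V) :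
    G.secRes h (a • p) = 𝒜.resA h a • G.secRes h p := by
  refine sec_ext ?_ fun y => ?_
  · change resP i E h (𝒜.redY i V a • p.1.1) = 𝒜.redY i V' _ • resP i E h p.1.1
    rw [resP_smul, DualAlgebra.redY_resA]
  · change resP i E _ (resOP i (inf_le_left : V ⊓ G.U y ≤ V) (𝒜.redY i V a) • p.1.2 y +
      (G.A y).toFun (V ⊓ G.U y) inf_le_right (𝒜.resA inf_le_left a)
        (resP i E inf_le_left p.1.1)) =
      resOP i (inf_le_left : V' ⊓ G.U y ≤ V') (𝒜.redY i V' (𝒜.resA h a)) • resP i E _ (p.1.2 y) +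
      (G.A y).toFun (V' ⊓ G.U y) inf_le_right (𝒜.resA inf_le_left (𝒜.resA h a))
        (resP i E inf_le_left (resP i E h p.1.1))
    rw [map_add, resP_smul, ← (G.A y).res _ _ inf_le_right (inf_le_inf_right (G.U y) h),
      DualAlgebra.redY_resA]
    simp only [resOP_resOP, resP_resP, DualAlgebra.resA_resA]

variable (G)

instance (V : (Opens X)ᵒᵖ) : Module (𝒜.ring.obj.obj V) (G.presheaf.obj V) :=
  inferInstanceAs (Module (𝒜.Sections V.unop) (G.sec V.unop))

/-- The glued module. -/
def mod [IsSheafOfModules E] : SheafOfModules.{u} 𝒜.ring where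
  val := PresheafOfModules.ofPresheaf G.presheaf fun _ _ f a p =>
    secRes_smul (G := G) f.unop.le a p
  isSheaf := G.isSheaf_presheaf

/-- The glued module with its reduction modulo `ε`. -/
def dualModule [IsSheafOfModules E] : DualModule i 𝒜 E where
  mod := G.mod
  proj U := (AddMonoidHom.fst _ _).comp (G.sec U).subtype
  proj_res _ _ _ _ := rfl
  proj_smul _ _ _ := rfl

lemma eps_smul_fst {V : X.Opens} (p : G.sec V) : (𝒜.eps V • p).1.1 = 0 := by
  rw [smul_fst, ← mul_one (𝒜.eps V), DualAlgebra.redY_eps_mul, zero_smul]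

lemma eps_smul_snd {V : X.Opens} (p : G.sec V) (y : Y) :
    (𝒜.eps V • p).1.2 y = resP i E inf_le_left p.1.1 := by
  rw [smul_snd, ← mul_one (𝒜.eps V), DualAlgebra.redY_eps_mul, map_zero, zero_smul, zero_add,
    mul_one, DualAlgebra.resA_eps, (G.A y).eps_one]

/-- The inclusion of `E` into the glued module over `V ≤ U y`. -/
def incl (y : Y) {V : X.Opens} (h : V ≤ G.U y) : SecP i E V →+ G.sec V where
  toFun e := ⟨(e, fun z => G.tr y z (inf_le_left.trans h) inf_le_right (resP i E inf_le_left e)), by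
    intro z w V' h' hz hw
    simp only [← tr_res, resP_resP]
    exact G.tr_add y z w _ _ _ _⟩
  map_zero' := sec_ext rfl fun z => by simp
  map_add' e e' := sec_ext rfl fun z => by simp

variable {G}

lemma incl_fst (y : Y) {V : X.Opens} (h : V ≤ G.U y) (e : SecP i E V) :
    (G.incl y h e).1.1 = e := rfl

lemma incl_snd (y : Y) {V : X.Opens} (h : V ≤ G.U y) (e : SecP i E V) (z : Y) :
    (G.incl y h e).1.2 z =
      G.tr y z (inf_le_left.trans h) inf_le_right (resP i E inf_le_left e) := rfl

lemma smul_incl (y : Y) {V : X.Opens} (h : V ≤ G.U y) (a : 𝒜.Sections V) (e : SecP i E V) :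
    a • G.incl y h e = G.incl y h (𝒜.redY i V a • e) +
      𝒜.eps V • G.incl y h ((G.A y).toFun V h a e) := by
  refine sec_ext ?_ fun z => ?_
  · rw [add_fst, eps_smul_fst, add_zero, smul_fst, incl_fst, incl_fst]
  · rw [add_snd, eps_smul_snd, smul_snd, incl_snd, incl_snd, incl_fst, incl_fst,
      ← (G.A y).res V _ h inf_le_left, add_comm (G.tr y z _ _ _), resP_smul,
      ← DualAlgebra.redY_resA, add_comm, tr_rel]

/-- Inside the chart `y` the reduction and the ε-component in that chart are free, and the gluing
condition determines the other components from them. -/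
lemma existsUnique_incl (y : Y) {V : X.Opens} (h : V ≤ G.U y) (p : G.sec V) :
    ∃! e : SecP i E V × SecP i E V, p = G.incl y h e.1 + 𝒜.eps V • G.incl y h e.2 := by
  refine ⟨(p.1.1, resP i E (le_inf le_rfl h) (p.1.2 y)), sec_ext ?_ fun z => ?_, ?_⟩
  · rw [add_fst, eps_smul_fst, add_zero, incl_fst]
  · rw [add_snd, eps_smul_snd, incl_snd, incl_fst]
    have := p.2 y z (V ⊓ G.U z) inf_le_left (inf_le_left.trans h) inf_le_right
    rw [resP_self] at this
    rw [this, resP_resP, add_comm]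
  · rintro ⟨e, e'⟩ hp
    have h1 := congr(($hp).1.1)
    have h2 := congr(($hp).1.2 y)
    rw [add_fst, eps_smul_fst, add_zero, incl_fst] at h1
    rw [add_snd, eps_smul_snd, incl_snd, incl_fst, tr_self, zero_add] at h2
    rw [h1, h2, resP_resP, resP_self]

/-- The splitting of the glued module over `U' ≤ U y`. -/
def splitting [IsSheafOfModules E] (y : Y) {U' : X.Opens} (hU' : U' ≤ G.U y)
    (τ : 𝒜.Splitting P U') (hA : ((G.A y).restrict hU').IsBidifferential τ) :
    G.dualModule.Splitting τ where
  toFun V h := G.incl y (h.trans hU')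
  res V V' h h' e := sec_ext rfl fun z => by
    change G.tr y z _ _ (resP i E _ (resP i E h' e)) = resP i E _ (G.tr y z _ _ (resP i E _ e))
    rw [← tr_res, resP_resP, resP_resP]
  map_const V h c e := by
    change _ = 𝒜.scalar V _ • G.incl y (h.trans hU') e
    rw [smul_incl, (G.A y).const, map_zero, smul_zero, add_zero, DualAlgebra.redY_scalar]
    rfl
  proj_toFun V h e := rfl
  bijective V h p := existsUnique_incl y (h.trans hU') p
  α V h a e := (G.A y).toFun V (h.trans hU') (τ.toFun V h a) e
  smul V h a e := by
    have := smul_incl (G := G) y (h.trans hU') (τ.toFun V h a) e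
    rw [DualAlgebra.redY_apply, τ.red_toFun] at this
    exact this
  bidifferential := hA

lemma subsingleton_sec [IsSheafOfModules E] {V : X.Opens} (hV : ∀ y : Y, i y ∉ V) :
    Subsingleton (G.sec V) := by
  refine ⟨fun p q => sec_ext ?_ fun y => ?_⟩
  · exact (subsingleton_secP hV).elim _ _
  · exact (subsingleton_secP fun z (hz : i z ∈ V ⊓ G.U y) => hV z hz.1).elim _ _

/-- The splitting of the glued module away from `Y`. -/
def splittingOfDisjoint [IsSheafOfModules E] {U' : X.Opens} (hU' : ∀ y : Y, i y ∉ U')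
    (τ : 𝒜.Splitting P U') : G.dualModule.Splitting τ where
  toFun V h := 0
  res V V' h h' e := (subsingleton_sec (G := G) fun y hy => hU' y (h (h' hy))).elim _ _
  map_const V h c e := (subsingleton_sec (G := G) fun y hy => hU' y (h hy)).elim _ _
  proj_toFun V h e := (subsingleton_secP (i := i) (E := E) fun y hy => hU' y (h hy)).elim _ _
  bijective V h p := ⟨0, (subsingleton_sec (G := G) fun y hy => hU' y (h hy)).elim _ _, fun q _ =>
    Prod.ext ((subsingleton_secP (i := i) (E := E) fun y hy => hU' y (h hy)).elim _ _)
      ((subsingleton_secP (i := i) (E := E) fun y hy => hU' y (h hy)).elim _ _)⟩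
  α V h a e := 0
  smul V h a e := (subsingleton_sec (G := G) fun y hy => hU' y (h hy)).elim _ _
  bidifferential := ⟨0, fun V h => ⟨fun e => IsDiffOp.zero _, fun a => IsDiffOp.zero _⟩⟩

end GlueData

/-- The deformation given by gluing data. -/
def GlueData.deformation {i : Y ⟶ X} [IsClosedImmersion i] {𝒜 : Quantization sX P}
    {E : Y.PresheafOfModules} [IsSheafOfModules E] (G : GlueData i 𝒜.toDualAlgebra E)
    (τ : ∀ y, 𝒜.toDualAlgebra.Splitting P (G.U y)) (hG : ∀ y, (G.A y).IsBidifferential (τ y)) :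
    Deformation i 𝒜 E where
  toDualModule := G.dualModule
  exists_splitting x := by
    by_cases hx : ∃ y, i y = x
    · obtain ⟨y, rfl⟩ := hx
      obtain ⟨U, hU, hyU, hle⟩ := exists_isAffineOpen_mem_and_subset (G.mem y)
      have hle : U ≤ G.U y := hle
      refine ⟨U, hyU, hU, (τ y).restrict hle, ⟨splitting y hle _ ?_⟩⟩
      obtain ⟨n, hn⟩ := hG y
      exact ⟨n, fun V h => hn V (h.trans hle)⟩
    -- Away from `Y` both E and the glued module are zero, so a splitting of `𝒜` is all that is
    -- needed.
    · obtain ⟨U, hU, hxU, hUa, ⟨τ⟩⟩ := 𝒜.exists_splitting_le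
        (mem_complOpen (i := i) fun y hy => hx ⟨y, hy⟩)
      exact ⟨U, hxU, hUa, τ, ⟨splittingOfDisjoint (fun y hy => notMem_complOpen y (hU hy)) τ⟩⟩

end GlueData

/-! ### Sections of first order deformations -/

namespace DualModule

variable {k : Type u} [Field k] {X Y : Scheme.{u}} {sX : X ⟶ Spec (.of k)} {i : Y ⟶ X}
  {𝒜 : DualAlgebra sX} {E : Y.PresheafOfModules} {P : Bivector sX} {D : DualModule i 𝒜 E}

lemma resD_resD {V W Z : X.Opens} (h : W ≤ V) (h' : Z ≤ W) (s : D.Sections V) :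
    D.resD h' (D.resD h s) = D.resD (h'.trans h) s := by
  have := D.mod.val.presheaf.map_comp (homOfLE h).op (homOfLE h').op
  exact (congr($(this).hom s)).symm

lemma resD_self {V : X.Opens} (h : V ≤ V) (s : D.Sections V) : D.resD h s = s :=
  congr($(D.mod.val.presheaf.map_id (op V)).hom s)

lemma resD_smul {V W : X.Opens} (h : W ≤ V) (a : 𝒜.Sections V) (s : D.Sections V) :
    D.resD h (a • s) = 𝒜.resA h a • D.resD h s :=
  D.mod.val.map_smul (homOfLE h).op a s

lemma proj_resD {V W : X.Opens} (h : W ≤ V) (s : D.Sections V) :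
    D.proj W (D.resD h s) = resP i E h (D.proj V s) :=
  D.proj_res V W h s

lemma proj_smul' {V : X.Opens} (a : 𝒜.Sections V) (s : D.Sections V) :
    D.proj V (a • s) = 𝒜.redY i V a • D.proj V s :=
  D.proj_smul V a s

lemma proj_eps_smul {V : X.Opens} (s : D.Sections V) : D.proj V (𝒜.eps V • s) = 0 := by
  rw [proj_smul', ← mul_one (𝒜.eps V), DualAlgebra.redY_eps_mul, zero_smul]

lemma eps_smul_eps_smul {V : X.Opens} (s : D.Sections V) : 𝒜.eps V • 𝒜.eps V • s = 0 := by
  rw [smul_smul, DualAlgebra.eps_mul_eps, zero_smul]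

lemma smul_eps_smul {V : X.Opens} (a : 𝒜.Sections V) (s : D.Sections V) :
    a • 𝒜.eps V • s = 𝒜.eps V • a • s := by
  rw [smul_smul, smul_smul, DualAlgebra.eps_comm]

lemma resD_ext {V : X.Opens} {s t : D.Sections V}
    (h : ∀ x ∈ V, ∃ (V' : X.Opens) (h : V' ≤ V), x ∈ V' ∧ D.resD h s = D.resD h t) : s = t :=
  sheaf_ext (F := D.mod.val.presheaf) D.mod.isSheaf h

lemma resD_glue {V : X.Opens}
    (R : ∀ V' : X.Opens, V' ≤ V → D.Sections V' → Prop)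
    (hres : ∀ V' h g, R V' h g → ∀ V'' (h' : V'' ≤ V'), R V'' (h'.trans h) (D.resD h' g))
    (huniq : ∀ V' h g g', R V' h g → R V' h g' → g = g')
    (hex : ∀ x ∈ V, ∃ (V' : X.Opens) (h : V' ≤ V), x ∈ V' ∧ ∃ g, R V' h g) :
    ∃ g : D.Sections V, ∀ V' h g', R V' h g' → D.resD h g = g' :=
  let R' : ∀ V' : Opens X, V' ≤ V → ToType (D.mod.val.presheaf.obj (op V')) → Prop := R
  sheaf_glue (F := D.mod.val.presheaf) D.mod.isSheaf R' hres huniq hex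

namespace Splitting

variable {U : X.Opens} {τ : 𝒜.Splitting P U}

/-- Restriction to a smaller open set. -/
def restrict (σ : D.Splitting τ) {U' : X.Opens} (h : U' ≤ U) : D.Splitting (τ.restrict h) where
  toFun V hV := σ.toFun V (hV.trans h)
  res V V' hV h' e := σ.res V V' (hV.trans h) h' e
  map_const V hV c e := σ.map_const V (hV.trans h) c e
  proj_toFun V hV e := σ.proj_toFun V (hV.trans h) e
  bijective V hV s := σ.bijective V (hV.trans h) s
  α V hV := σ.α V (hV.trans h)
  smul V hV a e := σ.smul V (hV.trans h) a e
  bidifferential := by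
    obtain ⟨n, hn⟩ := σ.bidifferential
    exact ⟨n, fun V hV => hn V (hV.trans h)⟩

variable (σ : D.Splitting τ)

lemma exists_snd {V : X.Opens} (h : V ≤ U) (s : D.Sections V) :
    ∃ e, s = σ.toFun V h (D.proj V s) + 𝒜.eps V • σ.toFun V h e := by
  obtain ⟨⟨e, e'⟩, he, -⟩ := σ.bijective V h s
  refine ⟨e', ?_⟩
  have : D.proj V s = e := by
    rw [he, map_add, proj_eps_smul, add_zero, σ.proj_toFun]
  rw [this]
  exact he

/-- The second component of a section. -/
def snd {V : X.Opens} (h : V ≤ U) (s : D.Sections V) : SecP i E V := (σ.exists_snd h s).choose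

lemma eq_snd {V : X.Opens} (h : V ≤ U) (s : D.Sections V) :
    s = σ.toFun V h (D.proj V s) + 𝒜.eps V • σ.toFun V h (σ.snd h s) :=
  (σ.exists_snd h s).choose_spec

lemma snd_eq {V : X.Opens} (h : V ≤ U) {s : D.Sections V} {e e' : SecP i E V}
    (hs : s = σ.toFun V h e + 𝒜.eps V • σ.toFun V h e') : σ.snd h s = e' :=
  congrArg Prod.snd ((σ.bijective V h s).unique (y₁ := (D.proj V s, σ.snd h s)) (y₂ := (e, e'))
    (σ.eq_snd h s) hs)

lemma snd_add {V : X.Opens} (h : V ≤ U) (s t : D.Sections V) :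
    σ.snd h (s + t) = σ.snd h s + σ.snd h t := by
  refine σ.snd_eq h (e := D.proj V s + D.proj V t) ?_
  conv_lhs => rw [σ.eq_snd h s, σ.eq_snd h t]
  simp only [map_add, smul_add]
  abel

lemma snd_res {V V' : X.Opens} (h : V ≤ U) (h' : V' ≤ V) (s : D.Sections V) :
    σ.snd (h'.trans h) (D.resD h' s) = resP i E h' (σ.snd h s) := by
  refine σ.snd_eq _ (e := resP i E h' (D.proj V s)) ?_
  conv_lhs => rw [σ.eq_snd h s, map_add, resD_smul, DualAlgebra.resA_eps, ← σ.res, ← σ.res]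
  rfl

lemma snd_toFun {V : X.Opens} (h : V ≤ U) (e : SecP i E V) : σ.snd h (σ.toFun V h e) = 0 :=
  σ.snd_eq h (e := e) (by rw [map_zero, smul_zero, add_zero])

lemma snd_eps_smul {V : X.Opens} (h : V ≤ U) (s : D.Sections V) :
    σ.snd h (𝒜.eps V • s) = D.proj V s := by
  refine σ.snd_eq h (e := 0) ?_
  conv_lhs => rw [σ.eq_snd h s, smul_add, eps_smul_eps_smul, add_zero]
  rw [map_zero, zero_add]

lemma snd_smul {V : X.Opens} (h : V ≤ U) (a : 𝒜.Sections V) (s : D.Sections V) :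
    σ.snd h (a • s) = 𝒜.redY i V a • σ.snd h s + σ.snd h (a • σ.toFun V h (D.proj V s)) := by
  conv_lhs => rw [σ.eq_snd h s, smul_add, snd_add, smul_eps_smul, snd_eps_smul, proj_smul',
    σ.proj_toFun]
  rw [add_comm]

lemma ext_snd {V : X.Opens} (h : V ≤ U) {s t : D.Sections V} (h1 : D.proj V s = D.proj V t)
    (h2 : σ.snd h s = σ.snd h t) : s = t := by
  rw [σ.eq_snd h s, σ.eq_snd h t, h1, h2]

/-- The action in terms of a splitting. -/
def act : Act i 𝒜 E U where
  toFun V h := AddMonoidHom.mk' (fun a => AddMonoidHom.mk' (fun e => σ.snd h (a • σ.toFun V h e))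
    fun e e' => by rw [map_add, smul_add, snd_add]) fun a b => by
      ext e
      simp only [AddMonoidHom.mk'_apply, AddMonoidHom.add_apply, add_smul, snd_add]
  res V V' h h' a e := by
    simp only [AddMonoidHom.mk'_apply]
    rw [← snd_res, resD_smul, ← σ.res]
    rfl
  mul V h a b e := by
    simp only [AddMonoidHom.mk'_apply]
    rw [mul_smul, snd_smul, proj_smul', σ.proj_toFun]
  eps V h a e := by
    simp only [AddMonoidHom.mk'_apply]
    rw [mul_smul, snd_eps_smul, proj_smul', σ.proj_toFun]
  const V h c e := by
    simp only [AddMonoidHom.mk'_apply]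
    rw [← σ.map_const, snd_toFun]

lemma snd_smul' {V : X.Opens} (h : V ≤ U) (a : 𝒜.Sections V) (s : D.Sections V) :
    σ.snd h (a • s) = 𝒜.redY i V a • σ.snd h s + σ.act.toFun V h a (D.proj V s) :=
  σ.snd_smul h a s

lemma isBidifferential_act : σ.act.IsBidifferential τ := by
  have : ∀ V h a e, σ.act.toFun V h (τ.toFun V h a) e = σ.α V h a e := fun V h a e =>
    σ.snd_eq h (σ.smul V h a e)
  obtain ⟨n, hn⟩ := σ.bidifferential
  exact ⟨n, fun V h => ⟨fun e => by simpa only [this] using (hn V h).1 e,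
    fun a => by simpa only [this] using (hn V h).2 a⟩⟩

end Splitting

end DualModule

namespace Deformation

variable {k : Type u} [Field k] {X Y : Scheme.{u}} {sX : X ⟶ Spec (.of k)}
  {i : Y ⟶ X} {P : Bivector sX} {𝒜 : Quantization sX P} {E : Y.PresheafOfModules}

/-! ### The exact sequence 0 → εE → ℰ₁ → E → 0 -/

section Inc

variable (D : Deformation i 𝒜 E)

lemma exists_splitting_le {O : X.Opens} {x : X} (hx : x ∈ O) :
    ∃ U ≤ O, x ∈ U ∧ IsAffineOpen U ∧ ∃ τ : 𝒜.toDualAlgebra.Splitting P U,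
      Nonempty (D.toDualModule.Splitting τ) := by
  obtain ⟨U, hxU, hU, τ, ⟨σ⟩⟩ := D.exists_splitting x
  obtain ⟨U', hU', hxU', hle⟩ := exists_isAffineOpen_mem_and_subset (U := U ⊓ O) (x := x) ⟨hxU, hx⟩
  have hle' : U' ≤ U := fun z hz => (hle hz).1
  exact ⟨U', fun z hz => (hle hz).2, hxU', hU', τ.restrict hle', ⟨σ.restrict hle'⟩⟩

lemma exists_proj_eq {V : X.Opens} (e : SecP i E V) {x : X} (hx : x ∈ V) :
    ∃ (V' : X.Opens) (h : V' ≤ V), x ∈ V' ∧ ∃ t : D.Sections V', D.proj V' t = resP i E h e := by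
  obtain ⟨U, hU, hxU, -, τ, ⟨σ⟩⟩ := D.exists_splitting_le hx
  exact ⟨U, hU, hxU, σ.toFun U le_rfl (resP i E hU e), σ.proj_toFun _ _ _⟩

/-- Multiplication by ε factors through the reduction, as one sees in a local splitting. -/
lemma eps_smul_eq_zero {V : X.Opens} {t : D.Sections V} (ht : D.proj V t = 0) :
    𝒜.eps V • t = 0 := by
  refine DualModule.resD_ext fun x hx => ?_
  obtain ⟨U, hU, hxU, -, τ, ⟨σ⟩⟩ := D.exists_splitting_le hx
  refine ⟨U, hU, hxU, σ.ext_snd le_rfl ?_ ?_⟩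
  · rw [map_zero, DualModule.proj_resD, DualModule.proj_eps_smul, map_zero, map_zero]
  · rw [map_zero, DualModule.resD_smul, DualAlgebra.resA_eps, σ.snd_eps_smul, DualModule.proj_resD,
      ht, map_zero, ← σ.snd_toFun le_rfl 0, map_zero]

/-- Lifts t of e exist only locally, but εt does not depend on the lift, so the local products glue.
-/
lemma exists_inc {V : X.Opens} (e : SecP i E V) :
    ∃ g : D.Sections V, ∀ (V' : X.Opens) (h : V' ≤ V) (t : D.Sections V'),
      D.proj V' t = resP i E h e → D.resD h g = 𝒜.eps V' • t := by
  obtain ⟨g, hg⟩ := DualModule.resD_glue (D := D.toDualModule) (V := V)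
    (fun V' h g => ∃ t : D.Sections V', D.proj V' t = resP i E h e ∧ g = 𝒜.eps V' • t)
    (fun V' h g ⟨t, ht, hg⟩ V'' h' => ⟨D.resD h' t, by
      rw [DualModule.proj_resD, ht, resP_resP], by
      rw [hg, DualModule.resD_smul, DualAlgebra.resA_eps]⟩)
    (fun V' h g g' ⟨t, ht, hg⟩ ⟨t', ht', hg'⟩ => by
      have := D.eps_smul_eq_zero (t := t - t') (by rw [map_sub, ht, ht', sub_self])
      rw [hg, hg', ← sub_eq_zero, ← smul_sub, this])
    (fun x hx => by
      obtain ⟨V', h, hxV, t, ht⟩ := D.exists_proj_eq e hx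
      exact ⟨V', h, hxV, _, t, ht, rfl⟩)
  exact ⟨g, fun V' h t ht => hg V' h _ ⟨t, ht, rfl⟩⟩

lemma inc_unique {V : X.Opens} {e : SecP i E V} {g g' : D.Sections V}
    (hg : ∀ (V' : X.Opens) (h : V' ≤ V) (t : D.Sections V'),
      D.proj V' t = resP i E h e → D.resD h g = 𝒜.eps V' • t)
    (hg' : ∀ (V' : X.Opens) (h : V' ≤ V) (t : D.Sections V'),
      D.proj V' t = resP i E h e → D.resD h g' = 𝒜.eps V' • t) : g = g' := by
  refine DualModule.resD_ext fun x hx => ?_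
  obtain ⟨V', h, hxV, t, ht⟩ := D.exists_proj_eq e hx
  exact ⟨V', h, hxV, (hg V' h t ht).trans (hg' V' h t ht).symm⟩

/-- The inclusion `ε : E → D`. -/
def inc (V : X.Opens) : SecP i E V →+ D.Sections V :=
  AddMonoidHom.mk' (fun e => (D.exists_inc e).choose) fun e e' => by
    refine DualModule.resD_ext fun x hx => ?_
    obtain ⟨V₁, h₁, hx₁, t, ht⟩ := D.exists_proj_eq e hx
    obtain ⟨V₂, h₂, hx₂, t', ht'⟩ := D.exists_proj_eq (resP i E h₁ e') hx₁
    have e1 : D.proj V₂ (D.resD h₂ t) = resP i E (h₂.trans h₁) e := by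
      rw [DualModule.proj_resD, ht, resP_resP]
    have e2 : D.proj V₂ t' = resP i E (h₂.trans h₁) e' := by rw [ht', resP_resP]
    refine ⟨V₂, h₂.trans h₁, hx₂, ?_⟩
    rw [map_add, (D.exists_inc e).choose_spec V₂ _ _ e1, (D.exists_inc e').choose_spec V₂ _ _ e2,
      (D.exists_inc (e + e')).choose_spec V₂ _ (D.resD h₂ t + t') (by rw [map_add, map_add, e1, e2]),
      smul_add]

variable {D}

lemma inc_spec {V V' : X.Opens} (h : V' ≤ V) (e : SecP i E V) {t : D.Sections V'}
    (ht : D.proj V' t = resP i E h e) : D.resD h (D.inc V e) = 𝒜.eps V' • t :=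
  (D.exists_inc e).choose_spec V' h t ht

lemma inc_proj {V : X.Opens} (t : D.Sections V) : D.inc V (D.proj V t) = 𝒜.eps V • t := by
  have := inc_spec le_rfl (D.proj V t) (t := t) (resP_self _ _).symm
  rwa [DualModule.resD_self] at this

lemma inc_res {V V' : X.Opens} (h : V' ≤ V) (e : SecP i E V) :
    D.resD h (D.inc V e) = D.inc V' (resP i E h e) := by
  refine D.inc_unique (e := resP i E h e) (fun V'' h' t ht => ?_) fun V'' h' t ht => inc_spec h' _ ht
  rw [DualModule.resD_resD]
  exact inc_spec _ _ (ht.trans (resP_resP _ _ _))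

lemma proj_inc {V : X.Opens} [IsSheafOfModules E] (e : SecP i E V) : D.proj V (D.inc V e) = 0 := by
  refine resP_ext fun x hx => ?_
  obtain ⟨V', h, hxV, t, ht⟩ := D.exists_proj_eq e hx
  exact ⟨V', h, hxV, by rw [← DualModule.proj_resD, inc_spec h e ht, DualModule.proj_eps_smul,
    map_zero]⟩

lemma smul_inc {V : X.Opens} (a : 𝒜.Sections V) (e : SecP i E V) :
    a • D.inc V e = D.inc V (𝒜.redY i V a • e) := by
  refine DualModule.resD_ext fun x hx => ?_
  obtain ⟨V', h, hxV, t, ht⟩ := D.exists_proj_eq e hx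
  refine ⟨V', h, hxV, ?_⟩
  rw [DualModule.resD_smul, inc_spec h e ht, inc_spec h _ (t := 𝒜.resA h a • t)
    (by rw [DualModule.proj_smul', ht, DualAlgebra.redY_resA, resP_smul]), DualModule.smul_eps_smul]

/-- In a local splitting the ε-component of the image recovers e. -/
lemma inc_injective [IsSheafOfModules E] (V : X.Opens) : Function.Injective (D.inc V) := by
  refine (injective_iff_map_eq_zero _).2 fun e he => ?_
  refine resP_ext fun x hx => ?_
  obtain ⟨U, hU, hxU, -, τ, ⟨σ⟩⟩ := D.exists_splitting_le hx
  refine ⟨U, hU, hxU, ?_⟩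
  have h1 := inc_spec (D := D) hU e (t := σ.toFun U le_rfl (resP i E hU e)) (σ.proj_toFun _ _ _)
  rw [he, map_zero] at h1
  have h2 := σ.snd_eps_smul le_rfl (σ.toFun U le_rfl (resP i E hU e))
  rw [← h1, σ.proj_toFun] at h2
  rw [← h2, map_zero, ← σ.snd_toFun le_rfl 0, map_zero]

/-- In a local splitting a section with zero reduction comes from its ε-component; injectivity lets
these local preimages glue. -/
lemma exists_inc_eq [IsSheafOfModules E] {V : X.Opens} {s : D.Sections V} (hs : D.proj V s = 0) :
    ∃ e, D.inc V e = s := by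
  obtain ⟨e, he⟩ := resP_glue (i := i) (E := E) (V := V)
    (fun V' h e => D.inc V' e = D.resD h s)
    (fun V' h e he V'' h' => by rw [← inc_res, he, DualModule.resD_resD])
    (fun V' h e e' he he' => inc_injective V' (he.trans he'.symm))
    (fun x hx => by
      obtain ⟨U, hU, hxU, -, τ, ⟨σ⟩⟩ := D.exists_splitting_le hx
      refine ⟨U, hU, hxU, σ.snd le_rfl (D.resD hU s), ?_⟩
      have h1 := inc_proj (D := D) (σ.toFun U le_rfl (σ.snd le_rfl (D.resD hU s)))
      rw [σ.proj_toFun] at h1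
      have h2 := σ.eq_snd le_rfl (D.resD hU s)
      rw [DualModule.proj_resD, hs, map_zero, map_zero, zero_add] at h2
      rw [h1, ← h2])
  refine ⟨e, DualModule.resD_ext fun x hx => ?_⟩
  obtain ⟨U, hU, hxU, -, τ, ⟨σ⟩⟩ := D.exists_splitting_le hx
  refine ⟨U, hU, hxU, ?_⟩
  have h1 := inc_proj (D := D) (σ.toFun U le_rfl (σ.snd le_rfl (D.resD hU s)))
  rw [σ.proj_toFun] at h1
  have h2 := σ.eq_snd le_rfl (D.resD hU s)
  rw [DualModule.proj_resD, hs, map_zero, map_zero, zero_add] at h2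
  rw [inc_res, he U hU _ (h1.trans h2.symm), h1, ← h2]

lemma snd_inc {U : X.Opens} {τ : 𝒜.toDualAlgebra.Splitting P U} (σ : D.Splitting τ)
    {V : X.Opens} (h : V ≤ U) (e : SecP i E V) : σ.snd h (D.inc V e) = e := by
  have := inc_proj (D := D) (σ.toFun V h e)
  rw [σ.proj_toFun] at this
  rw [this, σ.snd_eps_smul, σ.proj_toFun]

end Inc

/-! ### The operator γ of a deformation -/

section Gam

variable (D : Deformation i 𝒜 E) [IsSheafOfModules E]

lemma smul_toFun_of_redY_eq_zero {U : X.Opens} {τ : 𝒜.toDualAlgebra.Splitting P U}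
    (σ : D.Splitting τ) {V : X.Opens} (h : V ≤ U) {x : 𝒜.Sections V} (hx : 𝒜.redY i V x = 0)
    (s : D.Sections V) : x • s = D.inc V (σ.act.toFun V h x (D.proj V s)) := by
  refine σ.ext_snd h ?_ ?_
  · rw [DualModule.proj_smul', hx, zero_smul, proj_inc]
  · rw [σ.snd_smul', hx, zero_smul, zero_add, snd_inc]

/-- Two lifts of e differ by an element of εE, on which x acts through its restriction to `Y`, that
is, by zero. So x·t depends only on e, lies in εE, and the local values glue. -/
lemma exists_gam {V : X.Opens} {x : 𝒜.Sections V} (hx : 𝒜.redY i V x = 0) (e : SecP i E V) :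
    ∃ g : SecP i E V, ∀ (V' : X.Opens) (h : V' ≤ V) (t : D.Sections V'),
      D.proj V' t = resP i E h e → 𝒜.resA h x • t = D.inc V' (resP i E h g) := by
  have hx' : ∀ (V' : X.Opens) (h : V' ≤ V), 𝒜.redY i V' (𝒜.resA h x) = 0 := fun V' h => by
    rw [DualAlgebra.redY_resA, hx, map_zero]
  obtain ⟨g, hg⟩ := resP_glue (i := i) (E := E) (V := V)
    (fun V' h g => ∃ t : D.Sections V', D.proj V' t = resP i E h e ∧
      𝒜.resA h x • t = D.inc V' g)
    (fun V' h g ⟨t, ht, hg⟩ V'' h' => ⟨D.resD h' t, by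
      rw [DualModule.proj_resD, ht, resP_resP], by
      rw [← inc_res, ← hg, DualModule.resD_smul, DualAlgebra.resA_resA]⟩)
    (fun V' h g g' ⟨t, ht, hg⟩ ⟨t', ht', hg'⟩ => by
      obtain ⟨e', he'⟩ := exists_inc_eq (D := D) (s := t - t') (by rw [map_sub, ht, ht', sub_self])
      have h1 := smul_inc (D := D) (𝒜.resA h x) e'
      rw [hx', zero_smul, map_zero, he', smul_sub, hg, hg', sub_eq_zero] at h1
      exact inc_injective V' h1)
    (fun z hz => by
      obtain ⟨U, hU, hxU, -, τ, ⟨σ⟩⟩ := D.exists_splitting_le hz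
      exact ⟨U, hU, hxU, _, σ.toFun U le_rfl (resP i E hU e), σ.proj_toFun _ _ _,
        D.smul_toFun_of_redY_eq_zero σ le_rfl (hx' U hU) _⟩)
  refine ⟨g, fun V' h t ht => DualModule.resD_ext fun z hz => ?_⟩
  obtain ⟨U, hU, hxU, -, τ, ⟨σ⟩⟩ := D.exists_splitting_le hz
  refine ⟨U, hU, hxU, ?_⟩
  have h1 := D.smul_toFun_of_redY_eq_zero σ le_rfl (hx' U (hU.trans h)) (D.resD hU t)
  rw [DualModule.resD_smul, DualAlgebra.resA_resA, inc_res, resP_resP, h1,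
    hg U (hU.trans h) _ ⟨D.resD hU t, by rw [DualModule.proj_resD, ht, resP_resP], h1⟩]

/-- The operator `γ`. -/
def gam {V : X.Opens} {x : 𝒜.Sections V} (hx : 𝒜.redY i V x = 0) (e : SecP i E V) : SecP i E V :=
  (D.exists_gam hx e).choose

lemma gam_spec {V V' : X.Opens} (h : V' ≤ V) {x : 𝒜.Sections V} (hx : 𝒜.redY i V x = 0)
    {e : SecP i E V} {t : D.Sections V'} (ht : D.proj V' t = resP i E h e) :
    𝒜.resA h x • t = D.inc V' (resP i E h (D.gam hx e)) :=
  (D.exists_gam hx e).choose_spec V' h t ht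

lemma smul_eq_inc_gam {V : X.Opens} {x : 𝒜.Sections V} (hx : 𝒜.redY i V x = 0) (t : D.Sections V) :
    x • t = D.inc V (D.gam hx (D.proj V t)) := by
  have := D.gam_spec le_rfl hx (t := t) (resP_self _ _).symm
  rwa [DualAlgebra.resA_self, resP_self] at this

/-- The bridge between the intrinsic γ and local actions: the left side involves no splitting, so
neither does the normal part on the right. -/
lemma gam_eq_act {U : X.Opens} {τ : 𝒜.toDualAlgebra.Splitting P U} (σ : D.Splitting τ)
    {V : X.Opens} (h : V ≤ U) {x : 𝒜.Sections V} (hx : 𝒜.redY i V x = 0) (e : SecP i E V) :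
    D.gam hx e = σ.act.toFun V h x e := by
  refine inc_injective (D := D) V ?_
  have h1 := D.smul_eq_inc_gam hx (σ.toFun V h e)
  have h2 := D.smul_toFun_of_redY_eq_zero σ h hx (σ.toFun V h e)
  rw [σ.proj_toFun] at h1 h2
  exact h1.symm.trans h2

lemma redY_resA_eq_zero {V V' : X.Opens} (h : V' ≤ V) {x : 𝒜.Sections V} (hx : 𝒜.redY i V x = 0) :
    𝒜.redY i V' (𝒜.resA h x) = 0 := by
  rw [DualAlgebra.redY_resA, hx, map_zero]

lemma gam_res {V V' : X.Opens} (h : V' ≤ V) {x : 𝒜.Sections V} (hx : 𝒜.redY i V x = 0)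
    (e : SecP i E V) : D.gam (redY_resA_eq_zero h hx) (resP i E h e) = resP i E h (D.gam hx e) := by
  refine resP_ext fun z hz => ?_
  obtain ⟨V₂, h₂, hz₂, t, ht⟩ := D.exists_proj_eq (resP i E h e) hz
  refine ⟨V₂, h₂, hz₂, inc_injective (D := D) V₂ ?_⟩
  rw [← D.gam_spec h₂ (redY_resA_eq_zero h hx) ht, resP_resP, DualAlgebra.resA_resA]
  rw [resP_resP] at ht
  exact D.gam_spec (h₂.trans h) hx ht

lemma sameNormal_act {D' : Deformation i 𝒜 E}
    (H : ∀ (V : X.Opens) (x : 𝒜.Sections V) (hx : 𝒜.redY i V x = 0) (e : SecP i E V),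
      D'.gam hx e = D.gam hx e)
    {U U' : X.Opens} {τ : 𝒜.toDualAlgebra.Splitting P U} {τ' : 𝒜.toDualAlgebra.Splitting P U'}
    (σ : D.Splitting τ) (σ' : D'.Splitting τ') : σ.act.SameNormal σ'.act := by
  intro V h h' x e hx
  rw [← D.gam_eq_act σ h hx, ← D'.gam_eq_act σ' h' hx, H]

/-- `IsTranslate` speaks of actual sections of the two modules, which a given e need not lift to.
Since lifts exist locally and γ commutes with restriction, it can be restated for all sections e. -/
lemma isTranslate_iff {D D' : Deformation i 𝒜 E} {ζ : NormalEnd i E ⊤} :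
    D.IsTranslate D' ζ ↔ ∀ (V : X.Opens) (x : 𝒜.Sections V) (hx : 𝒜.redY i V x = 0)
      (e : SecP i E V), D'.gam hx e = D.gam hx e + napp ζ le_top ⟨𝒜.red V x, hx⟩ e := by
  constructor
  · intro H V x hx e
    refine resP_ext fun z hz => ?_
    obtain ⟨U, hU, hzU, -, τ, ⟨σ⟩⟩ := D.exists_splitting_le hz
    obtain ⟨U', hU', hzU', -, τ', ⟨σ'⟩⟩ := D'.exists_splitting_le hzU
    refine ⟨U', hU'.trans hU, hzU', ?_⟩
    have hx' := redY_resA_eq_zero (hU'.trans hU) hx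
    have h1 := D.smul_eq_inc_gam hx' (σ.toFun U' hU' (resP i E (hU'.trans hU) e))
    have h2 := D'.smul_eq_inc_gam hx' (σ'.toFun U' le_rfl (resP i E (hU'.trans hU) e))
    have h3 := inc_proj (D := D) (σ.toFun U' hU' (D.gam hx' (resP i E (hU'.trans hU) e)))
    have h4 := inc_proj (D := D') (σ'.toFun U' le_rfl (D'.gam hx' (resP i E (hU'.trans hU) e)))
    rw [σ.proj_toFun] at h1 h3
    rw [σ'.proj_toFun] at h2 h4
    have := H U' (𝒜.resA (hU'.trans hU) x) hx' _ _ _ _ (by rw [σ.proj_toFun, σ'.proj_toFun])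
      (h1.trans h3) (h2.trans h4)
    rw [σ.proj_toFun, σ'.proj_toFun, σ.proj_toFun] at this
    rw [map_add, ← gam_res, ← gam_res, this, ← NormalEnd.app_res]
    congr 2
    exact congrArg _ (Subtype.ext (DualAlgebra.red_resA _ _))
  · intro H V x hx s t s' t' hs ht ht'
    have hx' : 𝒜.redY i V x = 0 := hx
    have h1 := D.smul_eq_inc_gam hx' s
    have h2 := D'.smul_eq_inc_gam hx' s'
    rw [ht, ← inc_proj] at h1
    rw [ht', ← inc_proj] at h2
    rw [inc_injective V h1, inc_injective V h2, H V x hx', hs]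
    rfl

end Gam

end Deformation

/-! ### Morphisms of first order deformations -/

namespace Deformation

variable {k : Type u} [Field k] {X Y : Scheme.{u}} {sX : X ⟶ Spec (.of k)}
  {i : Y ⟶ X} {P : Bivector sX} {𝒜 : Quantization sX P} {E : Y.PresheafOfModules}

/-- Morphisms of sheaves of modules from their values on sections. -/
def homMk {D D' : Deformation i 𝒜 E} (f : ∀ V, D.Sections V →+ D'.Sections V)
    (hres : ∀ V V' (h : V' ≤ V) s, f V' (D.resD h s) = D'.resD h (f V s))
    (hsmul : ∀ V (a : 𝒜.Sections V) s, f V (a • s) = a • f V s) : D.mod ⟶ D'.mod where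
  val :=
    { app := fun V => ModuleCat.ofHom
        { toFun := f V.unop
          map_add' := map_add _
          map_smul' := hsmul V.unop }
      naturality := fun {V V'} h => by
        ext s
        exact hres V.unop V'.unop h.unop.le s }

/-- The value of a morphism on sections. -/
def homApp {D D' : Deformation i 𝒜 E} (φ : D.mod ⟶ D'.mod) (V : X.Opens) :
    D.Sections V →ₗ[𝒜.Sections V] D'.Sections V := (φ.val.app (op V)).hom

lemma homApp_res {D D' : Deformation i 𝒜 E} (φ : D.mod ⟶ D'.mod) {V V' : X.Opens} (h : V' ≤ V)
    (s : D.Sections V) : homApp φ V' (D.resD h s) = D'.resD h (homApp φ V s) :=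
  PresheafOfModules.naturality_apply φ.val (homOfLE h).op s

lemma hom_ext {D D' : Deformation i 𝒜 E} {φ ψ : D.mod ⟶ D'.mod}
    (h : ∀ V s, homApp φ V s = homApp ψ V s) : φ = ψ := by
  apply SheafOfModules.hom_ext
  apply PresheafOfModules.hom_ext
  intro V
  ext s
  exact h V.unop s

variable (D D' : Deformation i 𝒜 E)

/-- Morphisms of deformations over an open set that restrict to the identity modulo `ε`. -/
structure LocalMor (U : X.Opens) where
  /-- the morphism -/
  toFun : ∀ V, V ≤ U → D.Sections V →+ D'.Sections V
  res : ∀ V V' (h : V ≤ U) (h' : V' ≤ V) s,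
    toFun V' (h'.trans h) (D.resD h' s) = D'.resD h' (toFun V h s)
  smul : ∀ V (h : V ≤ U) (a : 𝒜.Sections V) s, toFun V h (a • s) = a • toFun V h s
  proj : ∀ V (h : V ≤ U) s, D'.proj V (toFun V h s) = D.proj V s

variable {D D'} [IsSheafOfModules E]

/-- A global morphism as a local one. -/
def LocalMor.ofHom (φ : D.mod ⟶ D'.mod) (hφ : IsIdentityMod (D := D) (D' := D') φ) :
    LocalMor D D' ⊤ where
  toFun V _ := (homApp φ V).toAddMonoidHom
  res _ _ _ h' s := homApp_res φ h' s
  smul V _ a s := map_smul (homApp φ V) a s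
  proj V _ s := hφ V s

/-! ### Local morphisms, their differences and their gluing -/

namespace LocalMor

/-- Restriction to a smaller open set. -/
def restrict {U U' : X.Opens} (ψ : LocalMor D D' U) (h : U' ≤ U) : LocalMor D D' U' where
  toFun V hV := ψ.toFun V (hV.trans h)
  res V V' hV h' s := ψ.res V V' (hV.trans h) h' s
  smul V hV a s := ψ.smul V (hV.trans h) a s
  proj V hV s := ψ.proj V (hV.trans h) s

/-- The morphism `ψ + ε c`. -/
def add {U : X.Opens} (ψ : LocalMor D D' U) {T : Y.Opens} (hT : i ⁻¹ᵁ U ≤ T)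
    (c : LocalHom E E T) : LocalMor D D' U where
  toFun V h := ψ.toFun V h + (D'.inc V).comp
    ((happ c ((preimage_le i h).trans hT)).toAddMonoidHom.comp (D.proj V))
  res V V' h h' s := by
    simp only [AddMonoidHom.add_apply, AddMonoidHom.comp_apply, LinearMap.toAddMonoidHom_coe,
      map_add, inc_res, ψ.res V V' h h', DualModule.proj_resD,
      happ_resP c ((preimage_le i h).trans hT) h']
  smul V h a s := by
    simp only [AddMonoidHom.add_apply, AddMonoidHom.comp_apply, LinearMap.toAddMonoidHom_coe,
      ψ.smul, smul_add, smul_inc, DualModule.proj_smul', map_smul]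
  proj V h s := by
    simp only [AddMonoidHom.add_apply, AddMonoidHom.comp_apply, map_add, ψ.proj, proj_inc, add_zero]

/-- ψ(εt) = εψ(t), and ψ(t) has the same reduction as t; so ψ is the identity on εE. -/
lemma map_inc {U : X.Opens} (ψ : LocalMor D D' U) {V : X.Opens} (h : V ≤ U) (e : SecP i E V) :
    ψ.toFun V h (D.inc V e) = D'.inc V e := by
  refine D'.inc_unique (e := e) (fun V' h' t ht => ?_) fun V' h' t ht => inc_spec h' e ht
  obtain ⟨g, hg⟩ : ∃ g, D'.inc V' g = ψ.toFun V' (h'.trans h) (D.resD h' (D.inc V e)) :=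
    exists_inc_eq (by rw [ψ.proj, DualModule.proj_resD, proj_inc, map_zero])
  rw [← ψ.res V V' h h', ← hg]
  refine DualModule.resD_ext fun x hx => ?_
  obtain ⟨V₂, h₂, hx₂, s, hs⟩ := D.exists_proj_eq (resP i E h' e) hx
  refine ⟨V₂, h₂, hx₂, ?_⟩
  rw [hg, ← ψ.res, inc_res, inc_res, ← hs, inc_proj, ψ.smul, DualModule.resD_smul,
    DualAlgebra.resA_eps]
  have := D'.eps_smul_eq_zero (t := ψ.toFun V₂ (h₂.trans (h'.trans h)) s - D'.resD h₂ t)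
    (by rw [map_sub, ψ.proj, hs, DualModule.proj_resD, ht, sub_self])
  rwa [smul_sub, sub_eq_zero] at this

/-- The two morphisms agree on εE and modulo ε, so their difference factors as D → E → εE ⊆ D'. -/
lemma exists_sub_apply {U U' : X.Opens} (ψ : LocalMor D D' U) (ψ' : LocalMor D D' U')
    {V : X.Opens} (h : V ≤ U) (h' : V ≤ U') (e : SecP i E V) :
    ∃ g : SecP i E V, ∀ (V' : X.Opens) (hV : V' ≤ V) (t : D.Sections V'),
      D.proj V' t = resP i E hV e →
        ψ'.toFun V' (hV.trans h') t = ψ.toFun V' (hV.trans h) t + D'.inc V' (resP i E hV g) := by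
  have key : ∀ (V' : X.Opens) (hV : V' ≤ V) (t t' : D.Sections V'), D.proj V' t = D.proj V' t' →
      ψ'.toFun V' (hV.trans h') t - ψ.toFun V' (hV.trans h) t =
      ψ'.toFun V' (hV.trans h') t' - ψ.toFun V' (hV.trans h) t' := by
    intro V' hV t t' htt
    obtain ⟨g, hg⟩ := exists_inc_eq (D := D) (s := t - t') (by rw [map_sub, htt, sub_self])
    have h1 := ψ.map_inc (hV.trans h) g
    have h2 := ψ'.map_inc (hV.trans h') g
    rw [hg, map_sub] at h1 h2
    rw [sub_eq_sub_iff_sub_eq_sub, h1, h2]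
  obtain ⟨g, hg⟩ := resP_glue (i := i) (E := E) (V := V)
    (fun V' hV g => ∃ t : D.Sections V', D.proj V' t = resP i E hV e ∧
      ψ'.toFun V' (hV.trans h') t - ψ.toFun V' (hV.trans h) t = D'.inc V' g)
    (fun V' hV g ⟨t, ht, hg⟩ V'' hV' => ⟨D.resD hV' t, by
      rw [DualModule.proj_resD, ht, resP_resP], by
      rw [ψ.res V' V'' (hV.trans h), ψ'.res V' V'' (hV.trans h'), ← inc_res, ← hg, map_sub]⟩)
    (fun V' hV g g' ⟨t, ht, hg⟩ ⟨t', ht', hg'⟩ => by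
      refine inc_injective (D := D') V' ?_
      rw [← hg, ← hg', key V' hV t t' (ht.trans ht'.symm)])
    (fun x hx => by
      obtain ⟨V', hV, hxV, t, ht⟩ := D.exists_proj_eq e hx
      obtain ⟨g, hg⟩ := exists_inc_eq (D := D')
        (s := ψ'.toFun V' (hV.trans h') t - ψ.toFun V' (hV.trans h) t)
        (by rw [map_sub, ψ.proj, ψ'.proj, sub_self])
      exact ⟨V', hV, hxV, g, t, ht, hg.symm⟩)
  refine ⟨g, fun V' hV t ht => ?_⟩
  obtain ⟨g', hg'⟩ := exists_inc_eq (D := D')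
    (s := ψ'.toFun V' (hV.trans h') t - ψ.toFun V' (hV.trans h) t)
    (by rw [map_sub, ψ.proj, ψ'.proj, sub_self])
  rw [hg V' hV g' ⟨t, ht, hg'.symm⟩, hg', add_sub_cancel]

/-- The map E → E that describes the difference commutes with `𝒜`, which acts on E through 𝒪_Y, so
it is 𝒪_Y-linear. This is where ℰnd(E) enters as the sheaf of ambiguities of isomorphisms. -/
lemma exists_sub [IsClosedImmersion i] {U U' : X.Opens} (ψ : LocalMor D D' U)
    (ψ' : LocalMor D D' U') {T : Y.Opens} (hT : T ≤ i ⁻¹ᵁ U) (hT' : T ≤ i ⁻¹ᵁ U') :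
    ∃ c : LocalHom E E T, ∀ (V : X.Opens) (h : V ≤ U) (h' : V ≤ U') (hV : i ⁻¹ᵁ V ≤ T)
      (s : D.Sections V),
      ψ'.toFun V h' s = ψ.toFun V h s + D'.inc V (happ c hV (D.proj V s)) := by
  choose g hg using fun (V : X.Opens) (h : V ≤ U ⊓ U') (e : SecP i E V) =>
    ψ.exists_sub_apply ψ' (h.trans inf_le_left) (h.trans inf_le_right) e
  have guniq : ∀ (V : X.Opens) (h : V ≤ U ⊓ U') (e c : SecP i E V),
      (∀ (V' : X.Opens) (hV : V' ≤ V) (t : D.Sections V'), D.proj V' t = resP i E hV e →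
        ψ'.toFun V' (hV.trans (h.trans inf_le_right)) t =
          ψ.toFun V' (hV.trans (h.trans inf_le_left)) t + D'.inc V' (resP i E hV c)) →
      g V h e = c := by
    intro V h e c hc
    refine resP_ext fun x hx => ?_
    obtain ⟨V', hV, hxV, t, ht⟩ := D.exists_proj_eq e hx
    refine ⟨V', hV, hxV, inc_injective (D := D') V' ?_⟩
    exact add_left_cancel ((hg V h e V' hV t ht).symm.trans (hc V' hV t ht))
  have hTU : T ≤ i ⁻¹ᵁ (U ⊓ U') := fun y hy => ⟨hT hy, hT' hy⟩
  obtain ⟨β, hβ⟩ := exists_addEnd_of_pushforward (M := E) (T := T) (U := U ⊓ U') hTU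
    (fun V h => AddMonoidHom.mk' (g V h) fun e e' => by
      refine resP_ext fun x hx => ?_
      obtain ⟨V₁, h₁, hx₁, t, ht⟩ := D.exists_proj_eq e hx
      obtain ⟨V₂, h₂, hx₂, t', ht'⟩ := D.exists_proj_eq (resP i E h₁ e') hx₁
      refine ⟨V₂, h₂.trans h₁, hx₂, inc_injective (D := D') V₂ ?_⟩
      have e1 : D.proj V₂ (D.resD h₂ t) = resP i E (h₂.trans h₁) e := by
        rw [DualModule.proj_resD, ht, resP_resP]
      have e2 : D.proj V₂ t' = resP i E (h₂.trans h₁) e' := by rw [ht', resP_resP]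
      have h3 := hg V h e V₂ _ _ e1
      have h4 := hg V h e' V₂ _ _ e2
      have h5 := hg V h (e + e') V₂ (h₂.trans h₁) (D.resD h₂ t + t')
        (by rw [map_add, map_add, e1, e2])
      rw [map_add, map_add, h3, h4, add_add_add_comm] at h5
      rw [← add_left_cancel h5, map_add, map_add])
    (fun V V' h h' e => by
      refine guniq _ _ _ _ fun V'' h'' t ht => ?_
      rw [resP_resP] at ht ⊢
      exact hg V h e V'' _ t ht)
  have hval : ∀ (V : X.Opens) (h : V ≤ U ⊓ U') (s : D.Sections V),
      ψ'.toFun V (h.trans inf_le_right) s =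
        ψ.toFun V (h.trans inf_le_left) s + D'.inc V (g V h (D.proj V s)) := by
    intro V h s
    have := hg V h (D.proj V s) V le_rfl s (resP_self _ _).symm
    rwa [resP_self] at this
  obtain ⟨c, hc⟩ := exists_localHom_of_linear 𝒜 hTU β (fun V h hV a e => by
    rw [hβ V h, hβ V h]
    change g V h _ = _ • g V h e
    refine resP_ext fun x hx => ?_
    obtain ⟨V', h', hxV, t, ht⟩ := D.exists_proj_eq e hx
    refine ⟨V', h', hxV, inc_injective (D := D') V' ?_⟩
    have h1 := hg V h e V' h' t ht
    have h2 := hg V h (𝒜.redY i V a • e) V' h' (𝒜.resA h' a • t)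
      (by rw [DualModule.proj_smul', ht, DualAlgebra.redY_resA, resP_smul])
    rw [ψ.smul, ψ'.smul, h1, smul_add, smul_inc] at h2
    rw [← add_left_cancel h2, resP_smul, DualAlgebra.redY_resA])
  refine ⟨c, fun V h h' hV s => ?_⟩
  rw [hc, hβ V (le_inf h h')]
  exact hval V (le_inf h h') s

/-- The open sets `U y` need only cover `Y`, because the module is zero on the complement of `Y`. -/
lemma sections_ext [IsClosedImmersion i] {U : Y → X.Opens} (hU : ∀ y, i y ∈ U y) {V : X.Opens}
    {s t : D.Sections V}
    (H : ∀ y V' (h : V' ≤ V) (_ : V' ≤ U y), D.resD h s = D.resD h t) : s = t := by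
  refine DualModule.resD_ext fun x hx => ?_
  by_cases hxY : ∃ y, i y = x
  · obtain ⟨y, rfl⟩ := hxY
    exact ⟨V ⊓ U y, inf_le_left, ⟨hx, hU y⟩, H y _ _ inf_le_right⟩
  · refine ⟨V ⊓ complOpen i, inf_le_left, ⟨hx, mem_complOpen fun y hy => hxY ⟨y, hy⟩⟩, ?_⟩
    obtain ⟨e, he⟩ := exists_inc_eq (D := D) (V := V ⊓ complOpen i)
      (s := D.resD inf_le_left s - D.resD inf_le_left t)
      ((subsingleton_secP fun y (hy : i y ∈ V ⊓ complOpen i) => notMem_complOpen y hy.2).elim _ _)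
    have he0 : e = 0 :=
      (subsingleton_secP fun y (hy : i y ∈ V ⊓ complOpen i) => notMem_complOpen y hy.2).elim _ _
    rw [he0, map_zero] at he
    exact (sub_eq_zero.1 he.symm)

lemma exists_glue [IsClosedImmersion i] {U : Y → X.Opens} (hU : ∀ y, i y ∈ U y)
    (ψ : ∀ y, LocalMor D D' (U y))
    (H : ∀ y z V (hy : V ≤ U y) (hz : V ≤ U z) s, (ψ y).toFun V hy s = (ψ z).toFun V hz s) :
    ∃ φ : D.mod ⟶ D'.mod, IsIdentityMod (D := D) (D' := D') φ := by
  have hex : ∀ (V : X.Opens) (s : D.Sections V), ∃ g : D'.Sections V,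
      ∀ y V' (h : V' ≤ V) (hy : V' ≤ U y), D'.resD h g = (ψ y).toFun V' hy (D.resD h s) := by
    intro V s
    obtain ⟨g, hg⟩ := DualModule.resD_glue (D := D'.toDualModule) (V := V)
      (fun V' h g => ∀ y V'' (h' : V'' ≤ V') (hy : V'' ≤ U y),
        D'.resD h' g = (ψ y).toFun V'' hy (D.resD (h'.trans h) s))
      (fun V' h g hg V'' h' y V₃ h₃ hy => by
        rw [DualModule.resD_resD]; exact hg y V₃ (h₃.trans h') hy)
      (fun V' h g g' hg hg' => sections_ext hU fun y V'' h' hy =>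
        (hg y V'' h' hy).trans (hg' y V'' h' hy).symm)
      (fun x hx => by
        by_cases hxY : ∃ y, i y = x
        · obtain ⟨y, rfl⟩ := hxY
          refine ⟨V ⊓ U y, inf_le_left, ⟨hx, hU y⟩,
            (ψ y).toFun _ inf_le_right (D.resD inf_le_left s), fun z V'' h' hz => ?_⟩
          rw [← (ψ y).res (V ⊓ U y) V'' inf_le_right, DualModule.resD_resD]
          exact H _ _ _ _ _ _
        -- Off `Y` zero is the only possible value, and it satisfies every condition there.
        · refine ⟨V ⊓ complOpen i, inf_le_left,
            ⟨hx, mem_complOpen fun y hy => hxY ⟨y, hy⟩⟩, 0, fun y V'' h' hy => ?_⟩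
          rw [map_zero]
          obtain ⟨e, he⟩ := exists_inc_eq (D := D')
            (s := (ψ y).toFun V'' hy (D.resD (h'.trans inf_le_left) s))
            ((subsingleton_secP fun z (hz : i z ∈ V'') => notMem_complOpen z (h' hz).2).elim _ _)
          have he0 : e = 0 :=
            (subsingleton_secP fun z (hz : i z ∈ V'') => notMem_complOpen z (h' hz).2).elim _ _
          rw [← he, he0, map_zero])
    refine ⟨g, fun y V' h hy => hg V' h _ fun z V'' h' hz => ?_⟩
    rw [← (ψ y).res V' V'' hy, DualModule.resD_resD]
    exact H _ _ _ _ _ _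
  choose f hf using hex
  refine ⟨homMk (fun V => AddMonoidHom.mk' (f V) fun s t => sections_ext hU fun y V' h hy => ?_)
    (fun V V' h s => sections_ext hU fun y V'' h' hy => ?_)
    (fun V a s => sections_ext hU fun y V' h hy => ?_), fun V s => ?_⟩
  · rw [map_add, hf V s y V' h hy, hf V t y V' h hy, hf V (s + t) y V' h hy, map_add, map_add]
  · refine (hf V' (D.resD h s) y V'' h' hy).trans ?_
    rw [DualModule.resD_resD, DualModule.resD_resD]
    exact (hf V s y V'' _ hy).symm
  · refine (hf V (a • s) y V' h hy).trans ?_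
    rw [DualModule.resD_smul, DualModule.resD_smul, (ψ y).smul]
    exact congrArg _ (hf V s y V' h hy).symm
  · change D'.proj V (f V s) = D.proj V s
    refine resP_ext fun x hx => ?_
    by_cases hxY : ∃ y, i y = x
    · obtain ⟨y, rfl⟩ := hxY
      refine ⟨V ⊓ U y, inf_le_left, ⟨hx, hU y⟩, ?_⟩
      rw [← DualModule.proj_resD, hf V s y _ inf_le_left inf_le_right, (ψ y).proj,
        DualModule.proj_resD]
    · exact ⟨V ⊓ complOpen i, inf_le_left, ⟨hx, mem_complOpen fun y hy => hxY ⟨y, hy⟩⟩,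
        (subsingleton_secP fun y (hy : i y ∈ V ⊓ complOpen i) => notMem_complOpen y hy.2).elim _ _⟩

end LocalMor

/-- Morphisms that restrict to the identity modulo `ε` are isomorphisms. -/
lemma IsIdentityMod.equiv {φ : D.mod ⟶ D'.mod} (hφ : IsIdentityMod (D := D) (D' := D') φ) :
    D ≈ D' := by
  have hproj : ∀ V s, D'.proj V (homApp φ V s) = D.proj V s := hφ
  have hinc : ∀ V e, homApp φ V (D.inc V e) = D'.inc V e := fun V e =>
    (LocalMor.ofHom φ hφ).map_inc le_top e
  -- The five lemma for 0 → εE → D → E, with the identity on both outer terms.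
  have hinj : ∀ V, Function.Injective (homApp φ V) := fun V => by
    refine (injective_iff_map_eq_zero _).2 fun s hs => ?_
    obtain ⟨e, he⟩ := exists_inc_eq (D := D) (s := s) (by rw [← hproj, hs, map_zero])
    rw [← he, hinc] at hs
    rw [← he, inc_injective V (hs.trans (map_zero _).symm), map_zero]
  have hsurj : ∀ V, Function.Surjective (homApp φ V) := fun V s' => by
    -- Preimages exist locally: lift the reduction of s', then correct by the error, which lies in
    -- εE. Injectivity glues them.
    have hloc : ∀ x ∈ V, ∃ (V' : X.Opens) (h : V' ≤ V), x ∈ V' ∧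
        ∃ s, homApp φ V' s = D'.resD h s' := fun x hx => by
      obtain ⟨V', h, hxV, t, ht⟩ := D.exists_proj_eq (D'.proj V s') hx
      obtain ⟨e, he⟩ := exists_inc_eq (D := D') (s := D'.resD h s' - homApp φ V' t)
        (by rw [map_sub, hproj, ht, DualModule.proj_resD, sub_self])
      exact ⟨V', h, hxV, t + D.inc V' e, by rw [map_add, hinc, he, add_sub_cancel]⟩
    obtain ⟨s, hs⟩ := DualModule.resD_glue (D := D.toDualModule) (V := V)
      (fun V' h s => homApp φ V' s = D'.resD h s')
      (fun V' h s hs V'' h' => by rw [homApp_res, hs, DualModule.resD_resD])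
      (fun V' h s t hs ht => hinj V' (hs.trans ht.symm)) hloc
    refine ⟨s, DualModule.resD_ext fun x hx => ?_⟩
    obtain ⟨V', h, hxV, t, ht⟩ := hloc x hx
    exact ⟨V', h, hxV, by rw [← homApp_res, hs V' h t ht, ht]⟩
  have : IsIso φ.val := by
    let ι := PresheafOfModules.isoMk (M₁ := D.mod.val) (M₂ := D'.mod.val)
      (fun V => (LinearEquiv.ofBijective (homApp φ V.unop)
        ⟨hinj V.unop, hsurj V.unop⟩).toModuleIso) fun V V' h => φ.val.naturality h
    have : φ.val = ι.hom := rfl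
    rw [this]
    infer_instance
  have : IsIso ((SheafOfModules.forget _).map φ) := this
  have : IsIso φ := isIso_of_reflects_iso φ (SheafOfModules.forget _)
  exact ⟨asIso φ, hφ⟩

end Deformation

/-! ### Čech coboundaries in low degrees -/

namespace Cech

variable {Y : Scheme.{u}} {F : TopCat.Presheaf AddCommGrpCat.{u} Y}

/-- The type of `c s` depends on `s`, so tuples that are equal but not syntactically so have to be
exchanged after restriction to a common open set. -/
lemma resF_cochain_congr {𝒱 : PointedCover Y} {n : ℕ} (c : Cochain F 𝒱 n) {s t : Fin (n + 1) → Y}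
    (hst : s = t) {O : Y.Opens} (hs : O ≤ inter 𝒱 s) (ht : O ≤ inter 𝒱 t) :
    resF F hs (c s) = resF F ht (c t) := by
  subst hst
  rfl

lemma le_inter {𝒱 : PointedCover Y} {n : ℕ} {s : Fin n → Y} {O : Y.Opens}
    (h : ∀ j, O ≤ 𝒱.nhd (s j)) : O ≤ inter 𝒱 s := le_iInf h

lemma le_inter_two {𝒱 : PointedCover Y} {y z : Y} {O : Y.Opens} (hy : O ≤ 𝒱.nhd y)
    (hz : O ≤ 𝒱.nhd z) : O ≤ inter 𝒱 ![y, z] :=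
  le_inter fun j => by fin_cases j <;> assumption

lemma le_inter_three {𝒱 : PointedCover Y} {y z w : Y} {O : Y.Opens} (hy : O ≤ 𝒱.nhd y)
    (hz : O ≤ 𝒱.nhd z) (hw : O ≤ 𝒱.nhd w) : O ≤ inter 𝒱 ![y, z, w] :=
  le_inter fun j => by fin_cases j <;> assumption

/-- The coboundary relation is stated over any open set inside the intersection, which avoids
comparing different descriptions of that intersection. -/
lemma exists_of_mk_eq_zero_one {𝒱 : PointedCover Y} {c : Z F 𝒱 1} (h : mk 𝒱 c = 0) :
    ∃ (𝒲 : PointedCover Y) (h : 𝒱 ≤ 𝒲) (b : ∀ y, F.obj (op (𝒲.nhd y))),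
      ∀ (y z : Y) (O : Y.Opens) (hy : O ≤ 𝒲.nhd y) (hz : O ≤ 𝒲.nhd z),
        resF F hz (b z) - resF F hy (b y) =
          resF F (le_inter_two (hy.trans (h y)) (hz.trans (h z))) (c.1 ![y, z]) := by
  obtain ⟨𝒲, h, b, hb⟩ := exists_of_mk_eq_zero h
  refine ⟨𝒲, h, fun y => resF F (le_inter fun _ => le_rfl) (b fun _ => y), fun y z O hy hz => ?_⟩
  have h1 := congrArg (resF F (le_inter_two hy hz)) (congrFun hb ![y, z])
  rw [d_zero_apply, map_sub] at h1
  simp only [resF_resF] at h1 ⊢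
  rw [resF_cochain_congr b (s := ![y, z] ∘ Fin.succAbove 0) (t := fun _ => z)
      (funext fun j => by fin_cases j; rfl) _ (le_inter fun _ => hz),
    resF_cochain_congr b (s := ![y, z] ∘ Fin.succAbove 1) (t := fun _ => y)
      (funext fun j => by fin_cases j; rfl) _ (le_inter fun _ => hy)] at h1
  refine h1.trans ?_
  exact resF_resF _ _ _

lemma exists_coboundary_one [Subsingleton (HLim F 1)] {𝒱 : PointedCover Y}
    (c : ∀ y z, F.obj (op (𝒱.nhd y ⊓ 𝒱.nhd z)))
    (hc : ∀ (y z w : Y) (O : Y.Opens) (hy : O ≤ 𝒱.nhd y) (hz : O ≤ 𝒱.nhd z) (hw : O ≤ 𝒱.nhd w),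
      resF F (le_inf hz hw) (c z w) - resF F (le_inf hy hw) (c y w) +
        resF F (le_inf hy hz) (c y z) = 0) :
    ∃ (𝒲 : PointedCover Y) (h : 𝒱 ≤ 𝒲) (b : ∀ y, F.obj (op (𝒲.nhd y))),
      ∀ (y z : Y) (O : Y.Opens) (hy : O ≤ 𝒲.nhd y) (hz : O ≤ 𝒲.nhd z),
        resF F hz (b z) - resF F hy (b y) =
          resF F (le_inf (hy.trans (h y)) (hz.trans (h z))) (c y z) := by
  let c' : Cochain F 𝒱 1 := fun s =>
    resF F (le_inf (inter_le 𝒱 s 0) (inter_le 𝒱 s 1)) (c (s 0) (s 1))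
  have hc' : c' ∈ Z F 𝒱 1 := mem_Z_one fun s => by
    simp only [c', resF_resF]
    exact hc (s 0) (s 1) (s 2) _ (inter_le 𝒱 s 0) (inter_le 𝒱 s 1) (inter_le 𝒱 s 2)
  obtain ⟨𝒲, h, b, hb⟩ := exists_of_mk_eq_zero_one (c := ⟨c', hc'⟩) (Subsingleton.elim _ _)
  refine ⟨𝒲, h, b, fun y z O hy hz => (hb y z O hy hz).trans ?_⟩
  exact resF_resF _ _ _

lemma exists_coboundary_two [Subsingleton (HLim F 2)] {𝒱 : PointedCover Y}
    (c : ∀ y z w, F.obj (op (𝒱.nhd y ⊓ (𝒱.nhd z ⊓ 𝒱.nhd w))))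
    (hc : ∀ (y z w v : Y) (O : Y.Opens) (hy : O ≤ 𝒱.nhd y) (hz : O ≤ 𝒱.nhd z) (hw : O ≤ 𝒱.nhd w)
      (hv : O ≤ 𝒱.nhd v),
      resF F (le_inf hz (le_inf hw hv)) (c z w v) - resF F (le_inf hy (le_inf hw hv)) (c y w v) +
        resF F (le_inf hy (le_inf hz hv)) (c y z v) -
        resF F (le_inf hy (le_inf hz hw)) (c y z w) = 0) :
    ∃ (𝒲 : PointedCover Y) (h : 𝒱 ≤ 𝒲) (b : ∀ y z, F.obj (op (𝒲.nhd y ⊓ 𝒲.nhd z))),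
      ∀ (y z w : Y) (O : Y.Opens) (hy : O ≤ 𝒲.nhd y) (hz : O ≤ 𝒲.nhd z) (hw : O ≤ 𝒲.nhd w),
        resF F (le_inf hz hw) (b z w) - resF F (le_inf hy hw) (b y w) +
          resF F (le_inf hy hz) (b y z) =
          resF F (le_inf (hy.trans (h y)) (le_inf (hz.trans (h z)) (hw.trans (h w))))
            (c y z w) := by
  let c' : Cochain F 𝒱 2 := fun s =>
    resF F (le_inf (inter_le 𝒱 s 0) (le_inf (inter_le 𝒱 s 1) (inter_le 𝒱 s 2)))
      (c (s 0) (s 1) (s 2))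
  have hc' : c' ∈ Z F 𝒱 2 := mem_Z_two fun s => by
    simp only [c', resF_resF]
    exact hc (s 0) (s 1) (s 2) (s 3) _ (inter_le 𝒱 s 0) (inter_le 𝒱 s 1) (inter_le 𝒱 s 2)
      (inter_le 𝒱 s 3)
  obtain ⟨𝒲, h, b, hb⟩ := exists_of_mk_eq_zero (c := ⟨c', hc'⟩) (Subsingleton.elim _ _)
  refine ⟨𝒲, h, fun y z => resF F (le_inter_two inf_le_left inf_le_right) (b ![y, z]),
    fun y z w O hy hz hw => ?_⟩
  have h1 := congrArg (resF F (le_inter_three hy hz hw)) (congrFun hb ![y, z, w])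
  rw [d_one_apply, map_add, map_sub] at h1
  simp only [resF_resF] at h1 ⊢
  rw [resF_cochain_congr b (s := ![y, z, w] ∘ Fin.succAbove 0) (t := ![z, w])
      (funext fun j => by fin_cases j <;> rfl) _ (le_inter_two hz hw),
    resF_cochain_congr b (s := ![y, z, w] ∘ Fin.succAbove 1) (t := ![y, w])
      (funext fun j => by fin_cases j <;> rfl) _ (le_inter_two hy hw),
    resF_cochain_congr b (s := ![y, z, w] ∘ Fin.succAbove 2) (t := ![y, z])
      (funext fun j => by fin_cases j <;> rfl) _ (le_inter_two hy hz)] at h1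
  refine h1.trans ?_
  refine (resF_resF _ _ _).trans ?_
  exact resF_resF _ _ _

end Cech

/-! ### Automorphisms of first order deformations -/

namespace Deformation

variable {k : Type u} [Field k] {X Y : Scheme.{u}} {sX : X ⟶ Spec (.of k)}
  {i : Y ⟶ X} {P : Bivector sX} {𝒜 : Quantization sX P} {E : Y.PresheafOfModules}
  [IsSheafOfModules E]

section Aut

variable (D : Deformation i 𝒜 E)

/-- The endomorphism `1 + ε f`. -/
def oneAddEps (f : LocalHom E E ⊤) : D.mod ⟶ D.mod :=
  homMk (D := D) (D' := D) (fun V => AddMonoidHom.id _ + (D.inc V).comp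
      ((happ f le_top).toAddMonoidHom.comp (D.proj V)))
    (fun V V' h s => by
      simp only [AddMonoidHom.add_apply, AddMonoidHom.comp_apply, LinearMap.toAddMonoidHom_coe,
        map_add, inc_res, AddMonoidHom.id_apply, DualModule.proj_resD,
        happ_resP f (le_top : i ⁻¹ᵁ V ≤ ⊤) h])
    (fun V a s => by
      simp only [AddMonoidHom.add_apply, AddMonoidHom.comp_apply, LinearMap.toAddMonoidHom_coe,
        AddMonoidHom.id_apply, smul_add, smul_inc, DualModule.proj_smul', map_smul])

lemma oneAddEps_apply (f : LocalHom E E ⊤) (V : X.Opens) (s : D.Sections V) :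
    homApp (D := D) (D' := D) (D.oneAddEps f) V s =
      s + D.inc V (happ f (le_top : i ⁻¹ᵁ V ≤ ⊤) (D.proj V s)) := rfl

/-- There is no cross term: 1 + εf does not change reductions, and only the reduction enters εg. -/
lemma oneAddEps_comp (f g : LocalHom E E ⊤) :
    D.oneAddEps f ≫ D.oneAddEps g = D.oneAddEps (f + g) := by
  refine hom_ext (D := D) (D' := D) fun V s => ?_
  change homApp (D := D) (D' := D) (D.oneAddEps g) V
    (homApp (D := D) (D' := D) (D.oneAddEps f) V s) = _
  rw [oneAddEps_apply, oneAddEps_apply, oneAddEps_apply, map_add (D.proj V), proj_inc, add_zero,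
    add_happ, map_add, add_assoc]

lemma oneAddEps_zero : D.oneAddEps 0 = 𝟙 _ := by
  refine hom_ext (D := D) (D' := D) fun V s => ?_
  rw [oneAddEps_apply]
  change s + D.inc V 0 = s
  rw [map_zero, add_zero]

/-- The automorphism `1 + ε f`. -/
def autOneAddEps (f : LocalHom E E ⊤) : D.autGroup where
  val :=
    { hom := D.oneAddEps f
      inv := D.oneAddEps (-f)
      hom_inv_id := by rw [oneAddEps_comp, add_neg_cancel, oneAddEps_zero]
      inv_hom_id := by rw [oneAddEps_comp, neg_add_cancel, oneAddEps_zero] }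
  property U s := by
    change D.proj U (homApp (D := D) (D' := D) (D.oneAddEps f) U s) = _
    rw [oneAddEps_apply, map_add, proj_inc, add_zero]

lemma autOneAddEps_add (f g : LocalHom E E ⊤) :
    D.autOneAddEps (f + g) = D.autOneAddEps f * D.autOneAddEps g := by
  refine Subtype.ext (Iso.ext ?_)
  -- Multiplication in `Aut` is composition in the opposite order, which is harmless as addition is
  -- commutative.
  change D.oneAddEps (f + g) = D.oneAddEps g ≫ D.oneAddEps f
  rw [oneAddEps_comp, add_comm]

/-- Every section of E lifts to D near each point, so a homomorphism is determined by its values on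
reductions. -/
lemma localHom_ext [IsClosedImmersion i] {T : Y.Opens} {f g : LocalHom E E T} {U : X.Opens}
    (hT : T ≤ i ⁻¹ᵁ U)
    (H : ∀ (V : X.Opens) (_ : V ≤ U) (hV : i ⁻¹ᵁ V ≤ T) (s : D.Sections V),
      happ f hV (D.proj V s) = happ g hV (D.proj V s)) : f = g := by
  refine happ_ext fun W hW m => ?_
  have hpre : i ⁻¹ᵁ (extOpen i W ⊓ U) = W := preimage_extOpen_inf (hW.trans hT)
  refine res_ext fun y hy => ?_
  obtain ⟨V, hV, hyV, t, ht⟩ := D.exists_proj_eq (DefQuant.res E hpre.le m) (x := i y)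
    (show y ∈ i ⁻¹ᵁ _ from hpre.ge hy)
  have hVW : i ⁻¹ᵁ V ≤ W := (preimage_le i hV).trans hpre.le
  refine ⟨i ⁻¹ᵁ V, hVW, hyV, ?_⟩
  have ht' : D.proj V t = DefQuant.res E hVW m := ht.trans (res_res E _ _ _)
  rw [← happ_res f hW hVW, ← happ_res g hW hVW, ← ht']
  exact H V (hV.trans inf_le_right) (hVW.trans hW) t

/-- Automorphisms that restrict to the identity modulo `ε` are given by endomorphisms of `E`. -/
lemma exists_autGroup_equiv [IsClosedImmersion i] :
    ∃ Φ : D.autGroup ≃* Multiplicative (LocalHom E E ⊤),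
      ∀ φ : D.autGroup, D.IsOneAddEps φ.1 (Φ φ).toAdd := by
  let Ψ : Multiplicative (LocalHom E E ⊤) →* D.autGroup :=
    MonoidHom.mk' (fun f => D.autOneAddEps f.toAdd) fun f g => D.autOneAddEps_add _ _
  have hΨ : Function.Bijective Ψ := by
    refine ⟨fun f g hfg => ?_, fun φ => ?_⟩
    · refine Multiplicative.toAdd.injective ?_
      refine D.localHom_ext (U := ⊤) (fun _ _ => trivial) fun V hV hV' s => ?_
      have h1 : D.oneAddEps f.toAdd = D.oneAddEps g.toAdd := congr(($hfg).1.hom)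
      have h2 := congr(homApp (D := D) (D' := D) $h1 V s)
      exact inc_injective V (add_left_cancel h2)
    -- Surjectivity: c is the difference between φ and the identity.
    · obtain ⟨c, hc⟩ := (LocalMor.ofHom (D := D) (D' := D) (𝟙 _) fun V s => rfl).exists_sub
        (LocalMor.ofHom φ.1.hom φ.2) (T := ⊤) (fun _ _ => trivial) (fun _ _ => trivial)
      refine ⟨Multiplicative.ofAdd c, Subtype.ext (Iso.ext ?_)⟩
      exact hom_ext (D := D) (D' := D) fun V s => (hc V le_top le_top le_top s).symm
  refine ⟨(MulEquiv.ofBijective Ψ hΨ).symm, fun φ => ?_⟩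
  obtain ⟨f, rfl⟩ := hΨ.2 φ
  have : (MulEquiv.ofBijective Ψ hΨ).symm (Ψ f) = f :=
    (MulEquiv.ofBijective Ψ hΨ).symm_apply_apply f
  rw [this]
  intro U s t ht
  change homApp (D := D) (D' := D) (D.oneAddEps f.toAdd) U s = _
  rw [oneAddEps_apply, ← inc_proj, ht]
  rfl

end Aut

/-! ### Deformations with the same normal part -/

section Iso

variable {D D' : Deformation i 𝒜 E}

/-- A transition between the actions of two deformations gives a local isomorphism. -/
def LocalMor.ofTrans {U U' : X.Opens} {τ : 𝒜.toDualAlgebra.Splitting P U}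
    {τ' : 𝒜.toDualAlgebra.Splitting P U'} (σ : D.Splitting τ) (σ' : D'.Splitting τ')
    (hU : U' ≤ U) {T : Y.Opens} (hT : i ⁻¹ᵁ U' ≤ T) (β : AddEnd E T)
    (hβ : IsTrans σ.act σ'.act β) : LocalMor D D' U' where
  toFun V h := AddMonoidHom.mk' (fun s => σ'.toFun V h (D.proj V s) + D'.inc V
    (σ.snd (h.trans hU) s + aapp β ((preimage_le i h).trans hT) (D.proj V s))) fun s t => by
      simp only [map_add, σ.snd_add]
      abel
  res V V' h h' s := by
    simp only [AddMonoidHom.mk'_apply, map_add, inc_res, DualModule.proj_resD,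
      aapp_resP β ((preimage_le i h).trans hT) h', ← σ'.res V V' h h',
      σ.snd_res (h.trans hU) h']
    rfl
  smul V h a s := by
    simp only [AddMonoidHom.mk'_apply]
    refine σ'.ext_snd h ?_ ?_
    · simp only [DualModule.proj_smul', map_add, proj_inc, σ'.proj_toFun, add_zero]
    · have := hβ V (h.trans hU) h ((preimage_le i h).trans hT) a (D.proj V s)
      simp only [σ'.snd_smul', σ'.snd_add, σ'.snd_toFun, snd_inc, DualModule.proj_smul', map_add,
        proj_inc, σ'.proj_toFun, map_zero, smul_zero, add_zero, zero_add, σ.snd_smul', smul_add,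
        this]
      abel
  proj V h s := by
    simp only [AddMonoidHom.mk'_apply, map_add, proj_inc, σ'.proj_toFun, add_zero]

/-- Deformations with the same `γ` are isomorphic if `H¹(Y, ℰnd(E)) = 0`. -/
lemma equiv_of_gam_eq [IsClosedImmersion i] (hE : IsVectorBundle E)
    [Subsingleton (Cech.HLim (endPresheaf E) 1)]
    (H : ∀ (V : X.Opens) (x : 𝒜.Sections V) (hx : 𝒜.redY i V x = 0) (e : SecP i E V),
      D'.gam hx e = D.gam hx e) : D ≈ D' := by
  -- Near a point of `Y` both deformations split and E has a frame, so equality of the γ's yields a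
  -- local isomorphism.
  have hloc : ∀ y : Y, ∃ U : X.Opens, i y ∈ U ∧ Nonempty (LocalMor D D' U) := fun y => by
    obtain ⟨T, hyT, n, s, hs⟩ := hE y
    obtain ⟨U, hUT, hyU, -, τ, ⟨σ⟩⟩ := D.exists_splitting_le (O := extOpen i T) (x := i y)
      (mem_extOpen.2 hyT)
    obtain ⟨U', hU', hyU', -, τ', ⟨σ'⟩⟩ := D'.exists_splitting_le hyU
    obtain ⟨β, hβ⟩ := (D.sameNormal_act H σ σ').exists_isTrans (T := i ⁻¹ᵁ U') (T' := T)
      (le_inf (preimage_le i hU') le_rfl)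
      ((preimage_le i (hU'.trans hUT)).trans (preimage_extOpen T).le) hs
    exact ⟨U', hyU', ⟨LocalMor.ofTrans σ σ' hU' le_rfl β hβ⟩⟩
  choose U hU ψ using hloc
  replace ψ := fun y => (ψ y).some
  let 𝒱 : PointedCover Y := ⟨fun y => i ⁻¹ᵁ U y, hU⟩
  -- The differences of the local isomorphisms form a 1-cocycle with values in ℰnd(E).
  choose c hc using fun y z => (ψ y).exists_sub (ψ z)
    (T := 𝒱.nhd y ⊓ 𝒱.nhd z) inf_le_left inf_le_right
  obtain ⟨𝒲, h𝒲, b, hb⟩ := Cech.exists_coboundary_one (F := endPresheaf E) (𝒱 := 𝒱) c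
    (fun y z w O hy hz hw => by
      let c₁ := LocalHom.restrict (le_inf hz hw) (c z w)
      let c₂ := LocalHom.restrict (le_inf hy hw) (c y w)
      let c₃ := LocalHom.restrict (le_inf hy hz) (c y z)
      change c₁ - c₂ + c₃ = 0
      refine D.localHom_ext (U := U y ⊓ (U z ⊓ U w))
        (fun x hx => ⟨hy hx, hz hx, hw hx⟩) fun V hV hVO s => inc_injective (D := D') V ?_
      have hVy := hV.trans inf_le_left
      have hVz := hV.trans (inf_le_right.trans inf_le_left)
      have hVw := hV.trans (inf_le_right.trans inf_le_right)
      have h1 := hc y z V hVy hVz (hVO.trans (le_inf hy hz)) s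
      have h2 := hc z w V hVz hVw (hVO.trans (le_inf hz hw)) s
      have h3 := hc y w V hVy hVw (hVO.trans (le_inf hy hw)) s
      rw [h1, h3, add_assoc] at h2
      have h4 := add_left_cancel h2
      change D'.inc V (happ (c z w) _ _ - happ (c y w) _ _ + happ (c y z) _ _) = D'.inc V 0
      rw [map_add, map_sub, h4, map_zero]
      abel)
  -- The refinement is a cover of `Y`; `extOpen` turns its members into open sets of `X`.
  let U' : Y → X.Opens := fun y => extOpen i (𝒲.nhd y) ⊓ U y
  have hU' : ∀ y, i y ∈ U' y := fun y => ⟨mem_extOpen.2 (𝒲.mem y), hU y⟩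
  have hTU : ∀ y, i ⁻¹ᵁ U' y ≤ 𝒲.nhd y := fun y =>
    (preimage_le i inf_le_left).trans (preimage_extOpen _).le
  let b' : ∀ y, LocalHom E E (𝒲.nhd y) := b
  -- Since c = b_z − b_y, the corrected morphisms ψ_y − εb_y agree on overlaps.
  obtain ⟨φ, hφ⟩ := LocalMor.exists_glue hU'
    (fun y => ((ψ y).restrict (inf_le_right : U' y ≤ U y)).add (hTU y) (-b' y))
    (fun y z V hy hz s => by
      have hVy := (preimage_le i hy).trans (hTU y)
      have hVz := (preimage_le i hz).trans (hTU z)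
      have h1 := hb y z (i ⁻¹ᵁ V) hVy hVz
      have h2 : happ (b' z) hVz (D.proj V s) - happ (b' y) hVy (D.proj V s) =
        happ (c y z) (le_inf (hVy.trans (h𝒲 y)) (hVz.trans (h𝒲 z))) (D.proj V s) :=
        congr(happ (T := i ⁻¹ᵁ V) $h1 le_rfl (D.proj V s))
      have h3 := hc y z V (hy.trans inf_le_right) (hz.trans inf_le_right)
        (le_inf (hVy.trans (h𝒲 y)) (hVz.trans (h𝒲 z))) s
      rw [← h2] at h3
      change (ψ y).toFun V _ s + D'.inc V (-happ (b' y) hVy (D.proj V s)) =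
        (ψ z).toFun V _ s + D'.inc V (-happ (b' z) hVz (D.proj V s))
      rw [h3, map_neg, map_neg, map_sub]
      abel)
  exact IsIdentityMod.equiv hφ

end Iso

end Deformation

/-! ### Deformations from local actions -/

section Existence

variable {k : Type u} [Field k] {X Y : Scheme.{u}} {sX : X ⟶ Spec (.of k)}
  {i : Y ⟶ X} [IsClosedImmersion i] {P : Bivector sX} {𝒜 : Quantization sX P}
  {E : Y.PresheafOfModules} [IsSheafOfModules E]

lemma GlueData.deformation_gam (G : GlueData i 𝒜.toDualAlgebra E)
    (τ : ∀ y, 𝒜.toDualAlgebra.Splitting P (G.U y)) (hG : ∀ y, (G.A y).IsBidifferential (τ y))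
    (y : Y) {V : X.Opens} (h : V ≤ G.U y) {x : 𝒜.Sections V} (hx : 𝒜.redY i V x = 0)
    (e : SecP i E V) : (G.deformation τ hG).gam hx e = (G.A y).toFun V h x e := by
  let σ : (G.deformation τ hG).Splitting ((τ y).restrict le_rfl) :=
    GlueData.splitting (G := G) y le_rfl ((τ y).restrict le_rfl) (hG y)
  rw [(G.deformation τ hG).gam_eq_act σ h hx]
  exact σ.snd_eq h (GlueData.smul_incl y h x e)

/-- Local actions with the same normal part come from a deformation if `H²(Y, ℰnd(E)) = 0`. -/
lemma exists_deformation_of_acts [Subsingleton (Cech.HLim (endPresheaf E) 2)] {U : Y → X.Opens}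
    (hU : ∀ y, i y ∈ U y) (A : ∀ y, Act i 𝒜.toDualAlgebra E (U y))
    (hA : ∀ y z, (A y).SameNormal (A z)) (τ : ∀ y, 𝒜.toDualAlgebra.Splitting P (U y))
    (hτ : ∀ y, (A y).IsBidifferential (τ y))
    (hT : ∀ y, ∃ (T : Y.Opens) (_ : i ⁻¹ᵁ U y ≤ T) (n : ℕ) (s : Fin n → Sec E T), IsFrame E s) :
    ∃ (D : Deformation i 𝒜 E) (U' : Y → X.Opens) (hU' : ∀ y, U' y ≤ U y), (∀ y, i y ∈ U' y) ∧
      ∀ (y : Y) (V : X.Opens) (h : V ≤ U' y) (x : 𝒜.Sections V) (hx : 𝒜.redY i V x = 0)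
        (e : SecP i E V), D.gam hx e = (A y).toFun V (h.trans (hU' y)) x e := by
  let 𝒱 : PointedCover Y := ⟨fun y => i ⁻¹ᵁ U y, hU⟩
  have hβ : ∀ y z, ∃ β : AddEnd E (𝒱.nhd y ⊓ 𝒱.nhd z), IsTrans (A y) (A z) β := fun y z => by
    obtain ⟨T, hT, n, s, hs⟩ := hT y
    exact (hA y z).exists_isTrans le_rfl (inf_le_left.trans hT) hs
  choose β hβ using hβ
  -- The failure of the transitions to satisfy the cocycle condition is 𝒪_Y-linear: in the
  -- alternating sum of the three intertwining relations the actions cancel. It is a 2-cocycle with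
  -- values in ℰnd(E).
  have hc : ∀ y z w, ∃ f : LocalHom E E (𝒱.nhd y ⊓ (𝒱.nhd z ⊓ 𝒱.nhd w)),
      ∀ (W : Y.Opens) (h : W ≤ 𝒱.nhd y ⊓ (𝒱.nhd z ⊓ 𝒱.nhd w)) (hzw : W ≤ 𝒱.nhd z ⊓ 𝒱.nhd w)
        (hyw : W ≤ 𝒱.nhd y ⊓ 𝒱.nhd w) (hyz : W ≤ 𝒱.nhd y ⊓ 𝒱.nhd z) (m : Sec E W),
        happ f h m = aapp (β z w) hzw m - aapp (β y w) hyw m + aapp (β y z) hyz m := by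
    intro y z w
    have hzw : 𝒱.nhd y ⊓ (𝒱.nhd z ⊓ 𝒱.nhd w) ≤ 𝒱.nhd z ⊓ 𝒱.nhd w := inf_le_right
    have hyw : 𝒱.nhd y ⊓ (𝒱.nhd z ⊓ 𝒱.nhd w) ≤ 𝒱.nhd y ⊓ 𝒱.nhd w :=
      inf_le_inf_left _ inf_le_right
    have hyz : 𝒱.nhd y ⊓ (𝒱.nhd z ⊓ 𝒱.nhd w) ≤ 𝒱.nhd y ⊓ 𝒱.nhd z :=
      inf_le_inf_left _ inf_le_left
    obtain ⟨f, hf⟩ := exists_localHom_of_linear 𝒜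
      (T := 𝒱.nhd y ⊓ (𝒱.nhd z ⊓ 𝒱.nhd w)) (U := U y ⊓ (U z ⊓ U w)) (fun x hx => hx)
      (restrictAddEnd (β z w) hzw - restrictAddEnd (β y w) hyw + restrictAddEnd (β y z) hyz)
      (fun V hV h a m => by
        have h1 := hβ y z V (hV.trans inf_le_left) (hV.trans (inf_le_right.trans inf_le_left))
          (h.trans hyz) a m
        have h2 := hβ z w V (hV.trans (inf_le_right.trans inf_le_left))
          (hV.trans (inf_le_right.trans inf_le_right)) (h.trans hzw) a m
        have h3 := hβ y w V (hV.trans inf_le_left) (hV.trans (inf_le_right.trans inf_le_right))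
          (h.trans hyw) a m
        rw [h1, h3, add_assoc] at h2
        have h4 := add_left_cancel h2
        simp only [aapp_add, aapp_sub, aapp_restrict, smul_add, smul_sub]
        rw [← sub_eq_zero] at h4 ⊢
        rw [← neg_eq_zero, ← h4]
        abel)
    exact ⟨f, fun W h _ _ _ m => hf W h m⟩
  choose f hf using hc
  obtain ⟨𝒲, h𝒲, b, hb⟩ := Cech.exists_coboundary_two (F := endPresheaf E) (𝒱 := 𝒱) f
    (fun y z w v O hy hz hw hv => by
      change LocalHom.restrict (le_inf hz (le_inf hw hv)) (f z w v) -
        LocalHom.restrict (le_inf hy (le_inf hw hv)) (f y w v) +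
        LocalHom.restrict (le_inf hy (le_inf hz hv)) (f y z v) -
        LocalHom.restrict (le_inf hy (le_inf hz hw)) (f y z w) = 0
      refine happ_ext fun W hW m => ?_
      change happ (f z w v) (hW.trans (le_inf hz (le_inf hw hv))) m -
        happ (f y w v) (hW.trans (le_inf hy (le_inf hw hv))) m +
        happ (f y z v) (hW.trans (le_inf hy (le_inf hz hv))) m -
        happ (f y z w) (hW.trans (le_inf hy (le_inf hz hw))) m = 0
      rw [hf z w v W _ (hW.trans (le_inf hw hv)) (hW.trans (le_inf hz hv)) (hW.trans (le_inf hz hw)),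
        hf y w v W _ (hW.trans (le_inf hw hv)) (hW.trans (le_inf hy hv)) (hW.trans (le_inf hy hw)),
        hf y z v W _ (hW.trans (le_inf hz hv)) (hW.trans (le_inf hy hv)) (hW.trans (le_inf hy hz)),
        hf y z w W _ (hW.trans (le_inf hz hw)) (hW.trans (le_inf hy hw)) (hW.trans (le_inf hy hz))]
      abel)
  let b' : ∀ y z, LocalHom E E (𝒲.nhd y ⊓ 𝒲.nhd z) := b
  let U' : Y → X.Opens := fun y => extOpen i (𝒲.nhd y) ⊓ U y
  have hU' : ∀ y, U' y ≤ U y := fun y => inf_le_right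
  have hUW : ∀ y, i ⁻¹ᵁ U' y ≤ 𝒲.nhd y := fun y =>
    (preimage_le i inf_le_left).trans (preimage_extOpen _).le
  let G : GlueData i 𝒜.toDualAlgebra E :=
    { U := U'
      mem := fun y => ⟨mem_extOpen.2 (𝒲.mem y), hU y⟩
      A := fun y => (A y).restrict (hU' y)
      -- Subtracting the linear map b_yz does not affect the intertwining relation and, as the
      -- coboundary of b is the defect, restores the cocycle condition.
      β := fun y z => restrictAddEnd (β y z)
          (inf_le_inf (preimage_le i (hU' y)) (preimage_le i (hU' z))) -
        restrictAddEnd (toAddEnd (b' y z)) (inf_le_inf (hUW y) (hUW z))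
      trans := fun y z V hy hz hV a e => by
        have h1 := hβ y z V (hy.trans (hU' y)) (hz.trans (hU' z)) (hV.trans
          (inf_le_inf (preimage_le i (hU' y)) (preimage_le i (hU' z)))) a e
        refine h1.trans ?_
        simp only [aapp_sub, aapp_restrict, aapp_toAddEnd, map_smul, smul_sub]
        change (A y).toFun V _ a e + _ = (A y).toFun V _ a e + _
        congr 1
        abel
      cocycle := fun y z w W hy hz hw e => by
        have hy' := hy.trans (hUW y)
        have hz' := hz.trans (hUW z)
        have hw' := hw.trans (hUW w)
        have h1 := hb y z w W hy' hz' hw'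
        have h2 : happ (b' z w) (le_inf hz' hw') e - happ (b' y w) (le_inf hy' hw') e +
            happ (b' y z) (le_inf hy' hz') e = happ (f y z w) (le_inf (hy'.trans (h𝒲 y))
              (le_inf (hz'.trans (h𝒲 z)) (hw'.trans (h𝒲 w)))) e :=
          congr(happ (T := W) $h1 le_rfl e)
        rw [hf y z w W _ (le_inf (hz'.trans (h𝒲 z)) (hw'.trans (h𝒲 w)))
          (le_inf (hy'.trans (h𝒲 y)) (hw'.trans (h𝒲 w)))
          (le_inf (hy'.trans (h𝒲 y)) (hz'.trans (h𝒲 z)))] at h2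
        simp only [aapp_sub, aapp_restrict, aapp_toAddEnd]
        rw [← sub_eq_zero] at h2 ⊢
        rw [← h2]
        abel }
  have hG : ∀ y, (G.A y).IsBidifferential ((τ y).restrict (hU' y)) := fun y => by
    obtain ⟨n, hn⟩ := hτ y
    exact ⟨n, fun V h => hn V (h.trans (hU' y))⟩
  exact ⟨G.deformation _ hG, U', hU', G.mem, fun y V h x hx e => G.deformation_gam _ hG y h hx e⟩

lemma exists_splitting_frame (D : Deformation i 𝒜 E) (hE : IsVectorBundle E) (y : Y) :
    ∃ U : X.Opens, i y ∈ U ∧ IsAffineOpen U ∧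
      (∃ (T : Y.Opens) (_ : i ⁻¹ᵁ U ≤ T) (n : ℕ) (s : Fin n → Sec E T), IsFrame E s) ∧
      ∃ τ : 𝒜.toDualAlgebra.Splitting P U, Nonempty (D.Splitting τ) := by
  obtain ⟨T, hyT, n, s, hs⟩ := hE y
  obtain ⟨U, hUT, hyU, hU, τ, hσ⟩ := D.exists_splitting_le (O := extOpen i T) (x := i y)
    (mem_extOpen.2 hyT)
  exact ⟨U, hyU, hU, ⟨T, (preimage_le i hUT).trans (preimage_extOpen T).le, n, s, hs⟩, τ, hσ⟩

lemma resP_ext_cover {U : Y → X.Opens} (hU : ∀ y, i y ∈ U y) {V : X.Opens} {e e' : SecP i E V}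
    (H : ∀ y V' (h : V' ≤ V) (_ : V' ≤ U y), resP i E h e = resP i E h e') : e = e' := by
  refine res_ext fun y hy => ?_
  exact ⟨i ⁻¹ᵁ (V ⊓ U y), preimage_le i inf_le_left, ⟨hy, hU y⟩, H y _ inf_le_left inf_le_right⟩

namespace Deformation

/-- The action of sections of `N(E)` on deformations of `E`. -/
lemma exists_isTranslate [Smooth sX] [Smooth (i ≫ sX)] (hE : IsVectorBundle E)
    [Subsingleton (Cech.HLim (endPresheaf E) 2)] (D : Deformation i 𝒜 E) (ζ : NormalEnd i E ⊤) :
    ∃ D' : Deformation i 𝒜 E, D.IsTranslate D' ζ := by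
  choose U hU hUa hT τ σ using exists_splitting_frame D hE
  replace σ := fun y => (σ y).some
  -- The extensions δ of ζ to all functions are chosen independently on each chart; the twisted
  -- actions need to agree only on their normal parts, which ζ itself determines.
  choose δ hδ using fun y => EndDerivation.exists_extension (sX := sX) (hUa y) (T := ⊤) le_top ζ
  have hact : ∀ y V (h : V ≤ U y) (x : 𝒜.Sections V) (hx : 𝒜.redY i V x = 0) (e : SecP i E V),
      ((σ y).act.twist (δ y)).toFun V h x e =
        D.gam hx e + napp ζ le_top ⟨𝒜.red V x, hx⟩ e := fun y V h x hx e => by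
    rw [Act.twist_apply, ← D.gam_eq_act (σ y) h hx]
    exact congrArg _ (hδ y V h ⟨𝒜.red V x, hx⟩ e)
  obtain ⟨D', U', hU', hyU', H⟩ := exists_deformation_of_acts hU
    (fun y => (σ y).act.twist (δ y))
    (fun y z V hy hz x e hx => by rw [hact y V hy x hx, hact z V hz x hx]) τ
    (fun y => (σ y).isBidifferential_act.twist (δ y)) hT
  refine ⟨D', isTranslate_iff.2 fun V x hx e => resP_ext_cover hyU' fun y V' h hy => ?_⟩
  rw [map_add, ← gam_res, ← gam_res, H y V' hy, hact y V' _ _ (redY_resA_eq_zero h hx), ← NormalEnd.app_res]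
  congr 2
  exact congrArg _ (Subtype.ext (DualAlgebra.red_resA _ _))

end Deformation

end Existence

/-! ### Differences of first order deformations -/

section Torsor

variable {k : Type u} [Field k] {X Y : Scheme.{u}} {sX : X ⟶ Spec (.of k)}
  {i : Y ⟶ X} {P : Bivector sX} {𝒜 : Quantization sX P}
  {E : Y.PresheafOfModules} [IsSheafOfModules E]

namespace Deformation

/-! ### Algebraic rules for γ -/

section Gam

variable (D : Deformation i 𝒜 E)

/-- Reduces identities for γ to the axioms of an action, near one point at a time. -/
lemma exists_gam_eq_act {V : X.Opens} {z : X} (hz : z ∈ V) :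
    ∃ (U : X.Opens) (h : U ≤ V), z ∈ U ∧ ∃ A : Act i 𝒜.toDualAlgebra E U,
      ∀ (x : 𝒜.Sections V) (hx : 𝒜.redY i V x = 0) (e : SecP i E V),
        resP i E h (D.gam hx e) = A.toFun U le_rfl (𝒜.resA h x) (resP i E h e) := by
  obtain ⟨U, hU, hzU, -, τ, ⟨σ⟩⟩ := D.exists_splitting_le hz
  refine ⟨U, hU, hzU, σ.act, fun x hx e => ?_⟩
  rw [← gam_res, D.gam_eq_act σ le_rfl]

lemma gam_add {V : X.Opens} {x : 𝒜.Sections V} (hx : 𝒜.redY i V x = 0) (e e' : SecP i E V) :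
    D.gam hx (e + e') = D.gam hx e + D.gam hx e' := by
  refine resP_ext fun z hz => ?_
  obtain ⟨U, hU, hzU, A, hA⟩ := D.exists_gam_eq_act hz
  exact ⟨U, hU, hzU, by simp only [map_add, hA]⟩

lemma add_gam {V : X.Opens} {x x' : 𝒜.Sections V} (hx : 𝒜.redY i V x = 0)
    (hx' : 𝒜.redY i V x' = 0) (h : 𝒜.redY i V (x + x') = 0) (e : SecP i E V) :
    D.gam h e = D.gam hx e + D.gam hx' e := by
  refine resP_ext fun z hz => ?_
  obtain ⟨U, hU, hzU, A, hA⟩ := D.exists_gam_eq_act hz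
  exact ⟨U, hU, hzU, by simp only [map_add, hA, AddMonoidHom.add_apply]⟩

lemma mul_gam {V : X.Opens} (a : 𝒜.Sections V) {x : 𝒜.Sections V} (hx : 𝒜.redY i V x = 0)
    (h : 𝒜.redY i V (a * x) = 0) (e : SecP i E V) :
    D.gam h e = 𝒜.redY i V a • D.gam hx e := by
  refine resP_ext fun z hz => ?_
  obtain ⟨U, hU, hzU, A, hA⟩ := D.exists_gam_eq_act hz
  refine ⟨U, hU, hzU, ?_⟩
  rw [resP_smul, hA, hA, map_mul, A.mul, DualAlgebra.redY_resA, redY_resA_eq_zero hU hx, zero_smul,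
    map_zero, add_zero]

lemma eps_gam {V : X.Opens} (a : 𝒜.Sections V) (h : 𝒜.redY i V (𝒜.eps V * a) = 0)
    (e : SecP i E V) : D.gam h e = 𝒜.redY i V a • e := by
  refine resP_ext fun z hz => ?_
  obtain ⟨U, hU, hzU, A, hA⟩ := D.exists_gam_eq_act hz
  refine ⟨U, hU, hzU, ?_⟩
  rw [resP_smul, hA, map_mul, DualAlgebra.resA_eps, A.eps, DualAlgebra.redY_resA]

/-- The Leibniz rule of a local action, carried over to γ. Its inhomogeneous term does not involve
the deformation, which is why differences of γ's are linear. -/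
lemma gam_smul [CharZero k] [IsClosedImmersion i] (hco : P.IsCoisotropic i) {V : X.Opens}
    {x : 𝒜.Sections V} (hx : 𝒜.redY i V x = 0) (b : Γ(Y, i ⁻¹ᵁ V)) (e : SecP i E V) :
    D.gam hx (b • e) = b • D.gam hx e +
      (P.p hco ⟨𝒜.red V x, hx⟩).1 ⟨i ⁻¹ᵁ V, le_rfl⟩ b • e := by
  refine resP_ext fun z hz => ?_
  obtain ⟨U, hU, hzU, -, τ, ⟨σ⟩⟩ := D.exists_splitting_le hz
  have hx' : 𝒜.red U (𝒜.resA hU x) ∈ idealSec i U := redY_resA_eq_zero hU hx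
  refine ⟨U, hU, hzU, ?_⟩
  have h1 := σ.act.smul_of_redY_eq_zero' hco le_rfl hx' (resOP i hU b) (resP i E hU e)
  have h2 : (P.p hco ⟨𝒜.red U (𝒜.resA hU x), hx'⟩).1 ⟨i ⁻¹ᵁ U, le_rfl⟩ (resOP i hU b) =
      resOP i hU ((P.p hco ⟨𝒜.red V x, hx⟩).1 ⟨i ⁻¹ᵁ V, le_rfl⟩ b) := by
    have h3 : (⟨𝒜.red U (𝒜.resA hU x), hx'⟩ : idealSec i U) = resI i hU ⟨𝒜.red V x, hx⟩ :=
      Subtype.ext (DualAlgebra.red_resA _ _)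
    rw [h3, P.p_res hco hU]
    exact (P.p hco ⟨𝒜.red V x, hx⟩).2.2.2 ⟨i ⁻¹ᵁ V, le_rfl⟩ ⟨i ⁻¹ᵁ U, preimage_le i hU⟩
      (preimage_le i hU) b
  rw [map_add, resP_smul, resP_smul, ← gam_res, ← gam_res, D.gam_eq_act σ le_rfl,
    D.gam_eq_act σ le_rfl, resP_smul, h1, h2]

end Gam

variable {D D' D'' : Deformation i 𝒜 E}

/-- The difference of the operators `γ` depends only on the reduction. -/
lemma gam_sub_congr {V : X.Opens} {x x' : 𝒜.Sections V} (hx : 𝒜.redY i V x = 0)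
    (hx' : 𝒜.redY i V x' = 0) (h : 𝒜.red V x = 𝒜.red V x') (e : SecP i E V) :
    D'.gam hx e - D.gam hx e = D'.gam hx' e - D.gam hx' e := by
  refine resP_ext fun z hz => ?_
  obtain ⟨U, hU, hzU, -, ⟨τ⟩⟩ := 𝒜.exists_splitting_le hz
  refine ⟨U, hU, hzU, ?_⟩
  obtain ⟨c, hc⟩ := τ.exists_eq le_rfl (𝒜.resA hU x - 𝒜.resA hU x')
  rw [map_sub, DualAlgebra.red_resA, DualAlgebra.red_resA, h, sub_self, map_zero, zero_add,
    sub_eq_iff_eq_add] at hc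
  have hy := redY_resA_eq_zero hU hx
  have hy' := redY_resA_eq_zero hU hx'
  -- Locally x and x' differ by some εc, and this changes γ by multiplication by c, the same for
  -- every deformation.
  have key : ∀ D : Deformation i 𝒜 E, D.gam hy (resP i E hU e) =
      𝒜.redY i U (τ.toFun U le_rfl c) • resP i E hU e + D.gam hy' (resP i E hU e) := fun D => by
    have h0 : 𝒜.redY i U (𝒜.eps U * τ.toFun U le_rfl c) = 0 := DualAlgebra.redY_eps_mul _
    rw [← D.eps_gam _ h0, ← D.add_gam h0 hy' (by rw [map_add, h0, hy', add_zero])]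
    congr 1
  simp only [map_sub, ← gam_res, key]
  abel

/-- A function vanishing on `Y` lifts to `𝒜` only locally, but the difference of the γ's does not
see the choice of lift, so its values glue. -/
lemma exists_normal_value (D D' : Deformation i 𝒜 E) {V : X.Opens} (x : idealSec i V)
    (e : SecP i E V) : ∃ g : SecP i E V, ∀ (V' : X.Opens) (h : V' ≤ V) (a : 𝒜.Sections V')
      (ha : 𝒜.redY i V' a = 0), 𝒜.red V' a = resO h x.1 →
        resP i E h g = D'.gam ha (resP i E h e) - D.gam ha (resP i E h e) := by
  obtain ⟨g, hg⟩ := resP_glue (i := i) (E := E) (V := V)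
    (fun V' h g => ∃ (a : 𝒜.Sections V') (ha : 𝒜.redY i V' a = 0), 𝒜.red V' a = resO h x.1 ∧
        g = D'.gam ha (resP i E h e) - D.gam ha (resP i E h e))
    (fun V' h g ⟨a, ha, hax, hg⟩ V'' h' => ⟨𝒜.resA h' a, redY_resA_eq_zero h' ha, by
        rw [DualAlgebra.red_resA, hax, resO_resO], by
        rw [hg, map_sub, ← gam_res, ← gam_res, resP_resP]⟩)
    (fun V' h g g' ⟨a, ha, hax, hg⟩ ⟨a', ha', hax', hg'⟩ => by
      rw [hg, hg', gam_sub_congr ha ha' (hax.trans hax'.symm)])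
    (fun z hz => by
      obtain ⟨V', h, hzV, a, ha⟩ := 𝒜.exists_red_eq x.1 hz
      refine ⟨V', h, hzV, _, a, ?_, ha, rfl⟩
      rw [DualAlgebra.redY_apply, ha, ← resOP_pull, mem_idealSec.1 x.2, map_zero])
  exact ⟨g, fun V' h a ha hax => hg V' h _ ⟨a, ha, hax, rfl⟩⟩

lemma exists_red_eq_ideal [IsClosedImmersion i] {V : X.Opens} (x : idealSec i V) {z : X} (hz : z ∈ V) :
    ∃ (V' : X.Opens) (h : V' ≤ V), z ∈ V' ∧ ∃ (a : 𝒜.Sections V') (_ : 𝒜.redY i V' a = 0),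
      𝒜.red V' a = resO h x.1 := by
  obtain ⟨V', h, hzV, a, ha⟩ := 𝒜.exists_red_eq x.1 hz
  exact ⟨V', h, hzV, a, by
    rw [DualAlgebra.redY_apply, ha, ← resOP_pull, mem_idealSec.1 x.2, map_zero], ha⟩

/-- Any two deformations differ by a section of `N(E)`. -/
lemma exists_isTranslate_of_pair [CharZero k] [IsClosedImmersion i] (hco : P.IsCoisotropic i)
    (D D' : Deformation i 𝒜 E) : ∃ ζ : NormalEnd i E ⊤, D.IsTranslate D' ζ := by
  choose g hg using fun (V : X.Opens) (x : idealSec i V) (e : SecP i E V) =>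
    exists_normal_value D D' x e
  have hres : ∀ (V V' : X.Opens) (h : V' ≤ V) (x : idealSec i V) (e : SecP i E V),
      g V' (resI i h x) (resP i E h e) = resP i E h (g V x e) := by
    intro V V' h x e
    refine resP_ext fun z hz => ?_
    obtain ⟨V₁, h₁, hz₁, a, ha, hax⟩ := exists_red_eq_ideal (𝒜 := 𝒜) (resI i h x) hz
    refine ⟨V₁, h₁, hz₁, ?_⟩
    rw [hg V' _ _ V₁ h₁ a ha hax, resP_resP, resP_resP]
    exact (hg V x e V₁ _ a ha (hax.trans (resO_resO _ _ _))).symm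
  have hval : ∀ (V : X.Opens) (x : 𝒜.Sections V) (hx : 𝒜.redY i V x = 0) (e : SecP i E V),
      g V ⟨𝒜.red V x, hx⟩ e = D'.gam hx e - D.gam hx e := by
    intro V x hx e
    have := hg V ⟨𝒜.red V x, hx⟩ e V le_rfl x hx (resO_self _ _).symm
    rwa [resP_self, resP_self] at this
  have hadd : ∀ (V : X.Opens) (x : idealSec i V) (e e' : SecP i E V),
      g V x (e + e') = g V x e + g V x e' := by
    intro V x e e'
    refine resP_ext fun z hz => ?_
    obtain ⟨V₁, h₁, hz₁, a, ha, hax⟩ := exists_red_eq_ideal (𝒜 := 𝒜) x hz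
    refine ⟨V₁, h₁, hz₁, ?_⟩
    rw [map_add, hg V x _ V₁ h₁ a ha hax, hg V x _ V₁ h₁ a ha hax, hg V x _ V₁ h₁ a ha hax,
      map_add, gam_add, gam_add]
    abel
  -- The terms p(x)(b)e of the two Leibniz rules cancel.
  have hsmul : ∀ (V : X.Opens) (x : idealSec i V) (b : Γ(Y, i ⁻¹ᵁ V)) (e : SecP i E V),
      g V x (b • e) = b • g V x e := by
    intro V x b e
    refine resP_ext fun z hz => ?_
    obtain ⟨V₁, h₁, hz₁, a, ha, hax⟩ := exists_red_eq_ideal (𝒜 := 𝒜) x hz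
    refine ⟨V₁, h₁, hz₁, ?_⟩
    rw [resP_smul, hg V x _ V₁ h₁ a ha hax, hg V x _ V₁ h₁ a ha hax, resP_smul, gam_smul D hco,
      gam_smul D' hco, smul_sub]
    abel
  have hadd' : ∀ (V : X.Opens) (x x' : idealSec i V) (e : SecP i E V),
      g V (x + x') e = g V x e + g V x' e := by
    intro V x x' e
    refine resP_ext fun z hz => ?_
    obtain ⟨V₁, h₁, hz₁, a, ha, hax⟩ := exists_red_eq_ideal (𝒜 := 𝒜) x hz
    obtain ⟨V₂, h₂, hz₂, a', ha', hax'⟩ := exists_red_eq_ideal (𝒜 := 𝒜) (resI i h₁ x') hz₁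
    refine ⟨V₂, h₂.trans h₁, hz₂, ?_⟩
    have hb := redY_resA_eq_zero h₂ ha
    have hbx : 𝒜.red V₂ (𝒜.resA h₂ a) = resO (h₂.trans h₁) x.1 := by
      rw [DualAlgebra.red_resA, hax, resO_resO]
    have hbx' : 𝒜.red V₂ a' = resO (h₂.trans h₁) x'.1 := hax'.trans (resO_resO _ _ _)
    have hs : 𝒜.redY i V₂ (𝒜.resA h₂ a + a') = 0 := by rw [map_add, hb, ha', add_zero]
    rw [map_add, hg V x _ V₂ _ _ hb hbx, hg V x' _ V₂ _ _ ha' hbx',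
      hg V (x + x') _ V₂ (h₂.trans h₁) _ hs (by
        rw [map_add, hbx, hbx']; exact (map_add (resO (h₂.trans h₁)) _ _).symm),
      add_gam _ hb ha', add_gam _ hb ha']
    abel
  have hmul : ∀ (V : X.Opens) (f : Γ(X, V)) (x : idealSec i V) (e : SecP i E V),
      g V (f • x) e = pull i V f • g V x e := by
    intro V f x e
    refine resP_ext fun z hz => ?_
    obtain ⟨V₁, h₁, hz₁, a, ha, hax⟩ := exists_red_eq_ideal (𝒜 := 𝒜) x hz
    obtain ⟨V₂, h₂, hz₂, b, hb⟩ := 𝒜.exists_red_eq (resO h₁ f) hz₁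
    refine ⟨V₂, h₂.trans h₁, hz₂, ?_⟩
    have hc := redY_resA_eq_zero h₂ ha
    have hcx : 𝒜.red V₂ (𝒜.resA h₂ a) = resO (h₂.trans h₁) x.1 := by
      rw [DualAlgebra.red_resA, hax, resO_resO]
    have hbf : 𝒜.redY i V₂ b = resOP i (h₂.trans h₁) (pull i V f) := by
      rw [DualAlgebra.redY_apply, hb, resO_resO, resOP_pull]
    have hs : 𝒜.redY i V₂ (b * 𝒜.resA h₂ a) = 0 := by rw [map_mul, hc, mul_zero]
    rw [resP_smul, hg V x _ V₂ _ _ hc hcx, hg V (f • x) _ V₂ (h₂.trans h₁) _ hs (by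
        rw [map_mul, hb, hcx, resO_resO]; exact (map_mul (resO (h₂.trans h₁)) _ _).symm),
      mul_gam _ _ hc, mul_gam _ _ hc, hbf, smul_sub]
  refine ⟨⟨fun U => AddMonoidHom.mk' (fun x =>
    { toFun := g U.1 x
      map_add' := hadd U.1 x
      map_smul' := hsmul U.1 x }) fun x x' => LinearMap.ext fun e => hadd' U.1 x x' e,
    fun U f x => LinearMap.ext fun e => hmul U.1 f x e, fun U U' h x e => hres U.1 U'.1 h x e⟩, ?_⟩
  refine isTranslate_iff.2 fun V x hx e => ?_
  refine Eq.trans ?_ (congrArg _ (hval V x hx e).symm)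
  rw [add_sub_cancel]

lemma IsTranslate.unique [IsClosedImmersion i] {ζ ζ' : NormalEnd i E ⊤} (h : D.IsTranslate D' ζ)
    (h' : D.IsTranslate D' ζ') : ζ = ζ' := by
  rw [isTranslate_iff] at h h'
  refine NormalEnd.ext fun V hV x e => resP_ext fun z hz => ?_
  obtain ⟨V', hV', hzV, a, ha, hax⟩ := exists_red_eq_ideal (𝒜 := 𝒜) x hz
  refine ⟨V', hV', hzV, ?_⟩
  have hx : resI i hV' x = ⟨𝒜.red V' a, ha⟩ := Subtype.ext hax.symm
  rw [← NormalEnd.app_res, ← NormalEnd.app_res, hx]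
  exact add_left_cancel ((h V' a ha (resP i E hV' e)).symm.trans (h' V' a ha (resP i E hV' e)))

lemma IsTranslate.trans {ζ ζ' : NormalEnd i E ⊤} (h : D.IsTranslate D' ζ)
    (h' : D'.IsTranslate D'' ζ') : D.IsTranslate D'' (ζ' + ζ) := by
  rw [isTranslate_iff] at h h' ⊢
  intro V x hx e
  rw [h', h, NormalEnd.add_app]
  abel

lemma isTranslate_zero_iff : D.IsTranslate D' 0 ↔
    ∀ (V : X.Opens) (x : 𝒜.Sections V) (hx : 𝒜.redY i V x = 0) (e : SecP i E V),
      D'.gam hx e = D.gam hx e := by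
  rw [isTranslate_iff]
  have : ∀ (V : X.Opens) (x : idealSec i V) (e : SecP i E V),
    napp (0 : NormalEnd i E ⊤) le_top x e = 0 := fun _ _ _ => rfl
  simp only [this, add_zero]

/-- An isomorphism is `𝒜`-linear and is the identity both on εE and modulo ε, so it carries the
relation xs = εt to the same relation. -/
lemma isTranslate_of_equiv (h : D ≈ D') : D.IsTranslate D' 0 := by
  obtain ⟨φ, hφ⟩ := h
  refine isTranslate_zero_iff.2 fun V x hx e => resP_ext fun z hz => ?_
  obtain ⟨V', hV', hzV, t, ht⟩ := D.exists_proj_eq e hz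
  refine ⟨V', hV', hzV, inc_injective (D := D') V' ?_⟩
  have h1 := D.gam_spec hV' hx ht
  have h2 : homApp (D := D) (D' := D') φ.hom V' (𝒜.resA hV' x • t) =
      𝒜.resA hV' x • homApp (D := D) (D' := D') φ.hom V' t := map_smul _ _ _
  rw [h1, D'.gam_spec hV' hx (t := homApp (D := D) (D' := D') φ.hom V' t)
    ((hφ V' t).trans ht)] at h2
  exact h2.symm.trans ((LocalMor.ofHom φ.hom hφ).map_inc le_top _)

/-- The isomorphism classes of deformations are a torsor, if there are any. -/
lemma exists_addTorsor [CharZero k] [Smooth sX] [IsClosedImmersion i] [Smooth (i ≫ sX)]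
    (hco : P.IsCoisotropic i) (hE : IsVectorBundle E)
    [Subsingleton (Cech.HLim (endPresheaf E) 1)] [Subsingleton (Cech.HLim (endPresheaf E) 2)]
    [Nonempty (Deformation i 𝒜 E)] :
    ∃ _ : AddTorsor (NormalEnd i E ⊤) (IsoClasses i 𝒜 E),
      ∀ (D D' : Deformation i 𝒜 E) (ζ : NormalEnd i E ⊤),
        ζ +ᵥ D.isoClass = D'.isoClass ↔ D.IsTranslate D' ζ := by
  have hequiv : ∀ {D D' : Deformation i 𝒜 E}, D.IsTranslate D' 0 → D ≈ D' := fun h =>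
    equiv_of_gam_eq hE (isTranslate_zero_iff.1 h)
  choose act hact using fun (ζ : NormalEnd i E ⊤) (D : Deformation i 𝒜 E) =>
    exists_isTranslate hE D ζ
  choose diff hdiff using fun D D' : Deformation i 𝒜 E => exists_isTranslate_of_pair hco D' D
  -- If D₁ and D₂ are both translates of D by ζ and differ from each other by ξ, then ξ + ζ = ζ, so
  -- ξ = 0. Thus the class of a translate depends only on ζ and D.
  have hclass : ∀ {D D₁ D₂ : Deformation i 𝒜 E} {ζ : NormalEnd i E ⊤}, D.IsTranslate D₁ ζ →
      D.IsTranslate D₂ ζ → D₁ ≈ D₂ := by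
    intro D D₁ D₂ ζ h₁ h₂
    refine hequiv ?_
    have h3 := h₁.trans (hdiff D₂ D₁)
    have h4 := h3.unique h₂
    rw [add_eq_right] at h4
    rw [← h4]
    exact hdiff D₂ D₁
  -- Isomorphic deformations are translates by 0, so being a translate by ζ is a relation between
  -- isomorphism classes.
  have htrans : ∀ {D₁ D₁' D₂ D₂' : Deformation i 𝒜 E} {ζ : NormalEnd i E ⊤}, D₁ ≈ D₁' → D₂ ≈ D₂' →
      D₁.IsTranslate D₂ ζ → D₁'.IsTranslate D₂' ζ := by
    intro D₁ D₁' D₂ D₂' ζ h₁ h₂ h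
    have := ((isTranslate_of_equiv (Setoid.symm h₁)).trans h).trans (isTranslate_of_equiv h₂)
    rwa [add_zero, zero_add] at this
  let vadd : NormalEnd i E ⊤ → IsoClasses i 𝒜 E → IsoClasses i 𝒜 E := fun ζ =>
    Quotient.lift (fun D => (act ζ D).isoClass) fun D D' h =>
      Quotient.sound (hclass (hact ζ D) (htrans (Setoid.symm h) (Setoid.refl _) (hact ζ D')))
  let vsub : IsoClasses i 𝒜 E → IsoClasses i 𝒜 E → NormalEnd i E ⊤ :=
    Quotient.lift₂ diff fun D₁ D₂ D₁' D₂' h₁ h₂ =>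
      (htrans h₂ h₁ (hdiff D₁ D₂)).unique (hdiff D₁' D₂')
  have hvadd : ∀ (D D' : Deformation i 𝒜 E) (ζ : NormalEnd i E ⊤),
      vadd ζ D.isoClass = D'.isoClass ↔ D.IsTranslate D' ζ := fun D D' ζ =>
    ⟨fun h => htrans (Setoid.refl D) (Quotient.exact h) (hact ζ D),
      fun h => Quotient.sound (hclass (hact ζ D) h)⟩
  refine ⟨{ vadd := vadd
            zero_vadd := by
              rintro ⟨D⟩
              exact (hvadd D D 0).2 (isTranslate_of_equiv (Setoid.refl D))
            add_vadd := by
              rintro ζ ζ' ⟨D⟩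
              exact (hvadd D (act ζ (act ζ' D)) (ζ + ζ')).2 ((hact ζ' D).trans (hact ζ _))
            vsub := vsub
            nonempty := ⟨(Classical.arbitrary (Deformation i 𝒜 E)).isoClass⟩
            vsub_vadd' := by
              rintro ⟨D⟩ ⟨D'⟩
              exact (hvadd D' D _).2 (hdiff D D')
            vadd_vsub' := by
              rintro ζ ⟨D⟩
              exact (hdiff (act ζ D) D).unique (hact ζ D) }, hvadd⟩

end Deformation

end Torsor

/-! ### Homomorphisms from a line bundle -/

section HomModule

variable {Y : Scheme.{u}} {L E : Y.PresheafOfModules}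

/-- Evaluation of sections of `ℋom(L, E)`. -/
def evalHom {V : Y.Opens} (m : Sec (homModule L E) V) : Sec L V →ₗ[Γ(Y, V)] Sec E V :=
  happ (T := V) (show LocalHom L E V from m) le_rfl

lemma evalHom_add {V : Y.Opens} (m m' : Sec (homModule L E) V) (l : Sec L V) :
    evalHom (m + m') l = evalHom m l + evalHom m' l := rfl

lemma evalHom_smul {V : Y.Opens} (b : Γ(Y, V)) (m : Sec (homModule L E) V) (l : Sec L V) :
    evalHom (b • m) l = b • evalHom m l := by
  change resO le_rfl b • evalHom m l = _
  rw [resO_self]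

lemma evalHom_res {V V' : Y.Opens} (h : V' ≤ V) (m : Sec (homModule L E) V) (l : Sec L V) :
    evalHom (res (homModule L E) h m) (res L h l) = res E h (evalHom m l) :=
  happ_res (T := V) (show LocalHom L E V from m) le_rfl h l

variable {T : Y.Opens} {l : Fin 1 → Sec L T}

lemma IsFrame.eq_coord_smul (hl : IsFrame L l) {W : Y.Opens} (h : W ≤ T) (l' : Sec L W) :
    l' = hl.coord h l' 0 • res L h (l 0) := by
  conv_lhs => rw [hl.eq_sum h l', Fin.sum_univ_one]

lemma IsFrame.coord_self (hl : IsFrame L l) {W : Y.Opens} (h : W ≤ T) :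
    hl.coord h (res L h (l 0)) 0 = 1 := by
  rw [hl.coord_eq h (c := fun _ => 1) (by rw [Fin.sum_univ_one, one_smul])]

/-- Homomorphisms from `L` are determined by their value on a frame. -/
lemma evalHom_ext (hl : IsFrame L l) {W : Y.Opens} (h : W ≤ T) {m m' : Sec (homModule L E) W}
    (H : evalHom m (res L h (l 0)) = evalHom m' (res L h (l 0))) : m = m' := by
  refine happ_ext (f := (show LocalHom L E W from m)) (g := (show LocalHom L E W from m'))
    fun Z hZ l' => ?_
  have key : ∀ m : LocalHom L E W, happ m hZ l' =
      hl.coord (hZ.trans h) l' 0 • res E hZ (happ m le_rfl (res L h (l 0))) := fun m => by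
    rw [← happ_res m le_rfl hZ, res_res, ← map_smul, ← hl.eq_coord_smul]
  rw [key, key]
  exact congrArg _ (congrArg _ H)

/-- The homomorphism from `L` with a given value on a frame. -/
def homTo (hl : IsFrame L l) {W : Y.Opens} (h : W ≤ T) (e : Sec E W) : Sec (homModule L E) W :=
  show LocalHom L E W from
  ⟨fun Z =>
    { toFun := fun m => hl.coord (Z.2.trans h) m 0 • res E Z.2 e
      map_add' := fun m m' => by rw [hl.coord_add, Pi.add_apply, add_smul]
      map_smul' := fun b m => by
        rw [hl.coord_smul, Pi.smul_apply, smul_eq_mul, mul_smul, RingHom.id_apply] },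
    fun Z Z' h' m => by
      change hl.coord _ (res L h' m) 0 • res E Z'.2 e =
        res E h' (hl.coord _ m 0 • res E Z.2 e)
      rw [hl.coord_res (Z.2.trans h) h' m, res_smul, res_res]⟩

lemma evalHom_homTo (hl : IsFrame L l) {W : Y.Opens} (h : W ≤ T) (e : Sec E W) (l' : Sec L W) :
    evalHom (homTo hl h e) l' = hl.coord h l' 0 • e := by
  change hl.coord h l' 0 • res E le_rfl e = _
  rw [res_self]

lemma evalHom_homTo_self (hl : IsFrame L l) {W : Y.Opens} (h : W ≤ T) (e : Sec E W) :
    evalHom (homTo hl h e) (res L h (l 0)) = e := by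
  rw [evalHom_homTo, hl.coord_self, one_smul]

lemma homTo_add (hl : IsFrame L l) {W : Y.Opens} (h : W ≤ T) (e e' : Sec E W) :
    homTo hl h (e + e') = homTo hl h e + homTo hl h e' :=
  evalHom_ext hl h (by rw [evalHom_add, evalHom_homTo_self, evalHom_homTo_self, evalHom_homTo_self])

lemma homTo_smul (hl : IsFrame L l) {W : Y.Opens} (h : W ≤ T) (b : Γ(Y, W)) (e : Sec E W) :
    homTo hl h (b • e) = b • homTo hl h e :=
  evalHom_ext hl h (by rw [evalHom_smul, evalHom_homTo_self, evalHom_homTo_self])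

lemma homTo_res (hl : IsFrame L l) {W W' : Y.Opens} (h : W ≤ T) (h' : W' ≤ W) (e : Sec E W) :
    homTo hl (h'.trans h) (res E h' e) = res (homModule L E) h' (homTo hl h e) :=
  evalHom_ext hl (h'.trans h) (by
    rw [evalHom_homTo_self, ← res_res L h h', evalHom_res, evalHom_homTo_self])

end HomModule

/-! ### Connections along the conormal bundle -/

section NormalConnection

variable {k : Type u} [Field k] {X Y : Scheme.{u}} {sX : X ⟶ Spec (.of k)}
  {P : Bivector sX} {i : Y ⟶ X} [IsClosedImmersion i]

/-- Covariant derivatives on `M|_T` along sections of `I_Y`, which act on functions through `p`. -/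
structure NormalConnection (hco : P.IsCoisotropic i) (M : Y.PresheafOfModules) (T : Y.Opens) where
  /-- the covariant derivative -/
  toFun : ∀ V : X.Opens, i ⁻¹ᵁ V ≤ T → idealSec i V →+ SecP i M V →+ SecP i M V
  smul : ∀ V h (f : Γ(X, V)) x m, toFun V h (f • x) m = pull i V f • toFun V h x m
  leibniz : ∀ V h x (b : Γ(Y, i ⁻¹ᵁ V)) m, toFun V h x (b • m) =
    b • toFun V h x m + (P.p hco x).1 ⟨i ⁻¹ᵁ V, le_rfl⟩ b • m
  res : ∀ V V' h (h' : V' ≤ V) x m, toFun V' ((preimage_le i h').trans h) (resI i h' x)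
    (resP i M h' m) = resP i M h' (toFun V h x m)

/-- The value of a connection. -/
def capp {sY : Y ⟶ Spec (.of k)} {M : Y.PresheafOfModules} {T W : Y.Opens}
    (C : Connection sY M T) (h : W ≤ T) : Tangent sY W →+ Sec M W →+ Sec M W :=
  C.toFun ⟨W, h⟩

section

variable {sY : Y ⟶ Spec (.of k)} {M : Y.PresheafOfModules} {T W : Y.Opens}
  (C : Connection sY M T) (h : W ≤ T) (θ : Tangent sY W) (m : Sec M W)

lemma capp_smul (b : Γ(Y, W)) : capp C h (b • θ) m = b • capp C h θ m :=
  C.smul ⟨W, h⟩ b θ m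

lemma capp_leibniz (b : Γ(Y, W)) :
    capp C h θ (b • m) = b • capp C h θ m + θ.1 ⟨W, le_rfl⟩ b • m :=
  C.leibniz ⟨W, h⟩ θ b m

lemma capp_res {W' : Y.Opens} (h' : W' ≤ W) :
    capp C (h'.trans h) (Tangent.restrict h' θ) (res M h' m) = res M h' (capp C h θ m) :=
  C.res ⟨W, h⟩ ⟨W', h'.trans h⟩ h' θ m

end

namespace NormalConnection

variable {hco : P.IsCoisotropic i}

/-- Restriction to a smaller open set. -/
def restrict {M : Y.PresheafOfModules} {T T' : Y.Opens} (C : NormalConnection hco M T)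
    (hT : T' ≤ T) : NormalConnection hco M T' where
  toFun V h := C.toFun V (h.trans hT)
  smul V h := C.smul V (h.trans hT)
  leibniz V h := C.leibniz V (h.trans hT)
  res V V' h := C.res V V' (h.trans hT)

/-- The operator `m ↦ ∇_{p(x)} m - ν(x) m`. -/
def ofConnection {M : Y.PresheafOfModules} {T T' : Y.Opens} (C : Connection (i ≫ sX) M T)
    (hT : T' ≤ T) (ν : NormalEnd i M T') : NormalConnection hco M T' where
  toFun V h := AddMonoidHom.mk' (fun x => AddMonoidHom.mk' (fun m =>
    capp C (h.trans hT) (P.p hco x) m - napp ν h x m) fun m m' => by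
      rw [map_add, map_add, add_sub_add_comm]) fun x x' => by
      ext m
      simp only [AddMonoidHom.mk'_apply, AddMonoidHom.add_apply, P.p_add, map_add,
        LinearMap.add_apply, add_sub_add_comm]
  smul V h f x m := by
    simp only [AddMonoidHom.mk'_apply, P.p_smul, capp_smul, NormalEnd.app_smul, smul_sub]
  leibniz V h x b m := by
    simp only [AddMonoidHom.mk'_apply, capp_leibniz, map_smul, smul_sub]
    abel
  res V V' h h' x m := by
    simp only [AddMonoidHom.mk'_apply, P.p_res, map_sub]
    exact congrArg₂ (fun a b : SecP i M V' => a - b)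
      (capp_res C (h.trans hT) (P.p hco x) m (preimage_le i h')) (NormalEnd.app_res ν h h' x m)

/-- On a refinement p^*(∇_z − ∇_y) = ν_z − ν_y with local sections ν of N(M), so the operators
∇_{p(x)} − ν(x) agree on overlaps. Only these conormal derivatives are made to agree, not the
connections themselves. -/
lemma exists_of_atiyahClassN_eq_zero {M : Y.PresheafOfModules} {hM : IsVectorBundle M}
    (h : atiyahClassN hco hM = 0) : ∃ (𝒲 : PointedCover Y)
      (C : ∀ y, NormalConnection hco M (𝒲.nhd y)),
      ∀ (y z : Y) (V : X.Opens) (hy : i ⁻¹ᵁ V ≤ 𝒲.nhd y) (hz : i ⁻¹ᵁ V ≤ 𝒲.nhd z)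
        (x : idealSec i V) (m : SecP i M V), (C y).toFun V hy x m = (C z).toFun V hz x m := by
  let C := (exists_localConnections (i ≫ sX) hM).some
  have h0 : Cech.map (Bivector.pStar hco M) 1 (Cech.mk C.cover C.cocycle) = 0 := h
  rw [Cech.map_mk] at h0
  obtain ⟨𝒲, hle, ν, hν⟩ := Cech.exists_of_mk_eq_zero_one h0
  let ν' : ∀ y, NormalEnd i M (𝒲.nhd y) := ν
  refine ⟨𝒲, fun y => ofConnection (C.conn y) (hle y) (ν' y), fun y z V hy hz x m => ?_⟩
  have h1 := hν y z (i ⁻¹ᵁ V) hy hz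
  have h2 : napp (ν' z) hz x m - napp (ν' y) hy x m =
      capp (C.conn z) (hz.trans (hle z)) (P.p hco x) m -
        capp (C.conn y) (hy.trans (hle y)) (P.p hco x) m :=
    congr(napp (i := i) (T := i ⁻¹ᵁ V) $h1 le_rfl x m)
  change capp (C.conn y) (hy.trans (hle y)) (P.p hco x) m - napp (ν' y) hy x m =
    capp (C.conn z) (hz.trans (hle z)) (P.p hco x) m - napp (ν' z) hz x m
  rw [sub_eq_sub_iff_sub_eq_sub, ← neg_sub (capp (C.conn z) _ _ _), ← h2, neg_sub]

variable {L E : Y.PresheafOfModules} {T : Y.Opens}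

/-- The section of `N(E)` given by the derivatives of the frame of `ℋom(L, E)` that corresponds to
frames of `L` and `E`. -/
def toNormalEnd (C : NormalConnection hco (homModule L E) T) {l : Fin 1 → Sec L T}
    (hl : IsFrame L l) {n : ℕ} {s : Fin n → Sec E T} (hs : IsFrame E s) : NormalEnd i E T :=
  ⟨fun V => AddMonoidHom.mk' (fun x =>
    { toFun := fun e => ∑ j, hs.coord V.2 e j • evalHom (C.toFun V.1 V.2 x
        (homTo hl V.2 (DefQuant.res E V.2 (s j)))) (DefQuant.res L V.2 (l 0))
      map_add' := fun e e' => by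
        simp only [hs.coord_add, Pi.add_apply, add_smul, Finset.sum_add_distrib]
      map_smul' := fun b e => by
        simp only [hs.coord_smul, Pi.smul_apply, smul_eq_mul, mul_smul, Finset.smul_sum,
          RingHom.id_apply] }) fun x x' => LinearMap.ext fun e => by
      simp only [LinearMap.coe_mk, AddHom.coe_mk, LinearMap.add_apply, map_add,
        AddMonoidHom.add_apply, evalHom_add, smul_add, Finset.sum_add_distrib],
    fun V f x => LinearMap.ext fun e => by
      simp only [AddMonoidHom.mk'_apply, LinearMap.coe_mk, AddHom.coe_mk, LinearMap.smul_apply,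
        C.smul, evalHom_smul, Finset.smul_sum]
      exact Finset.sum_congr rfl fun j _ => smul_comm _ _ _,
    fun V V' h x e => by
      simp only [AddMonoidHom.mk'_apply, LinearMap.coe_mk, AddHom.coe_mk, map_sum, res_smul,
        ← evalHom_res]
      refine Finset.sum_congr rfl fun j _ => ?_
      rw [hs.coord_res V.2 (preimage_le i h) e, ← res_res E V.2 (preimage_le i h),
        homTo_res hl V.2 (preimage_le i h), ← res_res L V.2 (preimage_le i h)]
      congr 2
      exact congrArg evalHom (C.res V.1 V'.1 V.2 h x _)⟩

lemma toNormalEnd_apply (C : NormalConnection hco (homModule L E) T) {l : Fin 1 → Sec L T}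
    (hl : IsFrame L l) {n : ℕ} {s : Fin n → Sec E T} (hs : IsFrame E s) {V : X.Opens}
    (h : i ⁻¹ᵁ V ≤ T) (x : idealSec i V) (e : SecP i E V) :
    napp (C.toNormalEnd hl hs) h x e = ∑ j, hs.coord h e j • evalHom (C.toFun V h x
        (homTo hl h (DefQuant.res E h (s j)))) (DefQuant.res L h (l 0)) := rfl

end NormalConnection

end NormalConnection

/-! ### Existence of deformations -/

section AtiyahExistence

variable {k : Type u} [Field k] [CharZero k] {X Y : Scheme.{u}} {sX : X ⟶ Spec (.of k)}
  {P : Bivector sX} {i : Y ⟶ X} [IsClosedImmersion i] {hco : P.IsCoisotropic i}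
  {𝒜 : Quantization sX P} {L E : Y.PresheafOfModules} [IsSheafOfModules L] [IsSheafOfModules E]
  {T : Y.Opens}

/-- The sum of a connection on `ℋom(L, E)` and the operator `γ` of a deformation of `L`. -/
def gamHom (C : NormalConnection hco (homModule L E) T) (D : Deformation i 𝒜 L) {V : X.Opens}
    (h : i ⁻¹ᵁ V ≤ T) {x : 𝒜.Sections V} (hx : 𝒜.redY i V x = 0) (m : SecP i (homModule L E) V)
    (l : SecP i L V) : SecP i E V :=
  evalHom (C.toFun V h ⟨𝒜.red V x, hx⟩ m) l + evalHom m (D.gam hx l)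

variable (C : NormalConnection hco (homModule L E) T) (D : Deformation i 𝒜 L) {V : X.Opens}
    (h : i ⁻¹ᵁ V ≤ T) {x : 𝒜.Sections V} (hx : 𝒜.redY i V x = 0)

lemma gamHom_add (m m' : SecP i (homModule L E) V) (l : SecP i L V) :
    gamHom C D h hx (m + m') l = gamHom C D h hx m l + gamHom C D h hx m' l := by
  simp only [gamHom, map_add, evalHom_add]
  abel

lemma gamHom_smul (b : Γ(Y, i ⁻¹ᵁ V)) (m : SecP i (homModule L E) V) (l : SecP i L V) :
    gamHom C D h hx (b • m) l = b • gamHom C D h hx m l +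
      (P.p hco ⟨𝒜.red V x, hx⟩).1 ⟨i ⁻¹ᵁ V, le_rfl⟩ b • evalHom m l := by
  simp only [gamHom, C.leibniz, evalHom_add, evalHom_smul, smul_add]
  abel

/-- Both sides contain p(x)(b)·m(l) exactly once: on the left it comes from γ of L, on the right
from the connection. So the expression is balanced over 𝒪_Y and, L being a line bundle, depends only
on m(l); this is the γ prescribed on E. -/
lemma gamHom_smul_right (b : Γ(Y, i ⁻¹ᵁ V)) (m : SecP i (homModule L E) V) (l : SecP i L V) :
    gamHom C D h hx m (b • l) = gamHom C D h hx (b • m) l := by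
  rw [gamHom_smul]
  simp only [gamHom, D.gam_smul hco, map_add, map_smul, smul_add]
  abel

/-- An action on `E` whose normal part is induced by a connection on `ℋom(L, E)` and a
deformation of `L`. -/
lemma exists_act_gamHom [Smooth sX] [Smooth (i ≫ sX)] {U : X.Opens} (hU : IsAffineOpen U)
    {τ : 𝒜.toDualAlgebra.Splitting P U} (σ : D.Splitting τ) (hT : i ⁻¹ᵁ U ≤ T)
    {l : Fin 1 → Sec L T} (hl : IsFrame L l) {n : ℕ} {s : Fin n → Sec E T} (hs : IsFrame E s) :
    ∃ A : Act i 𝒜.toDualAlgebra E U, A.IsBidifferential τ ∧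
      ∀ (V : X.Opens) (h : V ≤ U) (x : 𝒜.Sections V) (hx : 𝒜.redY i V x = 0) (e : SecP i E V),
        A.toFun V h x e = gamHom C D ((preimage_le i h).trans hT) hx
          (homTo hl ((preimage_le i h).trans hT) e)
          (DefQuant.res L ((preimage_le i h).trans hT) (l 0)) := by
  -- Transport along the frames accounts for the term with γ of L on each frame element; the
  -- derivatives of the corresponding frame of ℋom(L, E) are supplied by the twist.
  obtain ⟨δ, hδ⟩ := EndDerivation.exists_extension (sX := sX) hU hT (C.toNormalEnd hl hs)
  refine ⟨(σ.act.ofFrames hT hl hs).twist δ, (σ.isBidifferential_act.ofFrames hT hl hs).twist δ,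
    fun V h x hx e => ?_⟩
  let hV := (preimage_le i h).trans hT
  let A := (σ.act.ofFrames hT hl hs).twist δ
  have hframe : ∀ j, A.toFun V h x (DefQuant.res E hV (s j)) =
      gamHom C D hV hx (homTo hl hV (DefQuant.res E hV (s j))) (DefQuant.res L hV (l 0)) := by
    intro j
    have hcoord : hs.coord hV (DefQuant.res E hV (s j)) = Pi.single j 1 :=
      hs.coord_eq hV (by simp [Pi.single_apply, ite_smul])
    have h1 : (σ.act.ofFrames hT hl hs).toFun V h x (DefQuant.res E hV (s j)) =
        evalHom (homTo hl hV (DefQuant.res E hV (s j)))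
          (D.gam hx (DefQuant.res L hV (l 0))) := by
      rw [evalHom_homTo, D.gam_eq_act σ h hx]
      change ∑ j', hl.coord hV (σ.act.toFun V h x
        (hs.coord hV (DefQuant.res E hV (s j)) j' • DefQuant.res L hV (l 0))) 0 •
          DefQuant.res E hV (s j') = _
      rw [hcoord, Finset.sum_eq_single j]
      · rw [Pi.single_eq_same, one_smul]
      · intro j' _ hj
        rw [Pi.single_eq_of_ne hj, zero_smul, map_zero,
          hl.coord_eq hV (c := fun _ => 0) (by simp), zero_smul]
      · simp
    have h2 := hδ V h ⟨𝒜.red V x, hx⟩ (DefQuant.res E hV (s j))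
    rw [NormalConnection.toNormalEnd_apply, Finset.sum_eq_single j
      (fun j' _ hj => by rw [hcoord, Pi.single_eq_of_ne hj, zero_smul]) (by simp), hcoord,
      Pi.single_eq_same, one_smul] at h2
    exact (congrArg₂ (fun a b : SecP i E V => a + b) h1 h2).trans (add_comm _ _)
  -- Both sides obey the Leibniz rule with symbol p, so agreement on the frame is enough.
  have hA : ∀ c : Fin n → Γ(Y, i ⁻¹ᵁ V), A.toFun V h x (∑ j, c j • DefQuant.res E hV (s j)) =
      gamHom C D hV hx (homTo hl hV (∑ j, c j • DefQuant.res E hV (s j)))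
        (DefQuant.res L hV (l 0)) := by
    intro c
    let f : SecP i E V →+ SecP i E V := AddMonoidHom.mk' (fun e =>
      gamHom C D hV hx (homTo hl hV e) (DefQuant.res L hV (l 0))) fun e e' => by
        rw [homTo_add, gamHom_add]
    change _ = f _
    rw [map_sum, map_sum]
    refine Finset.sum_congr rfl fun j _ => ?_
    change _ = gamHom C D hV hx (homTo hl hV _) (DefQuant.res L hV (l 0))
    rw [A.smul_of_redY_eq_zero' hco h hx, homTo_smul, gamHom_smul, hframe, evalHom_homTo_self]
  rw [hs.eq_sum hV e]
  exact hA _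

/-- A deformation exists if the normal Atiyah class of `ℋom(L, E)` is zero, `L` has a deformation,
and `H²(Y, ℰnd(E)) = 0`. -/
lemma exists_deformation [Smooth sX] [Smooth (i ≫ sX)] (D : Deformation i 𝒜 L) (hL : IsLineBundle L) (hE : IsVectorBundle E)
    [Subsingleton (Cech.HLim (endPresheaf E) 2)]
    (h : atiyahClassN hco (isVectorBundle_homModule hL hE) = 0) :
    Nonempty (Deformation i 𝒜 E) := by
  obtain ⟨𝒲, C, hC⟩ := NormalConnection.exists_of_atiyahClassN_eq_zero h
  have hloc : ∀ y : Y, ∃ (T : Y.Opens) (hT : T ≤ 𝒲.nhd y) (l : Fin 1 → Sec L T) (_ : IsFrame L l)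
      (n : ℕ) (s : Fin n → Sec E T) (_ : IsFrame E s) (U : X.Opens) (_ : i y ∈ U)
      (_ : IsAffineOpen U) (_ : i ⁻¹ᵁ U ≤ T) (τ : 𝒜.toDualAlgebra.Splitting P U),
      Nonempty (D.Splitting τ) := fun y => by
    obtain ⟨V₁, hy₁, l, hl⟩ := hL y
    obtain ⟨V₂, hy₂, n, s, hs⟩ := hE y
    obtain ⟨U, hUT, hyU, hU, τ, hσ⟩ := D.exists_splitting_le
      (O := extOpen i (𝒲.nhd y ⊓ (V₁ ⊓ V₂))) (x := i y) (mem_extOpen.2 ⟨𝒲.mem y, hy₁, hy₂⟩)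
    exact ⟨𝒲.nhd y ⊓ (V₁ ⊓ V₂), inf_le_left, _,
      hl.restrict (inf_le_right.trans inf_le_left), n, _,
      hs.restrict (inf_le_right.trans inf_le_right), U, hyU, hU,
      (preimage_le i hUT).trans (preimage_extOpen _).le, τ, hσ⟩
  choose T hT𝒲 l hl n s hs U hyU hU hUT τ σ using hloc
  choose A hτ hA using fun y =>
    exists_act_gamHom ((C y).restrict (hT𝒲 y)) D (hU y) (σ y).some (hUT y) (hl y) (hs y)
  -- The connections agree on overlaps, and the function relating the frames l_y and l_z can be
  -- moved into the homomorphism; the two resulting homomorphisms coincide since both send l_y to e.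
  have hsame : ∀ y z, (A y).SameNormal (A z) := by
    intro y z V hy hz x e hx
    rw [hA y V hy x hx, hA z V hz x hx]
    have hVy := (preimage_le i hy).trans (hUT y)
    have hVz := (preimage_le i hz).trans (hUT z)
    have hCyz : ∀ m l', gamHom ((C y).restrict (hT𝒲 y)) D hVy hx m l' =
        gamHom ((C z).restrict (hT𝒲 z)) D hVz hx m l' := fun m l' =>
      congrArg (fun m' => evalHom m' l' + _)
        (hC y z V (hVy.trans (hT𝒲 y)) (hVz.trans (hT𝒲 z)) ⟨𝒜.red V x, hx⟩ m)
    rw [hCyz, (hl z).eq_coord_smul hVz (DefQuant.res L hVy (l y 0)), gamHom_smul_right]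
    congr 1
    refine evalHom_ext (hl z) hVz ?_
    rw [evalHom_smul, ← map_smul, ← (hl z).eq_coord_smul hVz, evalHom_homTo_self,
      evalHom_homTo_self]
  obtain ⟨D', -⟩ := exists_deformation_of_acts hyU A hsame τ hτ
    fun y => ⟨T y, hUT y, n y, s y, hs y⟩
  exact ⟨D'⟩

end AtiyahExistence

end

end DefQuant

/-! ### The theorem -/

theorem mainTheorem6 {k : Type u} [Field k] [CharZero k]
    {X Y : Scheme.{u}} (sX : X ⟶ Spec (.of k)) [Smooth sX] [IsSeparated sX] [QuasiCompact sX]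
    (i : Y ⟶ X) [IsClosedImmersion i] [Smooth (i ≫ sX)]
    (P : DefQuant.Bivector sX) (hco : P.IsCoisotropic i)
    (𝒜 : DefQuant.Quantization sX P)
    (E : Y.Modules) (hE : DefQuant.IsVectorBundle E.val) :
    (∀ D : DefQuant.Deformation i 𝒜 E.val,
      ∃ Φ : D.autGroup ≃* Multiplicative (DefQuant.LocalHom E.val E.val ⊤),
        ∀ φ : D.autGroup, D.IsOneAddEps φ.1 (Φ φ).toAdd) ∧
    ∀ (L : Y.Modules) (hL : DefQuant.IsLineBundle L.val),
      Nonempty (DefQuant.Deformation i 𝒜 L.val) →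
      Subsingleton (DefQuant.Cech.HLim (DefQuant.endPresheaf E.val) 1) →
      Subsingleton (DefQuant.Cech.HLim (DefQuant.endPresheaf E.val) 2) →
      DefQuant.atiyahClassN hco (DefQuant.isVectorBundle_homModule hL hE) = 0 →
      ∃ _ : AddTorsor (DefQuant.NormalEnd i E.val ⊤)
          (DefQuant.Deformation.IsoClasses i 𝒜 E.val),
        ∀ (D D' : DefQuant.Deformation i 𝒜 E.val) (ζ : DefQuant.NormalEnd i E.val ⊤),
          ζ +ᵥ D.isoClass = D'.isoClass ↔ D.IsTranslate D' ζ := by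
  refine ⟨fun D => D.exists_autGroup_equiv, fun L hL hDL h1 h2 hat => ?_⟩
  obtain ⟨DL⟩ := hDL
  -- ℋom(L, E) stands for E ⊗ L^∨. The deformation obtained here is the base point that makes the
  -- set of classes non-empty.
  have := DefQuant.exists_deformation DL hL hE hat
  exact DefQuant.Deformation.exists_addTorsor hco hE
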